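/- Let $d\in\{2,3\}$, $k\ge 0$, and let the element type be either simplices (reference element $\hat K$ the unit $d$-simplex) or quadrilaterals/hexahedra ($\hat K=[0,1]^d$). For every $\sigma,\tau>0$ there is $\beta_1>0$, depending only on $d$, $k$, the element type, $\sigma$ and $\tau$, such that the following holds. Let $\Omega\subset\mathbb R^d$ be a bounded Lipschitz domain with boundary $\Gamma$ and outer unit normal $\mathbf n$, and let $\Gamma_N\subseteq\Gamma$ be relatively open. Let $\mathcal T_h$ be a finite admissible mesh (two distinct elements are disjoint or meet in a common vertex, edge or face) of elements $K=\mathbf F_K(\hat K)$, where $\mathbf F_K$ is a diffeomorphism of $\hat K$ onto $K$ which is affine (simplices) or multilinear in each component (quadrilaterals/hexahedra). Put $\Omega_{\mathcal T}:=\operatorname{int}\bigcup_{K\in\mathcal T_h}K$ and assume $\overline\Omega\subsetneq\Omega_{\mathcal T}$. With $h_K:=\operatorname{diam}K$, $h:=\max_K h_K$, and $\rho_K$ the diameter of the largest ball inscribed in $K$, assume $h_K\le\sigma\rho_K$ and $h_K\ge\tau h$ for all $K$ and, for quadrilaterals/hexahedra, also $h_K\|(D\mathbf F_K)^{-1}\|\le\sigma$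 on $\hat K$. No condition is imposed on how $\Gamma$ cuts the mesh. Let $\mathcal G_h:=\{K\in\mathcal T_h:|\Gamma\cap K|\ne0\}$ and $\mathcal G_h(\Gamma_N):=\{K\in\mathcal T_h:|\Gamma_N\cap K|\neq 0\}$ ($|\cdot|$ the $(d-1)$-dimensional Hausdorff measure), $\Omega_{I,h}:=\Omega\setminus\bigcup_{K\in\mathcal G_h}K$, $\mathcal T_h(\Omega_{I,h}):=\{K\in\mathcal T_h:K\subset\overline{\Omega_{I,h}}\}$, and let $\mathcal F_h^i(\Omega_{I,h})$ be the set of facets shared by two elements of $\mathcal T_h(\Omega_{I,h})$. Let $\mathbb M_k(\hat K)=\mathbb P_k$ for simplices and $\mathbb Q_k$ for cubes, let $\mathbb{RT}_k(\hat K)$ be the Raviart–Thomas space, that is $(\mathbb P_k)^d\oplus \mathbf x\,\tilde{\mathbb P}_k$ (with $\tilde{\mathbb P}_k$ the homogeneous polynomials of degree $k$) for simplices, and for cubes the polynomial fields whose $i$-th component has degree at most $k+1$ in $x_i$ and at most $k$ in every other variable, and set $$Q_h:=\{q\in L^2(\Omega_{\mathcal T}): q|_K\circ\mathbf F_K\in\mathbb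 M_k(\hat K)\ \forall K\in\mathcal T_h\},$$ $$V_h:=\{\mathbf v\in\mathbf H(\operatorname{div};\Omega_{\mathcal T}): |\det D\mathbf F_K|\,(D\mathbf F_K)^{-1}(\mathbf v|_K\circ\mathbf F_K)\in\mathbb{RT}_k(\hat K)\ \forall K\in\mathcal T_h\},$$ $$b_1(\mathbf v,q):=\int_\Omega q\operatorname{div}\mathbf v-\int_{\Gamma_N}q\,\mathbf v\cdot\mathbf n,\qquad \|\mathbf v\|_{0,h,\Omega_{\mathcal T}}^2:=\|\mathbf v\|^2_{L^2(\Omega_{\mathcal T})}+\sum_{K\in\mathcal G_h(\Gamma_N)}h^{-1}\|\mathbf v\cdot\mathbf n\|^2_{L^2(\Gamma_N\cap K)},$$ $$\|q\|_{1,h,\Omega_{I,h}}^2:=\sum_{K\in\mathcal T_h(\Omega_{I,h})}\|\nabla q\|^2_{L^2(K)}+\sum_{f\in\mathcal F_h^i(\Omega_{I,h})}h^{-1}\|[q]\|^2_{L^2(f)},$$ where $[q]$ is the jump of $q$ across $f$ and values on $\Gamma_N$ are traces from inside $\Omega$. Then for every $q_h\in Q_h$ $$\sup_{\mathbf v_h\in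 V_h}\frac{b_1(\mathbf v_h,q_h)}{\|\mathbf v_h\|_{0,h,\Omega_{\mathcal T}}}\ \ge\ \beta_1\,\|q_h\|_{1,h,\Omega_{I,h}}$$ (the quotient being read as $0$ for $\mathbf v_h=0$). Moreover the bound is realized by interior Raviart–Thomas degrees of freedom only: there is $\mathbf v_h\in V_h$ vanishing on every element outside $\mathcal T_h(\Omega_{I,h})$ with $b_1(\mathbf v_h,q_h)=\|q_h\|^2_{1,h,\Omega_{I,h}}$ and $\beta_1\|\mathbf v_h\|_{0,h,\Omega_{\mathcal T}}\le\|q_h\|_{1,h,\Omega_{I,h}}$. -/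

import Mathlib

open scoped MeasureTheory Topology

namespace CutFEM

noncomputable section

/-- Points of `ℝᵈ` with the Euclidean norm. -/
abbrev Pt (d : ℕ) : Type := EuclideanSpace ℝ (Fin d)

/-! ### Reference elements and polynomial spaces -/

/-- The two families of elements: simplices (triangles, tetrahedra) and
images of the cube (quadrilaterals, hexahedra). -/
inductive CellKind : Type
  | simplex : CellKind
  | cube : CellKind

/-- The reference element: the unit simplex or the unit cube. -/
def refCell (κ : CellKind) (d : ℕ) : Set (Pt d) :=
  match κ with
  | CellKind.simplex => {x | (∀ i, 0 ≤ x i) ∧ ∑ i, x i ≤ 1}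
  | CellKind.cube => {x | ∀ i, 0 ≤ x i ∧ x i ≤ 1}

/-- The facets (edges if `d = 2`, faces if `d = 3`) of the reference element. -/
def refFacets (κ : CellKind) (d : ℕ) : Set (Set (Pt d)) :=
  match κ with
  | CellKind.simplex =>
      Set.range (fun i : Fin d => {x ∈ refCell CellKind.simplex d | x i = 0}) ∪
        {{x ∈ refCell CellKind.simplex d | ∑ i, x i = 1}}
  | CellKind.cube =>
      Set.range (fun i : Fin d => {x ∈ refCell CellKind.cube d | x i = 0}) ∪
        Set.range (fun i : Fin d => {x ∈ refCell CellKind.cube d | x i = 1})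

/-- The proper faces of every dimension (vertices, edges, faces) of the reference element: the
non-empty intersections of facets. -/
def refFaces (κ : CellKind) (d : ℕ) : Set (Set (Pt d)) :=
  {s | s.Nonempty ∧ ∃ S : Set (Set (Pt d)), S ⊆ refFacets κ d ∧ S.Nonempty ∧ s = ⋂₀ S}

/-- The scalar space `𝕄ₖ` on the reference element: `ℙₖ` for simplices, `ℚₖ` for cubes. -/
def scalarPoly (κ : CellKind) (d k : ℕ) : Set (MvPolynomial (Fin d) ℝ) :=
  match κ with
  | CellKind.simplex => {p | p.totalDegree ≤ k}
  | CellKind.cube => {p | ∀ j, p.degreeOf j ≤ k}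

/-- The Raviart-Thomas space `ℝ𝕋ₖ` on the reference element: `(ℙₖ)ᵈ ⊕ x ℙ̃ₖ` for simplices; for
cubes the `i`-th component has degree at most `k + 1` in the `i`-th variable and at most `k` in
the other ones. -/
def rtPoly (κ : CellKind) (d k : ℕ) : Set (Fin d → MvPolynomial (Fin d) ℝ) :=
  match κ with
  | CellKind.simplex =>
      {w | ∃ (a : Fin d → MvPolynomial (Fin d) ℝ) (b : MvPolynomial (Fin d) ℝ),
        (∀ i, (a i).totalDegree ≤ k) ∧ b.IsHomogeneous k ∧
          ∀ i, w i = a i + MvPolynomial.X i * b}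
  | CellKind.cube => {w | ∀ i j, (w i).degreeOf j ≤ if j = i then k + 1 else k}

/-- Value of a polynomial at a point. -/
def evalPoly {d : ℕ} (p : MvPolynomial (Fin d) ℝ) (x : Pt d) : ℝ :=
  MvPolynomial.eval (fun j => x j) p

/-- Value of a vector of polynomials at a point. -/
def evalVec {d : ℕ} (w : Fin d → MvPolynomial (Fin d) ℝ) (x : Pt d) : Pt d :=
  WithLp.toLp 2 (fun i => evalPoly (w i) x)

/-! ### Domains, boundary traces, weak divergence -/

/-- `Ω` is a non-empty bounded connected open set which near each of its boundary points is, in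
suitable orthonormal coordinates, the region below the graph of a Lipschitz function. -/
structure IsLipschitzDomain {d : ℕ} (Ω : Set (Pt d)) : Prop where
  isOpen : IsOpen Ω
  isConnected : IsConnected Ω
  isBounded : Bornology.IsBounded Ω
  lipschitz_boundary : ∀ x ∈ frontier Ω, ∃ (e : Pt d) (r : ℝ) (L : NNReal) (γ : Pt d → ℝ),
    ‖e‖ = 1 ∧ 0 < r ∧ LipschitzWith L γ ∧
      ∀ y ∈ Metric.ball x r, y ∈ Ω ↔ inner ℝ e y < γ (y - inner ℝ e y • e)

/-- `n` is the exterior unit normal to `Ω` at `x` (in the sense of Federer): near `x` the set `Ω`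
fills, up to density zero, exactly the half space `{y | ⟪y - x, n⟫ < 0}`. -/
def IsOuterNormal {d : ℕ} (Ω : Set (Pt d)) (x n : Pt d) : Prop :=
  ‖n‖ = 1 ∧
  Filter.Tendsto (fun r : ℝ =>
      MeasureTheory.volume {y ∈ Metric.ball x r ∩ Ω | 0 < inner ℝ (y - x) n} /
        MeasureTheory.volume (Metric.ball x r)) (𝓝[>] 0) (𝓝 0) ∧
  Filter.Tendsto (fun r : ℝ =>
      MeasureTheory.volume {y ∈ Metric.ball x r \ Ω | inner ℝ (y - x) n < 0} /
        MeasureTheory.volume (Metric.ball x r)) (𝓝[>] 0) (𝓝 0)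

open Classical in
/-- The exterior unit normal field of `Ω` (zero where there is none; on the boundary of a
Lipschitz domain it exists almost everywhere). -/
def outerNormal {d : ℕ} (Ω : Set (Pt d)) (x : Pt d) : Pt d :=
  if h : ∃ n, IsOuterNormal Ω x n then h.choose else 0

open Classical in
/-- The trace at `x` of `u` from inside `Ω`: the limit of the averages of `u` over `B(x,r) ∩ Ω`
(zero where the limit does not exist, which for piecewise smooth `u` and Lipschitz `Ω` is a null
set of the boundary). -/
def innerTrace {d : ℕ} {W : Type*} [NormedAddCommGroup W] [NormedSpace ℝ W]
    (Ω : Set (Pt d)) (u : Pt d → W) (x : Pt d) : W :=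
  if h : ∃ l, Filter.Tendsto (fun r : ℝ => ⨍ y in Metric.ball x r ∩ Ω, u y) (𝓝[>] 0) (𝓝 l)
  then h.choose else 0

/-- `g` is a weak divergence of `v` on the open set `U`, and is in `L²(U)`. -/
def IsWeakDiv {d : ℕ} (U : Set (Pt d)) (v : Pt d → Pt d) (g : Pt d → ℝ) : Prop :=
  MeasureTheory.MemLp g 2 (MeasureTheory.volume.restrict U) ∧
  ∀ φ : Pt d → ℝ, ContDiff ℝ (⊤ : ℕ∞) φ → HasCompactSupport φ → tsupport φ ⊆ U →
    ∫ x in U, inner ℝ (v x) (gradient φ x) = - ∫ x in U, g x * φ x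

/-- `v ∈ H(div; U)`. -/
def MemHdiv {d : ℕ} (U : Set (Pt d)) (v : Pt d → Pt d) : Prop :=
  MeasureTheory.MemLp v 2 (MeasureTheory.volume.restrict U) ∧ ∃ g, IsWeakDiv U v g

open Classical in
/-- The weak divergence of `v ∈ H(div; U)`, as a function defined almost everywhere on `U`. -/
def weakDiv {d : ℕ} (U : Set (Pt d)) (v : Pt d → Pt d) : Pt d → ℝ :=
  if h : ∃ g, IsWeakDiv U v g then h.choose else 0

/-! ### Meshes -/

/-- An admissible mesh of simplices or of (multilinear images of) cubes in `ℝᵈ`. The elements are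
`F i '' refCell κ d`, where `F i` is affine (simplices), respectively componentwise multilinear
(cubes), and is a diffeomorphism of the reference element onto its image. Two distinct elements
are disjoint or meet in a common proper face, on which the two maps agree up to an affine change
of the reference variable (as they do whenever the intersection is a face of both elements: the
vertices, in their cyclic order, determine an affine or multilinear map on a face). -/
structure Mesh (κ : CellKind) (d : ℕ) where
  /-- number of elements -/
  card : ℕ
  /-- the maps from the reference element -/
  F : Fin card → Pt d → Pt d
  F_poly : ∀ i, ∃ w : Fin d → MvPolynomial (Fin d) ℝ,
    (∀ a, w a ∈ scalarPoly κ d 1) ∧ ∀ x, F i x = evalVec w x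
  F_injOn : ∀ i, Set.InjOn (F i) (refCell κ d)
  F_det : ∀ i, ∀ x ∈ refCell κ d, (fderiv ℝ (F i) x).det ≠ 0
  admissible : ∀ i j, i ≠ j →
    F i '' refCell κ d ∩ F j '' refCell κ d = ∅ ∨
      ∃ s ∈ refFaces κ d, ∃ s' ∈ refFaces κ d, ∃ A : Pt d →ᵃ[ℝ] Pt d,
        A '' s = s' ∧ (∀ x ∈ s, F i x = F j (A x)) ∧
          F i '' refCell κ d ∩ F j '' refCell κ d = F i '' s

namespace Mesh

variable {κ : CellKind} {d : ℕ} (T : Mesh κ d)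

/-- The `i`-th (closed) element `K`. -/
def cell (i : Fin T.card) : Set (Pt d) := T.F i '' refCell κ d

/-- The fictitious domain `Ω_𝒯`, the interior of the union of the elements. -/
def domain : Set (Pt d) := interior (⋃ i, T.cell i)

/-- The mesh size `h`, the largest diameter of an element. -/
def h : ℝ := ⨆ i, Metric.diam (T.cell i)

/-- The diameter `ρ_K` of the largest ball inscribed in the `i`-th element. -/
def rho (i : Fin T.card) : ℝ := sSup {δ : ℝ | ∃ c, Metric.ball c (δ / 2) ⊆ T.cell i}

/-- Shape regularity with constant `σ`: `h_K ≤ σ ρ_K`, and, for images of cubes, also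
`h_K ‖(D F_K)⁻¹‖ ≤ σ` on the reference element (for affine `F_K` the second condition follows
from the first one up to a change of the constant). -/
def ShapeRegular (σ : ℝ) : Prop :=
  (∀ i, Metric.diam (T.cell i) ≤ σ * T.rho i) ∧
  (κ = CellKind.cube → ∀ i, ∀ x ∈ refCell κ d, ∀ u : Pt d,
    Metric.diam (T.cell i) * ‖u‖ ≤ σ * ‖fderiv ℝ (T.F i) x u‖)

/-- Quasi-uniformity with constant `τ`: `h_K ≥ τ h`. -/
def QuasiUniform (τ : ℝ) : Prop := ∀ i, τ * T.h ≤ Metric.diam (T.cell i)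

/-- The element `K` is cut by the part `Γ'` of the boundary: `|Γ' ∩ K| ≠ 0`. -/
def IsCut (Γ' : Set (Pt d)) (i : Fin T.card) : Prop := μHE[d - 1] (Γ' ∩ T.cell i) ≠ 0

/-- The interior part `Ω_{I,h}`: `Ω` without the elements cut by its boundary. -/
def innerPart (Ω : Set (Pt d)) : Set (Pt d) :=
  Ω \ ⋃ i ∈ {i | T.IsCut (frontier Ω) i}, T.cell i

/-- `K ∈ 𝒯_h(Ω_{I,h})`. -/
def IsInner (Ω : Set (Pt d)) (i : Fin T.card) : Prop := T.cell i ⊆ closure (T.innerPart Ω)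

/-- The elements `i` and `j` share a facet, which then is `T.cell i ∩ T.cell j`. -/
def ShareFacet (i j : Fin T.card) : Prop :=
  (∃ f ∈ refFacets κ d, T.cell i ∩ T.cell j = T.F i '' f) ∧
    ∃ f ∈ refFacets κ d, T.cell i ∩ T.cell j = T.F j '' f

/-- The function on `Ω_𝒯`, defined almost everywhere, with the given restrictions to the
elements. -/
def glue {W : Type*} [AddCommMonoid W] (u : Fin T.card → Pt d → W) (x : Pt d) : W :=
  ∑ i, (interior (T.cell i)).indicator (u i) x

/-- The pressure space `Q_h`. A function is given by its restrictions `q i` to the elements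
(only the values of `q i` on `T.cell i` matter). -/
def pressureSpace (k : ℕ) : Set (Fin T.card → Pt d → ℝ) :=
  {q | ∀ i, ∃ p ∈ scalarPoly κ d k, ∀ x ∈ refCell κ d, q i (T.F i x) = evalPoly p x}

/-- The velocity space `V_h`: fields in `H(div; Ω_𝒯)` whose restriction `v i` to each element is
the contravariant Piola transform of a Raviart-Thomas polynomial field. -/
def velocitySpace (k : ℕ) : Set (Fin T.card → Pt d → Pt d) :=
  {v | (∀ i, ∃ w ∈ rtPoly κ d k, ∀ x ∈ refCell κ d,
      v i (T.F i x) = |(fderiv ℝ (T.F i) x).det|⁻¹ • fderiv ℝ (T.F i) x (evalVec w x)) ∧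
    MemHdiv T.domain (T.glue v)}

/-- `b₁(v, q) = ∫_Ω q div v - ∫_{Γ_N} q v·n`. -/
def b₁ (Ω ΓN : Set (Pt d)) (v : Fin T.card → Pt d → Pt d) (q : Fin T.card → Pt d → ℝ) : ℝ :=
  (∫ x in Ω, T.glue q x * weakDiv T.domain (T.glue v) x) -
    ∫ x in ΓN, innerTrace Ω (T.glue q) x *
      inner ℝ (innerTrace Ω (T.glue v) x) (outerNormal Ω x) ∂μHE[d - 1]

open Classical in
/-- The norm `‖v‖_{0,h,Ω_𝒯}`. -/
def velocityNorm (Ω ΓN : Set (Pt d)) (v : Fin T.card → Pt d → Pt d) : ℝ :=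
  √((∫ x in T.domain, ‖T.glue v x‖ ^ 2) +
    ∑ i, if T.IsCut ΓN i then
      T.h⁻¹ * ∫ x in ΓN ∩ T.cell i,
        (inner ℝ (innerTrace Ω (T.glue v) x) (outerNormal Ω x)) ^ 2 ∂μHE[d - 1]
    else 0)

open Classical in
/-- The seminorm `‖q‖_{1,h,Ω_{I,h}}`. The interior facets of `𝒯_h(Ω_{I,h})` are the
`T.cell i ∩ T.cell j` with `i < j` inner elements that share a facet. -/
def pressureNorm (Ω : Set (Pt d)) (q : Fin T.card → Pt d → ℝ) : ℝ :=
  √((∑ i, if T.IsInner Ω i then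
      ∫ x in interior (T.cell i), ‖gradient (q i) x‖ ^ 2 else 0) +
    ∑ i, ∑ j, if i < j ∧ T.IsInner Ω i ∧ T.IsInner Ω j ∧ T.ShareFacet i j then
      T.h⁻¹ * ∫ x in T.cell i ∩ T.cell j, (q i x - q j x) ^ 2 ∂μHE[d - 1]
    else 0)

end Mesh

end

end CutFEM

/-!
For a discrete pressure `q` an explicit discrete velocity is built, supported on the elements of
`𝒯_h(Ω_{I,h})`, whose pairing with `q` controls the energy of `q`. Let `r` be the pull-back of `q`
to the reference element `K̂`.

*Local fields.* On the simplex the field with components `x j * (∂ j r - ∑ l, x l * ∂ l r)`, and on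
the cube the one with components `x j * (1 - x j) * ∂ j r`, belongs to the Raviart-Thomas space and
has no normal flux through the boundary of `K̂` (`bubbleField`). Tested against `∇r` it controls
`‖∇r‖²` in `L²(K̂)`, by the Cauchy-Schwarz inequality on the simplex and the equivalence of norms on
polynomials of bounded degree (`exists_bubbleField_coercive`). The lowest order Raviart-Thomas field
of a facet, times the jump of `q` across this facet extended constantly in one coordinate direction,
has this jump as its normal flux through the facet and no flux through the others
(`integral_flux_facetField`). The local velocity is a large negative multiple `-M` of the bubble
field plus the facet fields of all facets shared with other interior elements (`localField`).
Integration by parts on `K̂` gives the jump terms from the facet fields and the gradient term from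
the bubble field; the interaction of `∇r` with the facet fields is absorbed by Young's inequality
and the choice of `M` (`exists_localField_estimates`). This needs a bound on the number of
neighbours of an element, which follows by comparing volumes (`exists_card_le_of_inter_nonempty`).

*Conformity.* The two parametrizations of a shared facet by the reference element of one dimension
less differ by an affine bijection `B` of the latter (`exists_affine_facet_matching`). It has
determinant `±1`, so it preserves integrals, and it preserves the polynomial spaces; for `ℚ_k` this
holds because an affine bijection of the cube is a signed permutation of the coordinates
(`linear_single_unique_of_cube`). So the normal fluxes of the two local velocities cancel
(`JumpData.flux_antisymm`), and their Piola transforms form a field with a weak divergence in `L²`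
(`isWeakDiv_glue_piola`).

*Scaling.* Shape regularity and quasi-uniformity make the element maps bi-Lipschitz at scale `h`,
with constants depending only on `σ`, `τ` and the dimension (`isScaled`). This transfers the
estimates to the mesh.

*The boundary.* Interior elements are not cut by the boundary of `Ω`
(`IsInner.hausdorff_eq_zero`). A field supported on them has zero trace at almost every boundary
point, so that all boundary terms in the form and in the norm of the velocity vanish
(`b₁_eq_of_interior`, `velocityNorm_eq_of_interior`). Multiplying the velocity by a constant gives
the required normalization.
-/

namespace CutFEM

open MeasureTheory

/-! ### Calculus of polynomials evaluated at points -/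

section Poly

variable {d : ℕ}

@[simp] lemma evalPoly_add (p q : MvPolynomial (Fin d) ℝ) (x : Pt d) :
    evalPoly (p + q) x = evalPoly p x + evalPoly q x := by simp [evalPoly]

@[simp] lemma evalPoly_sub (p q : MvPolynomial (Fin d) ℝ) (x : Pt d) :
    evalPoly (p - q) x = evalPoly p x - evalPoly q x := by simp [evalPoly]

@[simp] lemma evalPoly_mul (p q : MvPolynomial (Fin d) ℝ) (x : Pt d) :
    evalPoly (p * q) x = evalPoly p x * evalPoly q x := by simp [evalPoly]

@[simp] lemma evalPoly_C (a : ℝ) (x : Pt d) :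
    evalPoly (MvPolynomial.C a) x = a := by simp [evalPoly]

@[simp] lemma evalPoly_one (x : Pt d) :
    evalPoly (1 : MvPolynomial (Fin d) ℝ) x = 1 := by simp [evalPoly]

@[simp] lemma evalPoly_zero (x : Pt d) :
    evalPoly (0 : MvPolynomial (Fin d) ℝ) x = 0 := by simp [evalPoly]

@[simp] lemma evalPoly_X (i : Fin d) (x : Pt d) :
    evalPoly (MvPolynomial.X i) x = x i := by simp [evalPoly]

@[simp] lemma evalPoly_smul (a : ℝ) (p : MvPolynomial (Fin d) ℝ) (x : Pt d) :
    evalPoly (a • p) x = a * evalPoly p x := by simp [evalPoly]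

@[simp] lemma evalPoly_sum {ι : Type*} (s : Finset ι) (p : ι → MvPolynomial (Fin d) ℝ) (x : Pt d) :
    evalPoly (∑ i ∈ s, p i) x = ∑ i ∈ s, evalPoly (p i) x := by simp [evalPoly]

@[simp] lemma evalVec_apply (w : Fin d → MvPolynomial (Fin d) ℝ) (x : Pt d) (i : Fin d) :
    evalVec w x i = evalPoly (w i) x := rfl

lemma evalVec_add (v w : Fin d → MvPolynomial (Fin d) ℝ) (x : Pt d) :
    evalVec (v + w) x = evalVec v x + evalVec w x := by ext i; simp

lemma evalVec_smul (a : ℝ) (w : Fin d → MvPolynomial (Fin d) ℝ) (x : Pt d) :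
    evalVec (a • w) x = a • evalVec w x := by ext i; simp

lemma evalVec_sum {ι : Type*} (s : Finset ι) (w : ι → Fin d → MvPolynomial (Fin d) ℝ) (x : Pt d) :
    evalVec (∑ i ∈ s, w i) x = ∑ i ∈ s, evalVec (w i) x := by
  ext i; simp [WithLp.ofLp_sum, Finset.sum_apply]

@[simp] lemma evalVec_zero (x : Pt d) :
    evalVec (0 : Fin d → MvPolynomial (Fin d) ℝ) x = 0 := by ext i; simp

lemma hasFDerivAt_evalPoly (p : MvPolynomial (Fin d) ℝ) (x : Pt d) :
    HasFDerivAt (evalPoly p)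
      (∑ i, evalPoly (MvPolynomial.pderiv i p) x • (EuclideanSpace.proj i : Pt d →L[ℝ] ℝ)) x := by
  induction p using MvPolynomial.induction_on with
  | C a =>
    have : evalPoly (MvPolynomial.C a) = fun _ : Pt d => a := by ext; simp
    rw [this]
    simpa using hasFDerivAt_const a x
  | add p q hp hq =>
    have : evalPoly (p + q) = fun y : Pt d => evalPoly p y + evalPoly q y := by ext; simp
    rw [this]
    refine (hp.add hq).congr_fderiv ?_
    simp [add_smul, Finset.sum_add_distrib]
  | mul_X p j hp =>
    have : evalPoly (p * MvPolynomial.X j) = fun y : Pt d =>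
      evalPoly p y * (EuclideanSpace.proj j : Pt d →L[ℝ] ℝ) y := by ext; simp
    rw [this]
    refine (hp.mul (EuclideanSpace.proj j : Pt d →L[ℝ] ℝ).hasFDerivAt).congr_fderiv ?_
    ext v
    simp [MvPolynomial.pderiv_X, Finset.sum_add_distrib, add_mul,
      Pi.single_apply, Finset.mul_sum, apply_ite (evalPoly (d := d) · x), mul_ite, ite_mul]
    exact Finset.sum_congr rfl fun i _ => by ring

lemma fderiv_evalPoly_apply (p : MvPolynomial (Fin d) ℝ) (x v : Pt d) :
    fderiv ℝ (evalPoly p) x v = ∑ i, evalPoly (MvPolynomial.pderiv i p) x * v i := by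
  rw [(hasFDerivAt_evalPoly p x).fderiv]
  simp

lemma contDiff_evalPoly {m : WithTop ℕ∞} (p : MvPolynomial (Fin d) ℝ) :
    ContDiff ℝ m (evalPoly p) := by
  induction p using MvPolynomial.induction_on with
  | C a =>
    have : evalPoly (MvPolynomial.C a) = fun _ : Pt d => a := by ext; simp
    rw [this]; exact contDiff_const
  | add p q hp hq =>
    have : evalPoly (p + q) = fun y : Pt d => evalPoly p y + evalPoly q y := by ext; simp
    rw [this]; exact hp.add hq
  | mul_X p j hp =>
    have : evalPoly (p * MvPolynomial.X j) = fun y : Pt d =>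
      evalPoly p y * (EuclideanSpace.proj j : Pt d →L[ℝ] ℝ) y := by ext; simp
    rw [this]; exact hp.mul (EuclideanSpace.proj j : Pt d →L[ℝ] ℝ).contDiff

@[fun_prop] lemma continuous_evalPoly (p : MvPolynomial (Fin d) ℝ) : Continuous (evalPoly p) :=
  (contDiff_evalPoly (m := 0) p).continuous

@[fun_prop] lemma differentiable_evalPoly (p : MvPolynomial (Fin d) ℝ) :
    Differentiable ℝ (evalPoly p) :=
  (contDiff_evalPoly (m := 1) p).differentiable (by simp)

lemma contDiff_evalVec {m : WithTop ℕ∞} (w : Fin d → MvPolynomial (Fin d) ℝ) :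
    ContDiff ℝ m (evalVec w) := by
  rw [contDiff_euclidean]
  intro i
  exact contDiff_evalPoly (w i)

@[fun_prop] lemma continuous_evalVec (w : Fin d → MvPolynomial (Fin d) ℝ) :
    Continuous (evalVec w) := (contDiff_evalVec (m := 0) w).continuous

/-- The gradient of a polynomial, as a vector of polynomials. -/
noncomputable def gradP (p : MvPolynomial (Fin d) ℝ) : Fin d → MvPolynomial (Fin d) ℝ :=
  fun i => MvPolynomial.pderiv i p

/-- The divergence of a vector of polynomials. -/
noncomputable def divP (w : Fin d → MvPolynomial (Fin d) ℝ) : MvPolynomial (Fin d) ℝ :=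
  ∑ i, MvPolynomial.pderiv i (w i)

lemma fderiv_evalPoly_eq_inner (p : MvPolynomial (Fin d) ℝ) (x v : Pt d) :
    fderiv ℝ (evalPoly p) x v = inner ℝ (evalVec (gradP p) x) v := by
  rw [fderiv_evalPoly_apply]
  simp [PiLp.inner_apply, gradP, mul_comm]

lemma inner_gradient_eq_fderiv {ψ : Pt d → ℝ} {x : Pt d} (v : Pt d) :
    inner ℝ v (gradient ψ x) = fderiv ℝ ψ x v := by
  rw [real_inner_comm, gradient, InnerProductSpace.toDual_symm_apply]

/-! ### Degrees -/

lemma degreeOf_pderiv_le (i j : Fin d) (p : MvPolynomial (Fin d) ℝ) :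
    (MvPolynomial.pderiv i p).degreeOf j ≤ p.degreeOf j - if j = i then 1 else 0 := by
  rw [MvPolynomial.degreeOf_eq_sup, Finset.sup_le_iff]
  intro m hm
  rw [MvPolynomial.mem_support_iff, MvPolynomial.coeff_pderiv] at hm
  have h1 : m + Finsupp.single i 1 ∈ p.support := by
    rw [MvPolynomial.mem_support_iff]; exact left_ne_zero_of_mul hm
  have h2 := MvPolynomial.monomial_le_degreeOf j h1
  split_ifs with h
  · subst h; simp at h2; omega
  · rw [Finsupp.add_apply, Finsupp.single_eq_of_ne h] at h2; omega

lemma pderiv_eq_zero_of_degreeOf_eq_zero {i : Fin d} {p : MvPolynomial (Fin d) ℝ}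
    (h : p.degreeOf i = 0) : MvPolynomial.pderiv i p = 0 := by
  ext m
  rw [MvPolynomial.coeff_pderiv]
  by_contra hm
  have h1 : m + Finsupp.single i 1 ∈ p.support := by
    rw [MvPolynomial.mem_support_iff]; exact left_ne_zero_of_mul hm
  have h2 := MvPolynomial.monomial_le_degreeOf i h1
  simp at h2; omega

lemma totalDegree_pderiv_le (i : Fin d) (p : MvPolynomial (Fin d) ℝ) :
    (MvPolynomial.pderiv i p).totalDegree ≤ p.totalDegree - 1 := by
  rw [MvPolynomial.totalDegree, Finset.sup_le_iff]
  intro m hm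
  rw [MvPolynomial.mem_support_iff, MvPolynomial.coeff_pderiv] at hm
  have h1 : m + Finsupp.single i 1 ∈ p.support := by
    rw [MvPolynomial.mem_support_iff]; exact left_ne_zero_of_mul hm
  have h2 := MvPolynomial.le_totalDegree h1
  rw [Finsupp.sum_add_index' (by simp) (by simp)] at h2
  simp at h2; omega

lemma totalDegree_X_mul_pderiv_le (i : Fin d) (p : MvPolynomial (Fin d) ℝ) :
    (MvPolynomial.X i * MvPolynomial.pderiv i p).totalDegree ≤ p.totalDegree := by
  by_cases h : p.totalDegree = 0
  · have : MvPolynomial.pderiv i p = 0 :=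
      pderiv_eq_zero_of_degreeOf_eq_zero
        (Nat.le_zero.1 (h ▸ MvPolynomial.degreeOf_le_totalDegree p i))
    simp [this]
  · have h1 := MvPolynomial.totalDegree_mul (MvPolynomial.X i) (MvPolynomial.pderiv i p)
    have h2 := totalDegree_pderiv_le i p
    rw [MvPolynomial.totalDegree_X] at h1
    omega

lemma totalDegree_le_of_degreeOf_le {k : ℕ} {p : MvPolynomial (Fin d) ℝ}
    (h : ∀ j, p.degreeOf j ≤ k) : p.totalDegree ≤ d * k := by
  rw [MvPolynomial.totalDegree, Finset.sup_le_iff]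
  intro m hm
  rw [Finsupp.sum_fintype _ _ (by simp)]
  calc ∑ i, m i ≤ ∑ _i : Fin d, k :=
        Finset.sum_le_sum fun i _ => (MvPolynomial.monomial_le_degreeOf i hm).trans (h i)
    _ = d * k := by simp

lemma totalDegree_X_mul_sub_homogeneousComponent_le {k : ℕ} {p : MvPolynomial (Fin d) ℝ}
    (hp : p.totalDegree ≤ k) (i : Fin d) :
    (MvPolynomial.X i * (p - MvPolynomial.homogeneousComponent k p)).totalDegree ≤ k := by
  have h1 : p = ∑ j ∈ Finset.range (k + 1), MvPolynomial.homogeneousComponent j p := by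
    conv_lhs => rw [← MvPolynomial.sum_homogeneousComponent p]
    refine Finset.sum_subset ?_ ?_
    · intro j hj; simp at hj ⊢; omega
    · intro j _ hj; simp at hj
      exact MvPolynomial.homogeneousComponent_eq_zero _ _ (by omega)
  have h2 : p - MvPolynomial.homogeneousComponent k p =
      ∑ j ∈ Finset.range k, MvPolynomial.homogeneousComponent j p := by
    rw [Finset.sum_range_succ] at h1
    exact sub_eq_of_eq_add h1
  rw [h2, Finset.mul_sum]
  refine MvPolynomial.totalDegree_finsetSum_le fun j hj => ?_
  refine (MvPolynomial.totalDegree_mul _ _).trans ?_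
  rw [MvPolynomial.totalDegree_X]
  have := (MvPolynomial.homogeneousComponent_isHomogeneous j p).totalDegree_le
  simp at hj; omega

/-! ### Closure properties of the polynomial spaces -/

lemma scalarPoly_totalDegree_le {κ : CellKind} {k : ℕ} {p : MvPolynomial (Fin d) ℝ}
    (hp : p ∈ scalarPoly κ d k) : p.totalDegree ≤ (d + 1) * k := by
  cases κ with
  | simplex => exact le_trans hp (Nat.le_mul_of_pos_left _ (by omega))
  | cube => exact (totalDegree_le_of_degreeOf_le hp).trans (Nat.mul_le_mul_right _ (by omega))

lemma sub_mem_scalarPoly {κ : CellKind} {k : ℕ} {p q : MvPolynomial (Fin d) ℝ}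
    (hp : p ∈ scalarPoly κ d k) (hq : q ∈ scalarPoly κ d k) : p - q ∈ scalarPoly κ d k := by
  cases κ with
  | simplex => exact (MvPolynomial.totalDegree_sub _ _).trans (max_le hp hq)
  | cube => exact fun j => (MvPolynomial.degreeOf_sub_le _ _ _).trans (max_le (hp j) (hq j))

lemma zero_mem_rtPoly (κ : CellKind) (k : ℕ) : 0 ∈ rtPoly κ d k := by
  cases κ with
  | simplex => exact ⟨0, 0, by simp, MvPolynomial.isHomogeneous_zero _ _ _, by simp⟩
  | cube => intro i j; simp

lemma add_mem_rtPoly {κ : CellKind} {k : ℕ} {v w : Fin d → MvPolynomial (Fin d) ℝ}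
    (hv : v ∈ rtPoly κ d k) (hw : w ∈ rtPoly κ d k) : v + w ∈ rtPoly κ d k := by
  cases κ with
  | simplex =>
    obtain ⟨a, b, ha, hb, h⟩ := hv
    obtain ⟨a', b', ha', hb', h'⟩ := hw
    refine ⟨a + a', b + b', fun i => (MvPolynomial.totalDegree_add _ _).trans
      (max_le (ha i) (ha' i)), hb.add hb', fun i => ?_⟩
    simp only [Pi.add_apply, h, h']; ring
  | cube =>
    exact fun i j => (MvPolynomial.degreeOf_add_le _ _ _).trans (max_le (hv i j) (hw i j))

lemma smul_mem_rtPoly {κ : CellKind} {k : ℕ} (t : ℝ) {w : Fin d → MvPolynomial (Fin d) ℝ}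
    (hw : w ∈ rtPoly κ d k) : t • w ∈ rtPoly κ d k := by
  cases κ with
  | simplex =>
    obtain ⟨a, b, ha, hb, h⟩ := hw
    refine ⟨t • a, t • b, fun i => (MvPolynomial.totalDegree_smul_le _ _).trans (ha i), ?_,
      fun i => ?_⟩
    · rw [MvPolynomial.smul_eq_C_mul]
      simpa using (MvPolynomial.isHomogeneous_C (Fin d) t).mul hb
    · simp only [Pi.smul_apply, h, smul_add, mul_smul_comm]
  | cube =>
    intro i j
    rw [Pi.smul_apply, MvPolynomial.smul_eq_C_mul]
    exact (MvPolynomial.degreeOf_C_mul_le _ _ _).trans (hw i j)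

lemma sum_mem_rtPoly {κ : CellKind} {k : ℕ} {ι : Type*} (s : Finset ι)
    {w : ι → Fin d → MvPolynomial (Fin d) ℝ} (hw : ∀ i ∈ s, w i ∈ rtPoly κ d k) :
    ∑ i ∈ s, w i ∈ rtPoly κ d k :=
  Finset.sum_induction _ (· ∈ rtPoly κ d k) (fun _ _ => add_mem_rtPoly) (zero_mem_rtPoly κ k) hw

/-- The lowest order Raviart-Thomas field with unit flux through one facet and none through the
others. On the cube, `(i, false)` and `(i, true)` stand for the facets `x i = 0` and `x i = 1`; on
the simplex, `(i, false)` stands for `x i = 0`, while all the `(i, true)` stand for the facet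
`∑ x = 1`. -/
noncomputable def facetField (κ : CellKind) (f : Fin d × Bool) (j : Fin d) :
    MvPolynomial (Fin d) ℝ :=
  match κ with
  | CellKind.simplex => MvPolynomial.X j - if j = f.1 ∧ f.2 = false then 1 else 0
  | CellKind.cube => if j = f.1 then MvPolynomial.X j - if f.2 = false then 1 else 0 else 0

lemma mul_facetField_mem_rtPoly {κ : CellKind} {k : ℕ} (f : Fin d × Bool)
    {r : MvPolynomial (Fin d) ℝ} (hr : r ∈ scalarPoly κ d k) :
    (fun j => r * facetField κ f j) ∈ rtPoly κ d k := by
  cases κ with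
  | simplex =>
    refine ⟨fun j => MvPolynomial.X j * (r - MvPolynomial.homogeneousComponent k r) -
      r * if j = f.1 ∧ f.2 = false then 1 else 0, MvPolynomial.homogeneousComponent k r, ?_,
      MvPolynomial.homogeneousComponent_isHomogeneous _ _, fun j => ?_⟩
    · intro i
      refine (MvPolynomial.totalDegree_sub _ _).trans (max_le
        (totalDegree_X_mul_sub_homogeneousComponent_le hr i) ?_)
      split_ifs
      · rw [mul_one]; exact hr
      · simp
    · simp only [facetField]; ring
  | cube =>
    intro i j
    simp only [facetField]
    by_cases hi : i = f.1
    · rw [if_pos hi]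
      refine (MvPolynomial.degreeOf_mul_le _ _ _).trans ?_
      have h1 := hr j
      have h2 : (MvPolynomial.X i - if f.2 = false then 1 else 0 :
          MvPolynomial (Fin d) ℝ).degreeOf j ≤ if j = i then 1 else 0 := by
        refine (MvPolynomial.degreeOf_sub_le _ _ _).trans (max_le ?_ ?_)
        · rw [MvPolynomial.degreeOf_X]
        · split_ifs <;> simp
      split_ifs at h2 ⊢ <;> omega
    · simp [hi]

/-- A field of the Raviart-Thomas space, linear in `∇r`, whose normal component vanishes on the
whole boundary of the reference element. -/
noncomputable def bubbleField (κ : CellKind) (r : MvPolynomial (Fin d) ℝ) (j : Fin d) :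
    MvPolynomial (Fin d) ℝ :=
  match κ with
  | CellKind.simplex => MvPolynomial.X j *
      (MvPolynomial.pderiv j r - ∑ l, MvPolynomial.X l * MvPolynomial.pderiv l r)
  | CellKind.cube => MvPolynomial.X j * (1 - MvPolynomial.X j) * MvPolynomial.pderiv j r

lemma bubbleField_mem_rtPoly {κ : CellKind} {k : ℕ} {r : MvPolynomial (Fin d) ℝ}
    (hr : r ∈ scalarPoly κ d k) : bubbleField κ r ∈ rtPoly κ d k := by
  cases κ with
  | simplex =>
    set s := ∑ l, MvPolynomial.X l * MvPolynomial.pderiv l r with hs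
    have hs' : s.totalDegree ≤ k := MvPolynomial.totalDegree_finsetSum_le fun l _ =>
      (totalDegree_X_mul_pderiv_le l r).trans hr
    refine ⟨fun j => MvPolynomial.X j * MvPolynomial.pderiv j r -
      MvPolynomial.X j * (s - MvPolynomial.homogeneousComponent k s),
      -MvPolynomial.homogeneousComponent k s, fun i => ?_,
      (MvPolynomial.homogeneousComponent_isHomogeneous _ _).neg, fun j => ?_⟩
    · exact (MvPolynomial.totalDegree_sub _ _).trans (max_le
        ((totalDegree_X_mul_pderiv_le i r).trans hr)
        (totalDegree_X_mul_sub_homogeneousComponent_le hs' i))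
    · simp only [bubbleField, ← hs]; ring
  | cube =>
    intro i j
    simp only [bubbleField]
    by_cases h0 : MvPolynomial.pderiv i r = 0
    · simp [h0]
    have h1 := degreeOf_pderiv_le i j r
    have h2 := hr j
    have h3 : (1 - MvPolynomial.X i : MvPolynomial (Fin d) ℝ).degreeOf j ≤
        if j = i then 1 else 0 := by
      refine (MvPolynomial.degreeOf_sub_le _ _ _).trans (max_le (by simp) ?_)
      rw [MvPolynomial.degreeOf_X]
    have h4 : (MvPolynomial.X i : MvPolynomial (Fin d) ℝ).degreeOf j ≤
        if j = i then 1 else 0 := by rw [MvPolynomial.degreeOf_X]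
    have h5 := MvPolynomial.degreeOf_mul_le j (MvPolynomial.X i * (1 - MvPolynomial.X i))
      (MvPolynomial.pderiv i r)
    have h6 := MvPolynomial.degreeOf_mul_le j (MvPolynomial.X i : MvPolynomial (Fin d) ℝ)
      (1 - MvPolynomial.X i)
    have h7 : j = i → r.degreeOf j ≠ 0 := by
      rintro rfl h
      exact h0 (pderiv_eq_zero_of_degreeOf_eq_zero h)
    split_ifs at * with h
    · have := h7 h; omega
    · omega

/-! ### Substitution in the scalar spaces -/

lemma totalDegree_bind₁_le {e k : ℕ} {p : MvPolynomial (Fin e) ℝ}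
    {g : Fin e → MvPolynomial (Fin d) ℝ} (hp : p.totalDegree ≤ k)
    (hg : ∀ l, (g l).totalDegree ≤ 1) : (MvPolynomial.bind₁ g p).totalDegree ≤ k := by
  rw [MvPolynomial.bind₁, MvPolynomial.aeval_def, MvPolynomial.eval₂_eq]
  refine MvPolynomial.totalDegree_finsetSum_le fun m hm => ?_
  refine (MvPolynomial.totalDegree_mul _ _).trans ?_
  rw [MvPolynomial.algebraMap_eq, MvPolynomial.totalDegree_C, zero_add]
  refine (MvPolynomial.totalDegree_finsetProd _ _).trans ?_
  refine le_trans ?_ ((MvPolynomial.le_totalDegree hm).trans hp)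
  rw [Finsupp.sum]
  refine Finset.sum_le_sum fun i _ => ?_
  exact (MvPolynomial.totalDegree_pow _ _).trans (by simpa using Nat.mul_le_mul_left (m i) (hg i))

lemma degreeOf_bind₁_le {e k : ℕ} {p : MvPolynomial (Fin e) ℝ}
    {g : Fin e → MvPolynomial (Fin d) ℝ} (hp : ∀ l, p.degreeOf l ≤ k) (j : Fin d) (l₀ : Fin e)
    (hg : (g l₀).degreeOf j ≤ 1) (hg' : ∀ l, l ≠ l₀ → (g l).degreeOf j = 0) :
    (MvPolynomial.bind₁ g p).degreeOf j ≤ k := by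
  rw [MvPolynomial.bind₁, MvPolynomial.aeval_def, MvPolynomial.eval₂_eq]
  refine (MvPolynomial.degreeOf_sum_le _ _ _).trans (Finset.sup_le fun m hm => ?_)
  refine (MvPolynomial.degreeOf_C_mul_le _ _ _).trans ?_
  refine (MvPolynomial.degreeOf_prod_le _ _ _).trans ?_
  have h1 : ∀ l ∈ m.support, (g l ^ m l).degreeOf j ≤ if l = l₀ then m l else 0 := by
    intro l _
    refine (MvPolynomial.degreeOf_pow_le _ _ _).trans ?_
    split_ifs with h
    · subst h; simpa using Nat.mul_le_mul_left (m l) hg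
    · rw [hg' l h]; simp
  refine (Finset.sum_le_sum h1).trans ?_
  rw [Finset.sum_ite_eq']
  split_ifs
  · exact (MvPolynomial.monomial_le_degreeOf l₀ hm).trans (hp l₀)
  · exact Nat.zero_le _

lemma evalPoly_bind₁ {e : ℕ} (p : MvPolynomial (Fin e) ℝ) (g : Fin e → MvPolynomial (Fin d) ℝ)
    (x : Pt d) (y : Pt e) (h : ∀ l, evalPoly (g l) x = y l) :
    evalPoly (MvPolynomial.bind₁ g p) x = evalPoly p y := by
  unfold evalPoly at *
  rw [MvPolynomial.eval, MvPolynomial.eval₂Hom_bind₁]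
  congr 2
  ext l
  exact h l

lemma rename_mem_scalarPoly {κ : CellKind} {e k : ℕ} {p : MvPolynomial (Fin e) ℝ}
    (hp : p ∈ scalarPoly κ e k) {g : Fin e → Fin d} (hg : Function.Injective g) :
    MvPolynomial.rename g p ∈ scalarPoly κ d k := by
  cases κ with
  | simplex => exact (MvPolynomial.totalDegree_rename_le _ _).trans hp
  | cube =>
    intro j
    by_cases hj : ∃ l, g l = j
    · obtain ⟨l, rfl⟩ := hj
      rw [MvPolynomial.degreeOf_rename_of_injective hg]
      exact hp l
    · have : j ∉ (MvPolynomial.rename g p).vars := by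
        intro h
        obtain ⟨l, _, hl⟩ := Finset.mem_image.1 (MvPolynomial.vars_rename g p h)
        exact hj ⟨l, hl⟩
      rw [MvPolynomial.vars_def, Multiset.mem_toFinset, ← Multiset.count_eq_zero] at this
      rw [MvPolynomial.degreeOf_def, this]
      exact Nat.zero_le _

end Poly

/-! ### Geometry of the reference element -/

section Ref

variable {n : ℕ}

lemma isClosed_refCell (κ : CellKind) (d : ℕ) : IsClosed (refCell κ d) := by
  cases κ with
  | simplex =>
    simp only [refCell, Set.ofPred_and, Set.ofPred_forall]
    exact (isClosed_iInter fun i => isClosed_le continuous_const (by fun_prop)).inter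
      (isClosed_le (by fun_prop) continuous_const)
  | cube =>
    simp only [refCell, Set.ofPred_and, Set.ofPred_forall]
    exact isClosed_iInter fun i => (isClosed_le continuous_const (by fun_prop)).inter
      (isClosed_le (by fun_prop) continuous_const)

lemma mem_refCell_coord {κ : CellKind} {d : ℕ} {x : Pt d} (hx : x ∈ refCell κ d) (i : Fin d) :
    0 ≤ x i ∧ x i ≤ 1 := by
  cases κ with
  | simplex =>
    exact ⟨hx.1 i, (Finset.single_le_sum (fun j _ => hx.1 j) (Finset.mem_univ i)).trans hx.2⟩
  | cube => exact hx i

lemma norm_le_of_mem_refCell {κ : CellKind} {d : ℕ} {x : Pt d} (hx : x ∈ refCell κ d) :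
    ‖x‖ ≤ √d := by
  rw [EuclideanSpace.norm_eq]
  refine Real.sqrt_le_sqrt ?_
  calc ∑ i, ‖x i‖ ^ 2 ≤ ∑ _i : Fin d, (1 : ℝ) := Finset.sum_le_sum fun i _ => by
        have := mem_refCell_coord hx i
        rw [Real.norm_eq_abs, abs_of_nonneg this.1]
        nlinarith
    _ = d := by simp

lemma isCompact_refCell (κ : CellKind) (d : ℕ) : IsCompact (refCell κ d) :=
  Metric.isCompact_of_isClosed_isBounded (isClosed_refCell κ d)
    (isBounded_iff_forall_norm_le.2 ⟨_, fun _ hx => norm_le_of_mem_refCell hx⟩)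

lemma measurableSet_refCell (κ : CellKind) (d : ℕ) : MeasurableSet (refCell κ d) :=
  (isClosed_refCell κ d).measurableSet

lemma convex_refCell (κ : CellKind) (d : ℕ) : Convex ℝ (refCell κ d) := by
  intro x hx y hy a b ha hb hab
  cases κ with
  | simplex =>
    refine ⟨fun i => ?_, ?_⟩
    · have := hx.1 i; have := hy.1 i; simp; positivity
    · simp only [PiLp.add_apply, PiLp.smul_apply, smul_eq_mul, Finset.sum_add_distrib,
        ← Finset.mul_sum]
      nlinarith [hx.2, hy.2]
  | cube =>
    intro i
    have h1 := hx i
    have h2 := hy i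
    simp only [PiLp.add_apply, PiLp.smul_apply, smul_eq_mul]
    constructor <;> nlinarith

lemma zero_mem_refCell (κ : CellKind) (d : ℕ) : (0 : Pt d) ∈ refCell κ d := by
  cases κ <;> simp [refCell]

lemma single_mem_refCell (κ : CellKind) {d : ℕ} (i : Fin d) :
    (EuclideanSpace.single i 1 : Pt d) ∈ refCell κ d := by
  cases κ with
  | simplex =>
    refine ⟨fun j => ?_, ?_⟩
    · simp only [PiLp.single_apply]; split_ifs <;> norm_num
    · simp
  | cube => intro j; simp only [PiLp.single_apply]; split_ifs <;> norm_num

/-- The interior of the reference element, described by strict inequalities. -/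
def openRefCell (κ : CellKind) (d : ℕ) : Set (Pt d) :=
  match κ with
  | CellKind.simplex => {x | (∀ i, 0 < x i) ∧ ∑ i, x i < 1}
  | CellKind.cube => {x | ∀ i, 0 < x i ∧ x i < 1}

lemma isOpen_openRefCell (κ : CellKind) (d : ℕ) : IsOpen (openRefCell κ d) := by
  cases κ with
  | simplex =>
    simp only [openRefCell, Set.ofPred_and, Set.ofPred_forall]
    exact (isOpen_iInter_of_finite fun i => isOpen_lt continuous_const (by fun_prop)).inter
      (isOpen_lt (by fun_prop) continuous_const)
  | cube =>
    simp only [openRefCell, Set.ofPred_and, Set.ofPred_forall]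
    exact isOpen_iInter_of_finite fun i => (isOpen_lt continuous_const (by fun_prop)).inter
      (isOpen_lt (by fun_prop) continuous_const)

lemma openRefCell_subset (κ : CellKind) (d : ℕ) : openRefCell κ d ⊆ refCell κ d := by
  intro x hx
  cases κ with
  | simplex => exact ⟨fun i => (hx.1 i).le, hx.2.le⟩
  | cube => exact fun i => ⟨(hx i).1.le, (hx i).2.le⟩

lemma openRefCell_nonempty (κ : CellKind) (d : ℕ) : (openRefCell κ d).Nonempty := by
  have hpos : (0 : ℝ) < 1 / (d + 1 + 1) := by positivity
  refine ⟨WithLp.toLp 2 fun _ => 1 / (d + 1 + 1), ?_⟩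
  have h1 : (1 : ℝ) / (d + 1 + 1) < 1 := by
    rw [div_lt_one (by positivity)]; have : (0:ℝ) ≤ d := by positivity
    linarith
  cases κ with
  | simplex =>
    refine ⟨fun i => hpos, ?_⟩
    simp only [Finset.sum_const, Finset.card_univ, Fintype.card_fin, nsmul_eq_mul]
    rw [mul_one_div, div_lt_one (by positivity)]; linarith
  | cube => exact fun i => ⟨hpos, h1⟩

lemma volume_refCell_pos (κ : CellKind) (d : ℕ) : 0 < volume (refCell κ d) :=
  ((isOpen_openRefCell κ d).measure_pos volume (openRefCell_nonempty κ d)).trans_le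
    (measure_mono (openRefCell_subset κ d))

lemma volume_refCell_lt_top (κ : CellKind) (d : ℕ) : volume (refCell κ d) < ⊤ :=
  (isCompact_refCell κ d).measure_lt_top

lemma integrableOn_refCell {κ : CellKind} {d : ℕ} {W : Type*} [NormedAddCommGroup W]
    {g : Pt d → W} (hg : Continuous g) : IntegrableOn g (refCell κ d) :=
  hg.continuousOn.integrableOn_compact (isCompact_refCell κ d)

/-- A hyperplane given by a nonconstant affine function is a null set. -/
lemma volume_hyperplane {d : ℕ} (ℓ : Pt d →ₗ[ℝ] ℝ) (hℓ : ℓ ≠ 0) (c : ℝ) :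
    volume {x : Pt d | ℓ x = c} = 0 := by
  by_cases hne : ∃ x₀, ℓ x₀ = c
  · obtain ⟨x₀, hx₀⟩ := hne
    have h1 : {x : Pt d | ℓ x = c} = (fun x => x + -x₀) ⁻¹' (LinearMap.ker ℓ : Set (Pt d)) := by
      ext x
      simp [hx₀, add_neg_eq_zero]
    rw [h1, measure_preimage_add_right]
    refine Measure.addHaar_submodule _ _ fun h => hℓ (LinearMap.ker_eq_top.1 h)
  · have : {x : Pt d | ℓ x = c} = ∅ := by
      ext x; simp only [Set.mem_ofPred_eq, Set.mem_empty_iff_false, iff_false]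
      exact fun h => hne ⟨x, h⟩
    rw [this, measure_empty]

lemma volume_coord_eq {d : ℕ} (i : Fin d) (c : ℝ) : volume {x : Pt d | x i = c} = 0 := by
  refine volume_hyperplane (EuclideanSpace.proj i : Pt d →L[ℝ] ℝ).toLinearMap ?_ c
  intro h
  simpa using LinearMap.congr_fun h (EuclideanSpace.single i 1)

lemma volume_sum_eq_one {d : ℕ} : volume {x : Pt d | ∑ i, x i = 1} = 0 := by
  by_cases hd : Nonempty (Fin d)
  · obtain ⟨i⟩ := hd
    have := volume_hyperplane
      (∑ i, (EuclideanSpace.proj i : Pt d →L[ℝ] ℝ).toLinearMap) (fun h => ?_) 1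
    · simpa using this
    · simpa using LinearMap.congr_fun h (EuclideanSpace.single i 1)
  · rw [not_nonempty_iff] at hd
    simp

lemma volume_refCell_diff_open (κ : CellKind) (d : ℕ) :
    volume (refCell κ d \ openRefCell κ d) = 0 := by
  cases κ with
  | simplex =>
    refine measure_mono_null (t := (⋃ i, {x : Pt d | x i = 0}) ∪ {x : Pt d | ∑ i, x i = 1}) ?_
      (measure_union_null (measure_iUnion_null fun i => volume_coord_eq i 0) volume_sum_eq_one)
    rintro x ⟨hx, hx'⟩
    by_contra hc
    simp only [Set.mem_union, Set.mem_iUnion, Set.mem_ofPred_eq, not_or, not_exists] at hc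
    exact hx' ⟨fun i => lt_of_le_of_ne (hx.1 i) (Ne.symm (hc.1 i)), lt_of_le_of_ne hx.2 hc.2⟩
  | cube =>
    refine measure_mono_null (t := (⋃ i, {x : Pt d | x i = 0}) ∪ ⋃ i, {x : Pt d | x i = 1}) ?_
      (measure_union_null (measure_iUnion_null fun i => volume_coord_eq i 0)
        (measure_iUnion_null fun i => volume_coord_eq i 1))
    rintro x ⟨hx, hx'⟩
    by_contra hc
    simp only [Set.mem_union, Set.mem_iUnion, Set.mem_ofPred_eq, not_or, not_exists] at hc
    exact hx' fun i =>
      ⟨lt_of_le_of_ne (hx i).1 (Ne.symm (hc.1 i)), lt_of_le_of_ne (hx i).2 (hc.2 i)⟩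

lemma openRefCell_ae_eq (κ : CellKind) (d : ℕ) :
    openRefCell κ d =ᵐ[volume] refCell κ d :=
  Filter.EventuallyLE.antisymm (openRefCell_subset κ d).eventuallyLE
    (ae_le_set.2 (volume_refCell_diff_open κ d))

lemma refFacet_null {κ : CellKind} {d : ℕ} {f : Set (Pt d)} (hf : f ∈ refFacets κ d) :
    f ⊆ refCell κ d ∧ volume f = 0 := by
  cases κ with
  | simplex =>
    rcases hf with ⟨i, rfl⟩ | rfl
    · exact ⟨fun x hx => hx.1, measure_mono_null (fun x hx => hx.2) (volume_coord_eq i 0)⟩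
    · exact ⟨fun x hx => hx.1, measure_mono_null (fun x hx => hx.2) volume_sum_eq_one⟩
  | cube =>
    rcases hf with ⟨i, rfl⟩ | ⟨i, rfl⟩
    · exact ⟨fun x hx => hx.1, measure_mono_null (fun x hx => hx.2) (volume_coord_eq i 0)⟩
    · exact ⟨fun x hx => hx.1, measure_mono_null (fun x hx => hx.2) (volume_coord_eq i 1)⟩

lemma refFace_null {κ : CellKind} {d : ℕ} {s : Set (Pt d)} (hs : s ∈ refFaces κ d) :
    s ⊆ refCell κ d ∧ volume s = 0 := by
  obtain ⟨-, S, hS, ⟨f, hf⟩, rfl⟩ := hs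
  have := refFacet_null (hS hf)
  exact ⟨(Set.sInter_subset_of_mem hf).trans this.1,
    measure_mono_null (Set.sInter_subset_of_mem hf) this.2⟩

/-! ### Slicing the reference element along a coordinate axis -/

/-- The point with `i`-th coordinate `t` and remaining coordinates `y`. -/
noncomputable def ins (i : Fin (n + 1)) (t : ℝ) (y : Pt n) : Pt (n + 1) :=
  WithLp.toLp 2 (Fin.insertNth (α := fun _ => ℝ) i t y.ofLp)

/-- Deletion of the `i`-th coordinate. -/
noncomputable def del (i : Fin (n + 1)) (x : Pt (n + 1)) : Pt n :=
  WithLp.toLp 2 fun j => x (i.succAbove j)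

@[simp] lemma ins_apply_same (i : Fin (n + 1)) (t : ℝ) (y : Pt n) : ins i t y i = t := by
  simp [ins]

@[simp] lemma ins_apply_succAbove (i : Fin (n + 1)) (t : ℝ) (y : Pt n) (j : Fin n) :
    ins i t y (i.succAbove j) = y j := by
  simp [ins]

@[simp] lemma del_apply (i : Fin (n + 1)) (x : Pt (n + 1)) (j : Fin n) :
    del i x j = x (i.succAbove j) := rfl

@[simp] lemma del_ins (i : Fin (n + 1)) (t : ℝ) (y : Pt n) : del i (ins i t y) = y := by
  ext j; simp

lemma ins_del (i : Fin (n + 1)) (x : Pt (n + 1)) : ins i (x i) (del i x) = x := by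
  ext j
  rcases Fin.eq_self_or_eq_succAbove i j with rfl | ⟨j, rfl⟩ <;> simp

lemma sum_ins (i : Fin (n + 1)) (t : ℝ) (y : Pt n) : ∑ j, ins i t y j = t + ∑ j, y j := by
  rw [Fin.sum_univ_succAbove _ i]; simp

lemma ins_eq_add (i : Fin (n + 1)) (t : ℝ) (y : Pt n) :
    ins i t y = ins i 0 y + t • EuclideanSpace.single i 1 := by
  ext j
  rcases Fin.eq_self_or_eq_succAbove i j with rfl | ⟨j, rfl⟩ <;> simp

@[fun_prop] lemma continuous_ins_uncurry (i : Fin (n + 1)) :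
    Continuous fun p : ℝ × Pt n => ins i p.1 p.2 := by
  refine (PiLp.continuous_toLp 2 _).comp ?_
  refine continuous_pi fun j => ?_
  rcases Fin.eq_self_or_eq_succAbove i j with rfl | ⟨j, rfl⟩
  · simpa using continuous_fst
  · simp only [Fin.insertNth_apply_succAbove]; fun_prop

/-- Height of the reference element over the point `y` of the reference element of one dimension
less. -/
noncomputable def top (κ : CellKind) (y : Pt n) : ℝ :=
  match κ with
  | CellKind.simplex => 1 - ∑ j, y j
  | CellKind.cube => 1

lemma continuous_top (κ : CellKind) : Continuous (top κ : Pt n → ℝ) := by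
  cases κ with
  | simplex => exact continuous_const.sub (by fun_prop)
  | cube => exact continuous_const

lemma top_mem {κ : CellKind} {y : Pt n} (hy : y ∈ refCell κ n) : 0 ≤ top κ y ∧ top κ y ≤ 1 := by
  cases κ with
  | simplex =>
    have := Finset.sum_nonneg fun j (_ : j ∈ Finset.univ) => hy.1 j
    have := hy.2
    constructor <;> simp only [top] <;> linarith
  | cube => simp [top]

lemma ins_mem_refCell_iff {κ : CellKind} (i : Fin (n + 1)) (t : ℝ) (y : Pt n) :
    ins i t y ∈ refCell κ (n + 1) ↔ y ∈ refCell κ n ∧ t ∈ Set.Icc 0 (top κ y) := by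
  cases κ with
  | simplex =>
    simp only [refCell, Set.mem_ofPred_eq, sum_ins, top, Set.mem_Icc]
    rw [Fin.forall_iff_succAbove i]
    simp only [ins_apply_same, ins_apply_succAbove]
    constructor
    · rintro ⟨⟨h1, h2⟩, h3⟩; exact ⟨⟨h2, by linarith⟩, h1, by linarith⟩
    · rintro ⟨⟨h1, h2⟩, h3, h4⟩; exact ⟨⟨h3, h1⟩, by linarith⟩
  | cube =>
    simp only [refCell, Set.mem_ofPred_eq, top, Set.mem_Icc]
    rw [Fin.forall_iff_succAbove i]
    simp only [ins_apply_same, ins_apply_succAbove]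
    tauto

/-- `ins i` as a measurable equivalence. -/
noncomputable def insEquiv (i : Fin (n + 1)) : ℝ × Pt n ≃ᵐ Pt (n + 1) :=
  ((MeasurableEquiv.refl ℝ).prodCongr (MeasurableEquiv.toLp 2 (Fin n → ℝ)).symm).trans
    ((MeasurableEquiv.piFinSuccAbove (fun _ => ℝ) i).symm.trans
      (MeasurableEquiv.toLp 2 (Fin (n + 1) → ℝ)))

lemma insEquiv_apply (i : Fin (n + 1)) (p : ℝ × Pt n) : insEquiv i p = ins i p.1 p.2 := rfl

lemma measurePreserving_insEquiv (i : Fin (n + 1)) :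
    MeasurePreserving (insEquiv i : ℝ × Pt n → Pt (n + 1)) := by
  have h1 : MeasurePreserving
      ((MeasurableEquiv.refl ℝ).prodCongr (MeasurableEquiv.toLp 2 (Fin n → ℝ)).symm) :=
    (MeasurePreserving.id (volume : Measure ℝ)).prod
      (EuclideanSpace.volume_preserving_symm_measurableEquiv_toLp (Fin n))
  have h2 := (volume_preserving_piFinSuccAbove (fun _ : Fin (n + 1) => ℝ) i).symm
  have h3 := PiLp.volume_preserving_toLp (Fin (n + 1))
  exact h3.comp (h2.comp h1)

lemma setIntegral_refCell_succ (κ : CellKind) (i : Fin (n + 1)) {g : Pt (n + 1) → ℝ}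
    (hg : Continuous g) :
    ∫ x in refCell κ (n + 1), g x =
      ∫ y in refCell κ n, ∫ t in (0 : ℝ)..(top κ y), g (ins i t y) := by
  have hmp := measurePreserving_insEquiv (n := n) i
  have hms := measurableSet_refCell κ (n + 1)
  rw [← integral_indicator hms, ← hmp.integral_comp (insEquiv i).measurableEmbedding]
  have hint : Integrable (fun p : ℝ × Pt n =>
      (refCell κ (n + 1)).indicator g (insEquiv i p)) :=
    hmp.integrable_comp_of_integrable
      ((integrable_indicator_iff hms).2 (integrableOn_refCell hg))
  rw [Measure.volume_eq_prod, integral_prod_symm _ hint,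
    ← integral_indicator (measurableSet_refCell κ n)]
  congr 1
  ext y
  by_cases hy : y ∈ refCell κ n
  · rw [Set.indicator_of_mem hy, intervalIntegral.integral_of_le (top_mem hy).1,
      ← integral_Icc_eq_integral_Ioc, ← integral_indicator measurableSet_Icc]
    congr 1
    ext t
    by_cases ht : t ∈ Set.Icc 0 (top κ y)
    · rw [Set.indicator_of_mem ht, Set.indicator_of_mem, insEquiv_apply]
      exact (ins_mem_refCell_iff i t y).2 ⟨hy, ht⟩
    · rw [Set.indicator_of_notMem ht, Set.indicator_of_notMem]
      exact fun h => ht ((ins_mem_refCell_iff i t y).1 h).2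
  · rw [Set.indicator_of_notMem hy]
    convert integral_zero ℝ ℝ
    rw [Set.indicator_of_notMem]
    exact fun h => hy ((ins_mem_refCell_iff i _ y).1 h).1

/-! ### Parametrized facets and the divergence theorem on the reference element -/

/-- Parametrization of the facet `f` of the reference element by the reference element of one
dimension less. The pair `(i, false)` stands for the facet `x i = 0`, and `(i, true)` for the
opposite part of the boundary in direction `i`, which is `x i = 1` for the cube, and `∑ x = 1`,
whatever `i` is, for the simplex. -/
noncomputable def facetMap (κ : CellKind) (f : Fin (n + 1) × Bool) (y : Pt n) : Pt (n + 1) :=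
  ins f.1 (if f.2 then top κ y else 0) y

lemma continuous_facetMap (κ : CellKind) (f : Fin (n + 1) × Bool) :
    Continuous (facetMap κ f : Pt n → Pt (n + 1)) := by
  obtain ⟨i, b⟩ := f
  refine (continuous_ins_uncurry i).comp (Continuous.prodMk ?_ continuous_id)
  cases b
  · exact continuous_const
  · exact continuous_top κ

lemma facetMap_mem {κ : CellKind} (f : Fin (n + 1) × Bool) {y : Pt n} (hy : y ∈ refCell κ n) :
    facetMap κ f y ∈ refCell κ (n + 1) := by
  rw [facetMap, ins_mem_refCell_iff]
  refine ⟨hy, ?_⟩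
  have := top_mem hy
  split_ifs <;> simp [this.1]

lemma del_facetMap (κ : CellKind) (f : Fin (n + 1) × Bool) (y : Pt n) :
    del f.1 (facetMap κ f y) = y := del_ins _ _ _

lemma exists_facetMap_image_eq {κ : CellKind} {s : Set (Pt (n + 1))}
    (hs : s ∈ refFacets κ (n + 1)) :
    ∃ f : Fin (n + 1) × Bool, facetMap κ f '' refCell κ n = s := by
  have key : ∀ f : Fin (n + 1) × Bool, ∀ P : Pt (n + 1) → Prop,
      (∀ x ∈ refCell κ (n + 1), P x ↔ x f.1 = if f.2 then top κ (del f.1 x) else 0) →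
      facetMap κ f '' refCell κ n = {x ∈ refCell κ (n + 1) | P x} := by
    intro f P hP
    ext x
    constructor
    · rintro ⟨y, hy, rfl⟩
      refine ⟨facetMap_mem f hy, (hP _ (facetMap_mem f hy)).2 ?_⟩
      rw [del_facetMap]
      simp [facetMap]
    · rintro ⟨hx, hx'⟩
      rw [hP x hx] at hx'
      have h1 := ins_del f.1 x
      have h2 : del f.1 x ∈ refCell κ n := by
        rw [← h1] at hx
        exact ((ins_mem_refCell_iff _ _ _).1 hx).1
      exact ⟨_, h2, by rw [facetMap, ← hx', h1]⟩
  cases κ with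
  | simplex =>
    rcases hs with ⟨i, rfl⟩ | rfl
    · exact ⟨(i, false), key _ _ fun x _ => by simp⟩
    · refine ⟨(0, true), key _ _ fun x _ => ?_⟩
      rw [Fin.sum_univ_succAbove _ 0]
      simp only [top, if_true, del_apply]
      constructor <;> intro h <;> linarith
  | cube =>
    rcases hs with ⟨i, rfl⟩ | ⟨i, rfl⟩
    · exact ⟨(i, false), key _ _ fun x _ => by simp⟩
    · exact ⟨(i, true), key _ _ fun x _ => by simp [top]⟩

lemma setIntegral_refCell_fderiv (κ : CellKind) (i : Fin (n + 1)) {g : Pt (n + 1) → ℝ}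
    (hg : ContDiff ℝ 1 g) :
    ∫ x in refCell κ (n + 1), fderiv ℝ g x (EuclideanSpace.single i 1) =
      ∫ y in refCell κ n, (g (facetMap κ (i, true) y) - g (facetMap κ (i, false) y)) := by
  have hc : Continuous fun x => fderiv ℝ g x (EuclideanSpace.single i 1) :=
    (hg.continuous_fderiv (by simp)).clm_apply continuous_const
  rw [setIntegral_refCell_succ κ i hc]
  refine setIntegral_congr_fun (measurableSet_refCell κ n) fun y _ => ?_
  have hd : ∀ t : ℝ, HasDerivAt (fun t => g (ins i t y))
      (fderiv ℝ g (ins i t y) (EuclideanSpace.single i 1)) t := by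
    intro t
    have h1 : HasDerivAt (fun t => ins i t y) (EuclideanSpace.single i 1) t := by
      have : (fun t => ins i t y) =
          fun t : ℝ => ins i 0 y + t • (EuclideanSpace.single i 1 : Pt (n + 1)) := by
        ext1 t; exact ins_eq_add i t y
      rw [this]
      simpa using ((hasDerivAt_id t).smul_const
        (EuclideanSpace.single i 1 : Pt (n + 1))).const_add (ins i 0 y)
    exact ((hg.differentiable (by simp)) (ins i t y)).hasFDerivAt.comp_hasDerivAt t h1
  rw [intervalIntegral.integral_eq_sub_of_hasDerivAt (fun t _ => hd t)]
  · simp [facetMap]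
  · refine Continuous.intervalIntegrable ?_ _ _
    exact hc.comp ((continuous_ins_uncurry i).comp (by fun_prop : Continuous fun t : ℝ => (t, y)))

end Ref

section RefAffine

variable {n : ℕ}

/-! ### Affine bijections of the reference element -/

lemma affine_apply_eq {d e : ℕ} (B : Pt d →ᵃ[ℝ] Pt e) (y : Pt d) : B y = B.linear y + B 0 := by
  have := congrFun (AffineMap.decomp B) y
  simpa using this

lemma affine_apply_coord {d e : ℕ} (B : Pt d →ᵃ[ℝ] Pt e) (y : Pt d) (l : Fin e) :
    B y l = B 0 l + ∑ m, y m * B.linear (EuclideanSpace.single m 1) l := by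
  have h1 : y = ∑ m, y m • (EuclideanSpace.single m 1 : Pt d) := by
    ext j; simp [Finset.sum_apply, WithLp.ofLp_sum, Pi.single_apply]
  rw [affine_apply_eq B y]
  conv_lhs => rw [h1]
  simp [map_sum, WithLp.ofLp_sum, Finset.sum_apply, add_comm]

lemma abs_det_eq_one_of_image_refCell {κ : CellKind} (B : Pt n →ᵃ[ℝ] Pt n)
    (hB : B '' refCell κ n = refCell κ n) : |LinearMap.det B.linear| = 1 := by
  have h1 : volume (B '' refCell κ n) =
      ENNReal.ofReal |LinearMap.det B.linear| * volume (refCell κ n) := by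
    have : (B : Pt n → Pt n) = (fun x => x + B 0) ∘ B.linear := by
      ext1 y; exact affine_apply_eq B y
    rw [this, Set.image_comp, Set.image_add_right, measure_preimage_add_right,
      Measure.addHaar_image_linearMap]
  rw [hB] at h1
  have h2 : ENNReal.ofReal |LinearMap.det B.linear| = 1 := by
    have := (ENNReal.mul_left_inj (volume_refCell_pos κ n).ne' (volume_refCell_lt_top κ n).ne).1
      (h1.symm.trans (one_mul _).symm)
    exact this
  rwa [ENNReal.ofReal_eq_one] at h2

lemma linear_injective_of_image_refCell {κ : CellKind} (B : Pt n →ᵃ[ℝ] Pt n)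
    (hB : B '' refCell κ n = refCell κ n) : Function.Injective B.linear := by
  have h := abs_det_eq_one_of_image_refCell B hB
  have h2 : LinearMap.det B.linear ≠ 0 := by
    intro h0; rw [h0] at h; simp at h
  exact (LinearEquiv.ofIsUnitDet (f := B.linear) (v := Module.finBasis ℝ (Pt n))
    (v' := Module.finBasis ℝ (Pt n)) (by
      rw [LinearMap.det_toMatrix]; exact isUnit_iff_ne_zero.2 h2)).injective

lemma setIntegral_comp_affine {κ : CellKind} (B : Pt n →ᵃ[ℝ] Pt n)
    (hB : B '' refCell κ n = refCell κ n) (g : Pt n → ℝ) :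
    ∫ y in refCell κ n, g (B y) = ∫ y in refCell κ n, g y := by
  have hd : ∀ x ∈ refCell κ n, HasFDerivWithinAt B
      (LinearMap.toContinuousLinearMap B.linear) (refCell κ n) x := by
    intro x _
    have : (B : Pt n → Pt n) = fun x => LinearMap.toContinuousLinearMap B.linear x + B 0 := by
      ext1 y; exact affine_apply_eq B y
    rw [this]
    exact ((LinearMap.toContinuousLinearMap B.linear).hasFDerivAt.add_const _).hasFDerivWithinAt
  have hinj : Function.Injective B :=
    (AffineMap.linear_injective_iff B).1 (linear_injective_of_image_refCell B hB)
  have h := integral_image_eq_integral_abs_det_fderiv_smul volume (measurableSet_refCell κ n) hd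
    hinj.injOn g
  rw [hB] at h
  rw [h]
  have h1 := abs_det_eq_one_of_image_refCell B hB
  have h2 : (LinearMap.toContinuousLinearMap B.linear).det = LinearMap.det B.linear := by
    simp [ContinuousLinearMap.det]
  simp [h2, h1]

/-- The rows of the linear part of an affine self-map of the cube have `ℓ¹` norm at most one. -/
lemma sum_abs_linear_le_one (B : Pt n →ᵃ[ℝ] Pt n)
    (hB : ∀ y ∈ refCell CellKind.cube n, B y ∈ refCell CellKind.cube n) (l : Fin n) :
    ∑ m, |B.linear (EuclideanSpace.single m 1) l| ≤ 1 := by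
  classical
  set M : Fin n → ℝ := fun m => B.linear (EuclideanSpace.single m 1) l with hM
  -- the extreme values of the `l`-th component are attained at these two vertices
  let y₁ : Pt n := WithLp.toLp 2 fun m => if 0 ≤ M m then 1 else 0
  let y₂ : Pt n := WithLp.toLp 2 fun m => if 0 ≤ M m then 0 else 1
  have h₁ : y₁ ∈ refCell CellKind.cube n := by
    intro m; simp only [y₁]; split_ifs <;> norm_num
  have h₂ : y₂ ∈ refCell CellKind.cube n := by
    intro m; simp only [y₂]; split_ifs <;> norm_num
  have e₁ := affine_apply_coord B y₁ l
  have e₂ := affine_apply_coord B y₂ l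
  have b₁ := (hB y₁ h₁ l).2
  have b₂ := (hB y₂ h₂ l).1
  have : ∑ m, |M m| = ∑ m, y₁ m * M m - ∑ m, y₂ m * M m := by
    rw [← Finset.sum_sub_distrib]
    refine Finset.sum_congr rfl fun m _ => ?_
    simp only [y₁, y₂]
    split_ifs with h
    · rw [abs_of_nonneg h]; ring
    · rw [abs_of_neg (not_le.1 h)]; ring
  linarith

/-- An affine bijection of the cube is a signed permutation of the coordinates: every variable
enters at most one component. -/
lemma linear_single_unique_of_cube (B : Pt n →ᵃ[ℝ] Pt n)
    (hB : B '' refCell CellKind.cube n = refCell CellKind.cube n) (m l l' : Fin n)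
    (h : B.linear (EuclideanSpace.single m 1) l ≠ 0)
    (h' : B.linear (EuclideanSpace.single m 1) l' ≠ 0) : l = l' := by
  classical
  by_contra hne
  let e : Pt n ≃ₗ[ℝ] Pt n :=
    LinearEquiv.ofInjectiveEndo B.linear (linear_injective_of_image_refCell B hB)
  have he : ∀ y, e y = B.linear y := fun y => rfl
  -- the inverse of `B`
  let B' : Pt n →ᵃ[ℝ] Pt n := e.symm.toLinearMap.toAffineMap + AffineMap.const ℝ _ (-e.symm (B 0))
  have hB'B : ∀ y, B' (B y) = y := by
    intro y
    have : B' (B y) = e.symm (B y) - e.symm (B 0) := by simp [B', sub_eq_add_neg]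
    rw [this, ← map_sub, affine_apply_eq B y, add_sub_cancel_right, ← he, e.symm_apply_apply]
  have hB' : ∀ y ∈ refCell CellKind.cube n, B' y ∈ refCell CellKind.cube n := by
    intro y hy
    rw [← hB] at hy
    obtain ⟨z, hz, rfl⟩ := hy
    rwa [hB'B]
  have hlin : B'.linear = e.symm.toLinearMap := by simp [B']
  have hcol : ∀ l, B.linear (EuclideanSpace.single m 1) l ≠ 0 →
      1 ≤ |B'.linear (EuclideanSpace.single l 1) m| := by
    intro l hl
    by_contra hlt
    push Not at hlt
    -- the `(l, l)` entry of `B.linear ∘ B'.linear = id`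
    have h1 : B.linear (B'.linear (EuclideanSpace.single l 1)) l = 1 := by
      rw [hlin]
      have : B.linear (e.symm (EuclideanSpace.single l 1)) = EuclideanSpace.single l 1 := by
        rw [← he, e.apply_symm_apply]
      simp [this]
    set z := B'.linear (EuclideanSpace.single l 1) with hz
    have h2 : B.linear z l = ∑ m, z m * B.linear (EuclideanSpace.single m 1) l := by
      have := affine_apply_coord B z l
      rw [affine_apply_eq B z] at this
      simp at this
      linarith
    have h3 : ∀ m', |z m'| ≤ 1 := fun m' =>
      (Finset.single_le_sum (f := fun j => |B'.linear (EuclideanSpace.single j 1) m'|)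
        (fun j _ => abs_nonneg _) (Finset.mem_univ l)).trans (sum_abs_linear_le_one B' hB' m')
    have h4 : (1 : ℝ) < 1 := by
      calc (1 : ℝ) = ∑ m, z m * B.linear (EuclideanSpace.single m 1) l := by rw [← h2, h1]
        _ ≤ ∑ m, |z m| * |B.linear (EuclideanSpace.single m 1) l| :=
            Finset.sum_le_sum fun j _ => (le_abs_self _).trans (abs_mul _ _).le
        _ < ∑ m, |B.linear (EuclideanSpace.single m 1) l| := by
            refine Finset.sum_lt_sum (fun j _ => ?_) ⟨m, Finset.mem_univ m, ?_⟩
            · exact mul_le_of_le_one_left (abs_nonneg _) (h3 j)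
            · exact mul_lt_of_lt_one_left (abs_pos.2 hl) hlt
        _ ≤ 1 := sum_abs_linear_le_one B
            (fun y hy => by rw [← hB]; exact Set.mem_image_of_mem _ hy) l
    exact lt_irrefl _ h4
  have h5 := sum_abs_linear_le_one B' hB' m
  have h6 : |B'.linear (EuclideanSpace.single l 1) m| + |B'.linear (EuclideanSpace.single l' 1) m|
      ≤ ∑ j, |B'.linear (EuclideanSpace.single j 1) m| := by
    rw [← Finset.sum_pair (f := fun j => |B'.linear (EuclideanSpace.single j 1) m|) hne]
    exact Finset.sum_le_sum_of_subset_of_nonneg (Finset.subset_univ _) fun j _ _ => abs_nonneg _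
  linarith [hcol l h, hcol l' h']

/-- The scalar spaces are invariant under affine bijections of the reference element. -/
lemma exists_scalarPoly_comp_affine {κ : CellKind} {k : ℕ} (B : Pt n →ᵃ[ℝ] Pt n)
    (hB : B '' refCell κ n = refCell κ n) {p : MvPolynomial (Fin n) ℝ}
    (hp : p ∈ scalarPoly κ n k) :
    ∃ r ∈ scalarPoly κ n k, ∀ y, evalPoly r y = evalPoly p (B y) := by
  classical
  let g : Fin n → MvPolynomial (Fin n) ℝ := fun l => MvPolynomial.C (B 0 l) +
    ∑ m, MvPolynomial.C (B.linear (EuclideanSpace.single m 1) l) * MvPolynomial.X m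
  refine ⟨MvPolynomial.bind₁ g p, ?_, fun y => evalPoly_bind₁ p g y (B y) fun l => ?_⟩
  · cases κ with
    | simplex =>
      refine totalDegree_bind₁_le hp fun l => ?_
      refine (MvPolynomial.totalDegree_add _ _).trans (max_le (by simp) ?_)
      refine MvPolynomial.totalDegree_finsetSum_le fun m _ => ?_
      refine (MvPolynomial.totalDegree_mul _ _).trans ?_
      rw [MvPolynomial.totalDegree_C, MvPolynomial.totalDegree_X]
    | cube =>
      intro j
      have hdeg : ∀ l, (g l).degreeOf j ≤
          if B.linear (EuclideanSpace.single j 1) l = 0 then 0 else 1 := by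
        intro l
        refine (MvPolynomial.degreeOf_add_le _ _ _).trans (max_le (by simp) ?_)
        refine (MvPolynomial.degreeOf_sum_le _ _ _).trans (Finset.sup_le fun m _ => ?_)
        by_cases hm : m = j
        · subst hm
          split_ifs with h0
          · simp [h0]
          · exact (MvPolynomial.degreeOf_C_mul_le _ _ _).trans (by simp)
        · refine (MvPolynomial.degreeOf_C_mul_le _ _ _).trans ?_
          rw [MvPolynomial.degreeOf_X_of_ne (Ne.symm hm)]
          exact Nat.zero_le _
      by_cases hex : ∃ l, B.linear (EuclideanSpace.single j 1) l ≠ 0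
      · obtain ⟨l₀, hl₀⟩ := hex
        refine degreeOf_bind₁_le hp j l₀ ((hdeg l₀).trans (by split_ifs <;> simp)) fun l hl => ?_
        have h0 : B.linear (EuclideanSpace.single j 1) l = 0 := by
          by_contra h
          exact hl (linear_single_unique_of_cube B hB j l l₀ h hl₀)
        simpa [h0] using hdeg l
      · push Not at hex
        refine degreeOf_bind₁_le hp j j ?_ fun l _ => ?_
        · exact (hdeg j).trans (by simp [hex])
        · simpa [hex] using hdeg l
  · rw [affine_apply_coord B y l]
    simp [g, mul_comm]

lemma exists_scalarPoly_comp_facetMap {κ : CellKind} {k : ℕ} (f : Fin (n + 1) × Bool)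
    {p : MvPolynomial (Fin (n + 1)) ℝ} (hp : p ∈ scalarPoly κ (n + 1) k) :
    ∃ r ∈ scalarPoly κ n k, ∀ y, evalPoly r y = evalPoly p (facetMap κ f y) := by
  classical
  obtain ⟨i, b⟩ := f
  cases κ with
  | simplex =>
    let g : Fin (n + 1) → MvPolynomial (Fin n) ℝ := Fin.insertNth (α := fun _ => _) i
      (if b then 1 - ∑ j, MvPolynomial.X j else 0) fun j => MvPolynomial.X j
    refine ⟨MvPolynomial.bind₁ g p, totalDegree_bind₁_le hp fun l => ?_,
      fun y => evalPoly_bind₁ p g y _ fun l => ?_⟩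
    · rcases Fin.eq_self_or_eq_succAbove i l with rfl | ⟨l, rfl⟩
      · simp only [g, Fin.insertNth_apply_same]
        split_ifs
        · refine (MvPolynomial.totalDegree_sub _ _).trans (max_le (by simp) ?_)
          exact MvPolynomial.totalDegree_finsetSum_le fun m _ => by simp
        · simp
      · simp [g]
    · rcases Fin.eq_self_or_eq_succAbove i l with rfl | ⟨l, rfl⟩
      · simp only [g, Fin.insertNth_apply_same, facetMap, ins_apply_same, top]
        split_ifs <;> simp
      · simp [g, facetMap]
  | cube =>
    let g : Fin (n + 1) → MvPolynomial (Fin n) ℝ := Fin.insertNth (α := fun _ => _) i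
      (if b then 1 else 0) fun j => MvPolynomial.X j
    refine ⟨MvPolynomial.bind₁ g p, fun j => ?_, fun y => evalPoly_bind₁ p g y _ fun l => ?_⟩
    · refine degreeOf_bind₁_le hp j (i.succAbove j) (by simp [g]) fun l hl => ?_
      rcases Fin.eq_self_or_eq_succAbove i l with rfl | ⟨l, rfl⟩
      · simp only [g, Fin.insertNth_apply_same]
        split_ifs <;> simp
      · simp only [g, Fin.insertNth_apply_succAbove]
        exact MvPolynomial.degreeOf_X_of_ne fun h => hl (by rw [h])
    · rcases Fin.eq_self_or_eq_succAbove i l with rfl | ⟨l, rfl⟩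
      · simp only [g, Fin.insertNth_apply_same, facetMap, ins_apply_same, top]
        split_ifs <;> simp
      · simp [g, facetMap]

/-! ### Fluxes of the local fields -/

/-- The divergence theorem on the reference element. -/
lemma integral_fderiv_add_div (κ : CellKind) (w : Fin (n + 1) → MvPolynomial (Fin (n + 1)) ℝ)
    {ψ : Pt (n + 1) → ℝ} (hψ : ContDiff ℝ 1 ψ) :
    ∫ x in refCell κ (n + 1), (fderiv ℝ ψ x (evalVec w x) + evalPoly (divP w) x * ψ x) =
      ∑ j, ∫ y in refCell κ n, (evalPoly (w j) (facetMap κ (j, true) y) * ψ (facetMap κ (j, true) y)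
        - evalPoly (w j) (facetMap κ (j, false) y) * ψ (facetMap κ (j, false) y)) := by
  have hg : ∀ j, ContDiff ℝ 1 fun x => evalPoly (w j) x * ψ x := fun j =>
    (contDiff_evalPoly _).mul hψ
  rw [← Finset.sum_congr rfl fun j _ => setIntegral_refCell_fderiv κ j (hg j),
    ← integral_finsetSum]
  · congr 1
    ext x
    have hx : ∀ j, fderiv ℝ (fun x => evalPoly (w j) x * ψ x) x (EuclideanSpace.single j 1) =
        evalPoly (w j) x * fderiv ℝ ψ x (EuclideanSpace.single j 1) +
          evalPoly (MvPolynomial.pderiv j (w j)) x * ψ x := by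
      intro j
      rw [fderiv_fun_mul (differentiable_evalPoly _ x) (hψ.differentiable (by simp) x)]
      simp [fderiv_evalPoly_apply, mul_comm]
    simp only [hx, Finset.sum_add_distrib, divP, evalPoly_sum, Finset.sum_mul]
    congr 1
    have h1 : evalVec w x = ∑ m, evalPoly (w m) x • (EuclideanSpace.single m 1 : Pt (n + 1)) := by
      ext j; simp [Finset.sum_apply, WithLp.ofLp_sum, Pi.single_apply]
    rw [h1, map_sum]
    simp
  · intro j _
    exact integrableOn_refCell (((hg j).continuous_fderiv (by simp)).clm_apply continuous_const)

/-- Deletion of a coordinate as a linear map. -/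
noncomputable def delLinear (i : Fin (n + 1)) : Pt (n + 1) →ₗ[ℝ] Pt n where
  toFun := del i
  map_add' x y := by ext j; simp
  map_smul' c x := by ext j; simp

/-- The parametrization of a facet as an affine map. -/
noncomputable def facetAffine (κ : CellKind) (f : Fin (n + 1) × Bool) :
    Pt n →ᵃ[ℝ] Pt (n + 1) where
  toFun := facetMap κ f
  linear :=
    { toFun := fun y => facetMap κ f y - facetMap κ f 0
      map_add' := fun y z => by
        obtain ⟨i, b⟩ := f
        ext j
        rcases Fin.eq_self_or_eq_succAbove i j with rfl | ⟨j, rfl⟩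
        · cases κ <;> cases b <;> simp [facetMap, top, Finset.sum_add_distrib]
          ring
        · simp [facetMap]
      map_smul' := fun c y => by
        obtain ⟨i, b⟩ := f
        ext j
        rcases Fin.eq_self_or_eq_succAbove i j with rfl | ⟨j, rfl⟩
        · cases κ <;> cases b <;> simp [facetMap, top, Finset.mul_sum]
        · simp [facetMap] }
  map_vadd' y z := by
    obtain ⟨i, b⟩ := f
    ext j
    rcases Fin.eq_self_or_eq_succAbove i j with rfl | ⟨j, rfl⟩
    · cases κ <;> cases b <;> simp [facetMap, top, Finset.sum_add_distrib]
      ring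
    · simp [facetMap]

/-- All parametrizations of the slanted facet of the simplex give the same integrals. -/
lemma integral_facetMap_true_simplex (g : Pt (n + 1) → ℝ) (j : Fin (n + 1)) :
    ∫ y in refCell CellKind.simplex n, g (facetMap CellKind.simplex (j, true) y) =
      ∫ y in refCell CellKind.simplex n, g (facetMap CellKind.simplex (0, true) y) := by
  let κ := CellKind.simplex
  -- the affine change of parameters between two parametrizations
  let B : Pt n →ᵃ[ℝ] Pt n := (delLinear 0).toAffineMap.comp (facetAffine κ (j, true))
  have hB : ∀ y, B y = del 0 (facetMap κ (j, true) y) := fun y => rfl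
  have hrep : ∀ x : Pt (n + 1), ∑ l, x l = 1 → ∀ i, facetMap κ (i, true) (del i x) = x := by
    intro x hx i
    have h1 := ins_del i x
    rw [Fin.sum_univ_succAbove _ i] at hx
    have : x i = 1 - ∑ l, del i x l := by simp; linarith
    rw [this] at h1
    exact h1
  have hsum : ∀ i (y : Pt n), ∑ l, facetMap κ (i, true) y l = 1 := by
    intro i y; simp [facetMap, sum_ins, top, κ]
  have hmem : ∀ (x : Pt (n + 1)), x ∈ refCell κ (n + 1) → ∀ i, del i x ∈ refCell κ n := by
    intro x hx i
    rw [← ins_del i x] at hx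
    exact ((ins_mem_refCell_iff _ _ _).1 hx).1
  have himg : B '' refCell κ n = refCell κ n := by
    ext z
    constructor
    · rintro ⟨y, hy, rfl⟩
      rw [hB]
      exact hmem _ (facetMap_mem _ hy) 0
    · intro hz
      refine ⟨del j (facetMap κ (0, true) z), hmem _ (facetMap_mem _ hz) j, ?_⟩
      rw [hB, hrep _ (hsum 0 z) j, del_facetMap κ (0, true)]
  rw [← setIntegral_comp_affine B himg fun y => g (facetMap κ (0, true) y)]
  congr 1
  ext y
  rw [hB, hrep _ (hsum j y) 0]

/-- The field `r` times the facet field of `f` has normal flux `r` through `f` and none through the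
other facets. -/
lemma integral_flux_facetField (κ : CellKind) (f : Fin (n + 1) × Bool)
    (r : MvPolynomial (Fin (n + 1)) ℝ) {ψ : Pt (n + 1) → ℝ} (hψ : ContDiff ℝ 1 ψ) :
    ∫ x in refCell κ (n + 1), (fderiv ℝ ψ x (evalVec (fun j => r * facetField κ f j) x) +
        evalPoly (divP fun j => r * facetField κ f j) x * ψ x) =
      ∫ y in refCell κ n, evalPoly r (facetMap κ f y) * ψ (facetMap κ f y) := by
  rw [integral_fderiv_add_div κ _ hψ]
  obtain ⟨i, b⟩ := f
  have hψc := hψ.continuous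
  cases κ with
  | simplex =>
    have hc : ∀ (p : MvPolynomial (Fin (n + 1)) ℝ) f, IntegrableOn (fun y =>
        evalPoly p (facetMap CellKind.simplex f y) * ψ (facetMap CellKind.simplex f y))
        (refCell CellKind.simplex n) := fun p f =>
      integrableOn_refCell (((continuous_evalPoly p).comp (continuous_facetMap _ f)).mul
        (hψc.comp (continuous_facetMap _ f)))
    rw [Finset.sum_congr rfl fun j _ => integral_sub (hc _ _) (hc _ _), Finset.sum_sub_distrib]
    rw [Finset.sum_congr rfl fun j _ => integral_facetMap_true_simplex (fun x =>
        evalPoly (r * facetField CellKind.simplex (i, b) j) x * ψ x) j,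
      ← integral_finsetSum _ fun j _ => hc _ _]
    have h1 : ∀ y : Pt n, ∑ j, evalPoly (r * facetField CellKind.simplex (i, b) j)
        (facetMap CellKind.simplex (0, true) y) * ψ (facetMap CellKind.simplex (0, true) y) =
        if b then evalPoly r (facetMap CellKind.simplex (0, true) y) *
          ψ (facetMap CellKind.simplex (0, true) y) else 0 := by
      intro y
      have h2 : ∑ l, facetMap CellKind.simplex (0, true) y l = 1 := by
        simp [facetMap, sum_ins, top]
      rw [← Finset.sum_mul]
      simp only [facetField, evalPoly_mul, evalPoly_sub, evalPoly_X, ← Finset.mul_sum,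
        Finset.sum_sub_distrib, h2]
      cases b <;> simp [apply_ite (evalPoly · (facetMap CellKind.simplex (0, true) y))]
    have h3 : ∀ j, ∀ y : Pt n, evalPoly (r * facetField CellKind.simplex (i, b) j)
        (facetMap CellKind.simplex (j, false) y) * ψ (facetMap CellKind.simplex (j, false) y) =
        if j = i then (if b then 0 else -(evalPoly r (facetMap CellKind.simplex (i, false) y) *
          ψ (facetMap CellKind.simplex (i, false) y))) else 0 := by
      intro j y
      have h4 : facetMap CellKind.simplex (j, false) y j = 0 := by simp [facetMap]
      by_cases hj : j = i
      · subst hj; cases b <;> simp [facetField, h4]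
      · simp [facetField, h4, hj]
    simp only [h1, h3]
    cases b
    · simp only [Bool.false_eq_true, if_false, integral_zero, zero_sub]
      rw [Finset.sum_eq_single i (fun j _ hj => by simp [hj]) (by simp)]
      simp [integral_neg]
    · simp only [if_true, ite_self, integral_zero, Finset.sum_const_zero, sub_zero]
      exact (integral_facetMap_true_simplex (fun x => evalPoly r x * ψ x) i).symm
  | cube =>
    rw [Finset.sum_eq_single i (fun j _ hj => by simp [facetField, hj]) (by simp)]
    refine setIntegral_congr_fun (measurableSet_refCell _ n) fun y _ => ?_
    cases b <;> simp [facetField, facetMap, top]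

/-- The bubble field has no normal flux. -/
lemma integral_flux_bubbleField (κ : CellKind) (r : MvPolynomial (Fin (n + 1)) ℝ)
    {ψ : Pt (n + 1) → ℝ} (hψ : ContDiff ℝ 1 ψ) :
    ∫ x in refCell κ (n + 1), (fderiv ℝ ψ x (evalVec (bubbleField κ r) x) +
        evalPoly (divP (bubbleField κ r)) x * ψ x) = 0 := by
  rw [integral_fderiv_add_div κ _ hψ]
  have hψc := hψ.continuous
  cases κ with
  | simplex =>
    have hc : ∀ (p : MvPolynomial (Fin (n + 1)) ℝ) f, IntegrableOn (fun y =>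
        evalPoly p (facetMap CellKind.simplex f y) * ψ (facetMap CellKind.simplex f y))
        (refCell CellKind.simplex n) := fun p f =>
      integrableOn_refCell (((continuous_evalPoly p).comp (continuous_facetMap _ f)).mul
        (hψc.comp (continuous_facetMap _ f)))
    rw [Finset.sum_congr rfl fun j _ => integral_sub (hc _ _) (hc _ _), Finset.sum_sub_distrib]
    rw [Finset.sum_congr rfl fun j _ => integral_facetMap_true_simplex (fun x =>
        evalPoly (bubbleField CellKind.simplex r j) x * ψ x) j,
      ← integral_finsetSum _ fun j _ => hc _ _]
    have h1 : ∀ y : Pt n, ∑ j, evalPoly (bubbleField CellKind.simplex r j)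
        (facetMap CellKind.simplex (0, true) y) * ψ (facetMap CellKind.simplex (0, true) y) =
        0 := by
      intro y
      have h2 : ∑ l, facetMap CellKind.simplex (0, true) y l = 1 := by
        simp [facetMap, sum_ins, top]
      rw [← Finset.sum_mul]
      simp only [bubbleField, evalPoly_mul, evalPoly_sub, evalPoly_X, evalPoly_sum, mul_sub,
        Finset.sum_sub_distrib, ← Finset.sum_mul, h2]
      simp
    have h3 : ∀ j, ∀ y : Pt n, evalPoly (bubbleField CellKind.simplex r j)
        (facetMap CellKind.simplex (j, false) y) = 0 := by
      intro j y
      have h4 : facetMap CellKind.simplex (j, false) y j = 0 := by simp [facetMap]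
      simp [bubbleField, h4]
    simp only [h1, h3]
    simp
  | cube =>
    refine Finset.sum_eq_zero fun j _ => ?_
    simp [bubbleField, facetMap, top]

end RefAffine

section Energy

variable {n : ℕ}

/-! ### Equivalence of norms on polynomials -/

/-- On a finite-dimensional space every quadratic form is dominated by every positive definite
one. -/
lemma exists_mul_le_of_posDef {E : Type*} [NormedAddCommGroup E] [NormedSpace ℝ E]
    [FiniteDimensional ℝ E] (β₁ β₂ : E →ₗ[ℝ] E →ₗ[ℝ] ℝ) (h₁ : ∀ a, a ≠ 0 → 0 < β₁ a a) :
    ∃ c : ℝ, 0 < c ∧ ∀ a, c * β₂ a a ≤ β₁ a a := by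
  have hcont : ∀ β : E →ₗ[ℝ] E →ₗ[ℝ] ℝ, Continuous fun a => β a a := by
    intro β
    let T : E →ₗ[ℝ] (E →L[ℝ] ℝ) := (LinearMap.toContinuousLinearMap).toLinearMap ∘ₗ β
    have hT : Continuous T := T.continuous_of_finiteDimensional
    exact (hT.clm_apply continuous_id)
  have : ProperSpace E := FiniteDimensional.proper ℝ E
  have hK : IsCompact (Metric.sphere (0 : E) 1) := isCompact_sphere 0 1
  by_cases hne : (Metric.sphere (0 : E) 1).Nonempty
  · obtain ⟨a₁, ha₁, hmin⟩ := hK.exists_isMinOn hne (hcont β₁).continuousOn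
    obtain ⟨C, hC⟩ := hK.exists_bound_of_continuousOn (hcont β₂).continuousOn
    have hm : 0 < β₁ a₁ a₁ := h₁ a₁ (by rintro rfl; simp at ha₁)
    have hC0 : 0 ≤ C := (norm_nonneg _).trans (hC a₁ ha₁)
    refine ⟨β₁ a₁ a₁ / (C + 1), by positivity, fun a => ?_⟩
    by_cases ha : a = 0
    · simp [ha]
    have hna : ‖a‖ ≠ 0 := norm_ne_zero_iff.2 ha
    set u := ‖a‖⁻¹ • a with hu
    have hus : u ∈ Metric.sphere (0 : E) 1 := by
      simp [hu, norm_smul, inv_mul_cancel₀ hna]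
    have hau : a = ‖a‖ • u := by rw [hu, smul_smul, mul_inv_cancel₀ hna, one_smul]
    have h2 : β₁ a₁ a₁ / (C + 1) * β₂ u u ≤ β₁ u u := by
      have h3 : β₂ u u ≤ C + 1 := by
        have := (le_abs_self _).trans (hC u hus); linarith
      calc β₁ a₁ a₁ / (C + 1) * β₂ u u ≤ β₁ a₁ a₁ / (C + 1) * (C + 1) := by gcongr
        _ = β₁ a₁ a₁ := by field_simp
        _ ≤ β₁ u u := hmin hus
    rw [hau]
    simp only [map_smul, LinearMap.smul_apply, smul_eq_mul]
    have h4 : 0 ≤ ‖a‖ * ‖a‖ := by positivity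
    nlinarith [mul_le_mul_of_nonneg_left h2 h4]
  · refine ⟨1, one_pos, fun a => ?_⟩
    by_cases ha : a = 0
    · simp [ha]
    exfalso
    refine hne ⟨‖a‖⁻¹ • a, ?_⟩
    simp [norm_smul, inv_mul_cancel₀ (norm_ne_zero_iff.2 ha)]

lemma eq_zero_of_evalPoly_eq_zero_on_open {κ : CellKind} {d : ℕ} {p : MvPolynomial (Fin d) ℝ}
    (h : ∀ x ∈ openRefCell κ d, evalPoly p x = 0) : p = 0 := by
  have hpos : (0 : ℝ) < 1 / (d + 1) := by positivity
  refine MvPolynomial.funext_set (fun _ => Set.Ioo (0 : ℝ) (1 / (d + 1)))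
    (fun _ => Set.Ioo_infinite hpos) fun x hx => ?_
  rw [map_zero]
  refine h (WithLp.toLp 2 x) ?_
  have hx' : ∀ i, 0 < x i ∧ x i < 1 / (d + 1) := fun i => hx i (Set.mem_univ i)
  have hle : (1 : ℝ) / (d + 1) ≤ 1 := by
    rw [div_le_one (by positivity)]; have : (0 : ℝ) ≤ d := by positivity
    linarith
  cases κ with
  | simplex =>
    refine ⟨fun i => (hx' i).1, ?_⟩
    calc ∑ i, x i ≤ ∑ _i : Fin d, (1 : ℝ) / (d + 1) := Finset.sum_le_sum fun i _ => (hx' i).2.le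
      _ = d / (d + 1) := by simp [div_eq_mul_inv]
      _ < 1 := by rw [div_lt_one (by positivity)]; linarith
  | cube => exact fun i => ⟨(hx' i).1, (hx' i).2.trans_le hle⟩

/-- On polynomials of bounded degree, an `L²` norm with a weight which is positive inside the
reference element is equivalent to the `L²` norm. -/
lemma exists_weighted_norm_le (κ : CellKind) (d N : ℕ) (ω : MvPolynomial (Fin d) ℝ)
    (hω : ∀ x ∈ openRefCell κ d, 0 < evalPoly ω x) :
    ∃ c : ℝ, 0 < c ∧ ∀ p : MvPolynomial (Fin d) ℝ, p.totalDegree ≤ N →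
      c * ∫ x in refCell κ d, evalPoly p x ^ 2 ≤
        ∫ x in refCell κ d, evalPoly ω x * evalPoly p x ^ 2 := by
  let V := MvPolynomial.restrictTotalDegree (Fin d) ℝ N
  let m := Module.finrank ℝ V
  let e : V ≃ₗ[ℝ] (Fin m → ℝ) := (Module.finBasis ℝ V).equivFun
  let T : (Fin m → ℝ) →ₗ[ℝ] MvPolynomial (Fin d) ℝ := V.subtype ∘ₗ e.symm.toLinearMap
  let I : MvPolynomial (Fin d) ℝ →ₗ[ℝ] ℝ :=
    { toFun := fun p => ∫ x in refCell κ d, evalPoly p x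
      map_add' := fun p q => by
        simp only [evalPoly_add]
        exact integral_add (integrableOn_refCell (continuous_evalPoly p))
          (integrableOn_refCell (continuous_evalPoly q))
      map_smul' := fun c p => by
        simp only [evalPoly_smul, integral_const_mul, RingHom.id_apply, smul_eq_mul] }
  let β : MvPolynomial (Fin d) ℝ → (Fin m → ℝ) →ₗ[ℝ] (Fin m → ℝ) →ₗ[ℝ] ℝ := fun ω =>
    (((LinearMap.mul ℝ (MvPolynomial (Fin d) ℝ)).compl₁₂
      ((LinearMap.mulLeft ℝ ω) ∘ₗ T) T)).compr₂ I
  have hβ : ∀ ω a, β ω a a = ∫ x in refCell κ d, evalPoly ω x * evalPoly (T a) x ^ 2 := by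
    intro ω a
    have : β ω a a = ∫ x in refCell κ d, evalPoly (ω * T a * T a) x := rfl
    rw [this]
    congr 1; ext x; simp; ring
  have hpos : ∀ a, a ≠ 0 → 0 < β ω a a := by
    intro a ha
    rw [hβ]
    rw [← setIntegral_congr_set (openRefCell_ae_eq κ d)]
    have hc : Continuous fun x => evalPoly ω x * evalPoly (T a) x ^ 2 := by fun_prop
    have hnn : ∀ x ∈ openRefCell κ d, 0 ≤ evalPoly ω x * evalPoly (T a) x ^ 2 := fun x hx =>
      mul_nonneg (hω x hx).le (sq_nonneg _)
    have hmeas := (isOpen_openRefCell κ d).measurableSet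
    have hint : IntegrableOn (fun x => evalPoly ω x * evalPoly (T a) x ^ 2) (openRefCell κ d) :=
      (integrableOn_refCell hc).mono_set (openRefCell_subset κ d)
    have h0 : 0 ≤ ∫ x in openRefCell κ d, evalPoly ω x * evalPoly (T a) x ^ 2 :=
      setIntegral_nonneg hmeas hnn
    refine lt_of_le_of_ne h0 fun heq => ha ?_
    have h1 := (setIntegral_eq_zero_iff_of_nonneg_ae
      (ae_restrict_of_forall_mem hmeas hnn) hint).1 heq.symm
    have h2 := Measure.eqOn_open_of_ae_eq h1 (isOpen_openRefCell κ d) hc.continuousOn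
      continuousOn_const
    have h3 : T a = 0 := eq_zero_of_evalPoly_eq_zero_on_open (κ := κ) fun x hx => by
      have h4 : evalPoly ω x * evalPoly (T a) x ^ 2 = 0 := h2 hx
      rcases mul_eq_zero.1 h4 with h | h
      · exact absurd h (hω x hx).ne'
      · exact pow_eq_zero_iff (two_ne_zero) |>.1 h
    have h5 : e.symm a = 0 := Subtype.ext h3
    simpa using h5
  obtain ⟨c, hc, h⟩ := exists_mul_le_of_posDef (β ω) (β 1) hpos
  refine ⟨c, hc, fun p hp => ?_⟩
  have h1 := h (e ⟨p, (MvPolynomial.mem_restrictTotalDegree _ _ _).2 hp⟩)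
  rw [hβ, hβ] at h1
  have h2 : T (e ⟨p, (MvPolynomial.mem_restrictTotalDegree _ _ _).2 hp⟩) = p := by simp [T]
  rw [h2] at h1
  simpa using h1

/-! ### Energy estimates for the local fields -/

lemma norm_sq_evalVec {d : ℕ} (w : Fin d → MvPolynomial (Fin d) ℝ) (x : Pt d) :
    ‖evalVec w x‖ ^ 2 = ∑ j, evalPoly (w j) x ^ 2 := by
  rw [EuclideanSpace.norm_sq_eq]; simp

/-- The bubble field controls the full gradient: `∇r` times the bubble field is at least a weighted
sum of squares of the partial derivatives, which is equivalent to the unweighted one. For the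
simplex, with the weight `(1 - ∑ l, x l) * x j`, this is the Cauchy-Schwarz inequality
`(∑ j, x j * ∂ j r) ^ 2 ≤ (∑ j, x j) * ∑ j, x j * (∂ j r) ^ 2`. -/
lemma exists_bubbleField_coercive (κ : CellKind) (n k : ℕ) :
    ∃ c : ℝ, 0 < c ∧ ∀ r ∈ scalarPoly κ (n + 1) k,
      c * ∫ x in refCell κ (n + 1), ‖evalVec (gradP r) x‖ ^ 2 ≤
        ∫ x in refCell κ (n + 1), fderiv ℝ (evalPoly r) x (evalVec (bubbleField κ r) x) := by
  let ω : Fin (n + 1) → MvPolynomial (Fin (n + 1)) ℝ := fun j =>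
    match κ with
    | CellKind.simplex => (1 - ∑ l, MvPolynomial.X l) * MvPolynomial.X j
    | CellKind.cube => MvPolynomial.X j * (1 - MvPolynomial.X j)
  have hω : ∀ j, ∀ x ∈ openRefCell κ (n + 1), 0 < evalPoly (ω j) x := by
    intro j x hx
    cases κ with
    | simplex => simpa [ω] using mul_pos (sub_pos.2 hx.2) (hx.1 j)
    | cube => simpa [ω] using mul_pos (hx j).1 (sub_pos.2 (hx j).2)
  choose c hc hcp using fun j =>
    exists_weighted_norm_le κ (n + 1) ((n + 1 + 1) * k) (ω j) (hω j)
  have hne : (Finset.univ : Finset (Fin (n + 1))).Nonempty := ⟨0, Finset.mem_univ _⟩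
  refine ⟨Finset.univ.inf' hne c, (Finset.lt_inf'_iff hne).2 fun j _ => hc j, fun r hr => ?_⟩
  have hdeg : ∀ j, (MvPolynomial.pderiv j r).totalDegree ≤ (n + 1 + 1) * k := fun j =>
    ((totalDegree_pderiv_le j r).trans (Nat.sub_le _ _)).trans (scalarPoly_totalDegree_le hr)
  have hint : ∀ j, IntegrableOn (fun x => evalPoly (MvPolynomial.pderiv j r) x ^ 2)
      (refCell κ (n + 1)) := fun j => integrableOn_refCell (by fun_prop)
  have hintω : ∀ j, IntegrableOn (fun x => evalPoly (ω j) x *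
      evalPoly (MvPolynomial.pderiv j r) x ^ 2) (refCell κ (n + 1)) :=
    fun j => integrableOn_refCell (by fun_prop)
  calc Finset.univ.inf' hne c * ∫ x in refCell κ (n + 1), ‖evalVec (gradP r) x‖ ^ 2
      = ∑ j, Finset.univ.inf' hne c *
          ∫ x in refCell κ (n + 1), evalPoly (MvPolynomial.pderiv j r) x ^ 2 := by
        simp only [norm_sq_evalVec, gradP]
        rw [integral_finsetSum _ fun j _ => hint j, Finset.mul_sum]
    _ ≤ ∑ j, ∫ x in refCell κ (n + 1), evalPoly (ω j) x *
          evalPoly (MvPolynomial.pderiv j r) x ^ 2 := by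
        refine Finset.sum_le_sum fun j _ => le_trans ?_ (hcp j _ (hdeg j))
        exact mul_le_mul_of_nonneg_right (Finset.inf'_le _ (Finset.mem_univ j))
          (integral_nonneg fun x => sq_nonneg _)
    _ = ∫ x in refCell κ (n + 1), ∑ j, evalPoly (ω j) x *
          evalPoly (MvPolynomial.pderiv j r) x ^ 2 :=
        (integral_finsetSum _ fun j _ => hintω j).symm
    _ ≤ _ := by
        refine setIntegral_mono_on (integrable_finsetSum _ fun j _ => hintω j) ?_
          (measurableSet_refCell _ _) fun x hx => ?_
        · refine integrableOn_refCell ?_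
          exact ((contDiff_evalPoly r).continuous_fderiv (n := 1) (by simp)).clm_apply
            (continuous_evalVec _)
        · rw [fderiv_evalPoly_apply]
          simp only [evalVec_apply]
          cases κ with
          | simplex =>
            simp only [ω, bubbleField, evalPoly_mul, evalPoly_sub, evalPoly_one, evalPoly_sum,
              evalPoly_X]
            set a : Fin (n + 1) → ℝ := fun j => evalPoly (MvPolynomial.pderiv j r) x with ha
            have hcs : (∑ j, x j * a j) ^ 2 ≤ (∑ j, x j) * ∑ j, x j * a j ^ 2 :=
              Finset.sum_sq_le_sum_mul_sum_of_sq_le_mul _ (fun j _ => hx.1 j)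
                (fun j _ => mul_nonneg (hx.1 j) (sq_nonneg _)) fun j _ => le_of_eq (by ring)
            have e1 : ∑ j, (1 - ∑ l, x l) * x j * a j ^ 2 =
                (1 - ∑ l, x l) * ∑ j, x j * a j ^ 2 := by
              rw [Finset.mul_sum]; exact Finset.sum_congr rfl fun j _ => by ring
            have e2 : ∑ j, a j * (x j * (a j - ∑ l, x l * a l)) =
                ∑ j, x j * a j ^ 2 - (∑ l, x l * a l) ^ 2 := by
              rw [sq, Finset.sum_mul, ← Finset.sum_sub_distrib]
              exact Finset.sum_congr rfl fun j _ => by ring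
            rw [e1, e2]; linarith
          | cube =>
            refine Finset.sum_le_sum fun j _ => le_of_eq ?_
            simp [ω, bubbleField]; ring

lemma norm_bubbleField_sq_le {κ : CellKind} (r : MvPolynomial (Fin (n + 1)) ℝ) {x : Pt (n + 1)}
    (hx : x ∈ refCell κ (n + 1)) :
    ‖evalVec (bubbleField κ r) x‖ ^ 2 ≤
      (n + 1) * (n + 2) ^ 2 * ‖evalVec (gradP r) x‖ ^ 2 := by
  set g := ‖evalVec (gradP r) x‖ with hg
  have hg0 : 0 ≤ g := norm_nonneg _
  have ha : ∀ j, |evalPoly (MvPolynomial.pderiv j r) x| ≤ g := fun j =>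
    PiLp.norm_apply_le (evalVec (gradP r) x) j
  have hb : ∀ j, |evalPoly (bubbleField κ r j) x| ≤ (n + 2) * g := by
    intro j
    have h01 := mem_refCell_coord hx
    have hn : (0 : ℝ) ≤ n := Nat.cast_nonneg n
    cases κ with
    | simplex =>
      simp only [bubbleField, evalPoly_mul, evalPoly_sub, evalPoly_sum, evalPoly_X, abs_mul]
      have hs : |∑ l, x l * evalPoly (MvPolynomial.pderiv l r) x| ≤ (n + 1) * g := by
        refine (Finset.abs_sum_le_sum_abs _ _).trans ?_
        calc _ ≤ ∑ _l : Fin (n + 1), g := Finset.sum_le_sum fun l _ => by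
              rw [abs_mul, abs_of_nonneg (h01 l).1]
              exact (mul_le_of_le_one_left (abs_nonneg _) (h01 l).2).trans (ha l)
          _ = (n + 1) * g := by simp
      rw [abs_of_nonneg (h01 j).1]
      refine (mul_le_of_le_one_left (abs_nonneg _) (h01 j).2).trans ?_
      refine (abs_sub _ _).trans ?_
      linarith [ha j]
    | cube =>
      simp only [bubbleField, evalPoly_mul, evalPoly_sub, evalPoly_one, evalPoly_X, abs_mul]
      rw [abs_of_nonneg (h01 j).1, abs_of_nonneg (sub_nonneg.2 (h01 j).2)]
      have h2 : x j * (1 - x j) ≤ 1 := by nlinarith [(h01 j).1, (h01 j).2]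
      refine (mul_le_of_le_one_left (abs_nonneg _) h2).trans ((ha j).trans ?_)
      nlinarith
  rw [norm_sq_evalVec]
  calc ∑ j, evalPoly (bubbleField κ r j) x ^ 2 ≤ ∑ _j : Fin (n + 1), ((n + 2) * g) ^ 2 :=
        Finset.sum_le_sum fun j _ => sq_le_sq' (abs_le.1 (hb j)).1 (abs_le.1 (hb j)).2
    _ = _ := by simp; ring

lemma norm_mul_facetField_sq_le {κ : CellKind} (f : Fin (n + 1) × Bool)
    (r : MvPolynomial (Fin (n + 1)) ℝ) {x : Pt (n + 1)} (hx : x ∈ refCell κ (n + 1)) :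
    ‖evalVec (fun j => r * facetField κ f j) x‖ ^ 2 ≤ (n + 1) * evalPoly r x ^ 2 := by
  rw [norm_sq_evalVec]
  calc _ ≤ ∑ _j : Fin (n + 1), evalPoly r x ^ 2 := Finset.sum_le_sum fun j _ => by
        rw [evalPoly_mul, mul_pow]
        refine mul_le_of_le_one_right (sq_nonneg _) ?_
        have h01 := mem_refCell_coord hx j
        have : -1 ≤ evalPoly (facetField κ f j) x ∧ evalPoly (facetField κ f j) x ≤ 1 := by
          cases κ with
          | simplex =>
            simp only [facetField, evalPoly_sub, evalPoly_X]
            split_ifs <;> simp <;> constructor <;> linarith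
          | cube =>
            simp only [facetField]
            split_ifs <;> simp <;> (try constructor) <;> linarith
        nlinarith [this.1, this.2]
    _ = _ := by simp

lemma integral_rename_sq_le (κ : CellKind) (i : Fin (n + 1)) (p : MvPolynomial (Fin n) ℝ) :
    ∫ x in refCell κ (n + 1), evalPoly (MvPolynomial.rename i.succAbove p) x ^ 2 ≤
      ∫ y in refCell κ n, evalPoly p y ^ 2 := by
  rw [setIntegral_refCell_succ κ i (by fun_prop)]
  have h1 : ∀ t (y : Pt n), evalPoly (MvPolynomial.rename i.succAbove p) (ins i t y) =
      evalPoly p y := by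
    intro t y
    unfold evalPoly
    rw [MvPolynomial.eval_rename]
    congr 2
    ext j; simp
  simp only [h1, intervalIntegral.integral_const, sub_zero, smul_eq_mul]
  refine setIntegral_mono_on (integrableOn_refCell ((continuous_top κ).mul (by fun_prop)))
    (integrableOn_refCell (by fun_prop)) (measurableSet_refCell κ n) fun y hy => ?_
  exact mul_le_of_le_one_left (sq_nonneg _) (top_mem hy).2

/-- The local velocity on the reference element: a multiple of the bubble field, which tests the
gradient of `r`, and for each `j ∈ N` a field with normal component `p j` on the facet `f j`. -/
noncomputable def localField {ι : Type*} (κ : CellKind) (M : ℝ) (r : MvPolynomial (Fin (n + 1)) ℝ)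
    (N : Finset ι) (f : ι → Fin (n + 1) × Bool) (p : ι → MvPolynomial (Fin n) ℝ) :
    Fin (n + 1) → MvPolynomial (Fin (n + 1)) ℝ :=
  (-M) • bubbleField κ r +
    ∑ j ∈ N, fun l => MvPolynomial.rename (f j).1.succAbove (p j) * facetField κ (f j) l

section LocalField

variable {ι : Type*} {κ : CellKind} {k : ℕ}

lemma localField_mem_rtPoly (M : ℝ) {r : MvPolynomial (Fin (n + 1)) ℝ} {N : Finset ι}
    {f : ι → Fin (n + 1) × Bool} {p : ι → MvPolynomial (Fin n) ℝ}
    (hr : r ∈ scalarPoly κ (n + 1) k) (hp : ∀ j ∈ N, p j ∈ scalarPoly κ n k) :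
    localField κ M r N f p ∈ rtPoly κ (n + 1) k :=
  add_mem_rtPoly (smul_mem_rtPoly _ (bubbleField_mem_rtPoly hr))
    (sum_mem_rtPoly _ fun j hj => mul_facetField_mem_rtPoly _
      (rename_mem_scalarPoly (hp j hj) Fin.succAbove_right_injective))

lemma divP_add {d : ℕ} (v w : Fin d → MvPolynomial (Fin d) ℝ) :
    divP (v + w) = divP v + divP w := by simp [divP, Finset.sum_add_distrib]

lemma divP_smul {d : ℕ} (t : ℝ) (w : Fin d → MvPolynomial (Fin d) ℝ) :
    divP (t • w) = t • divP w := by simp [divP, Finset.smul_sum]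

lemma divP_sum {d : ℕ} {α : Type*} (s : Finset α) (w : α → Fin d → MvPolynomial (Fin d) ℝ) :
    divP (∑ a ∈ s, w a) = ∑ a ∈ s, divP (w a) := by
  simp only [divP, Finset.sum_apply, map_sum]
  exact Finset.sum_comm

/-- The flux of the local velocity through the boundary of the reference element, tested with
`ψ`. -/
lemma integral_flux_localField (M : ℝ) (r : MvPolynomial (Fin (n + 1)) ℝ) (N : Finset ι)
    (f : ι → Fin (n + 1) × Bool) (p : ι → MvPolynomial (Fin n) ℝ)
    {ψ : Pt (n + 1) → ℝ} (hψ : ContDiff ℝ 1 ψ) :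
    ∫ x in refCell κ (n + 1), (fderiv ℝ ψ x (evalVec (localField κ M r N f p) x) +
        evalPoly (divP (localField κ M r N f p)) x * ψ x) =
      ∑ j ∈ N, ∫ y in refCell κ n, evalPoly (p j) y * ψ (facetMap κ (f j) y) := by
  have hψc := hψ.continuous
  have hcont : ∀ w : Fin (n + 1) → MvPolynomial (Fin (n + 1)) ℝ, IntegrableOn (fun x =>
      fderiv ℝ ψ x (evalVec w x) + evalPoly (divP w) x * ψ x) (refCell κ (n + 1)) := fun w =>
    integrableOn_refCell (((hψ.continuous_fderiv (by simp)).clm_apply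
      (continuous_evalVec w)).add ((continuous_evalPoly _).mul hψc))
  have h1 : ∀ x, fderiv ℝ ψ x (evalVec (localField κ M r N f p) x) +
        evalPoly (divP (localField κ M r N f p)) x * ψ x =
      (-M) * (fderiv ℝ ψ x (evalVec (bubbleField κ r) x) +
        evalPoly (divP (bubbleField κ r)) x * ψ x) +
      ∑ j ∈ N, (fderiv ℝ ψ x (evalVec (fun l => MvPolynomial.rename (f j).1.succAbove (p j) *
          facetField κ (f j) l) x) + evalPoly (divP fun l =>
            MvPolynomial.rename (f j).1.succAbove (p j) * facetField κ (f j) l) x * ψ x) := by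
    intro x
    simp only [localField, divP_add, divP_smul, divP_sum, evalVec_add, evalVec_smul, evalVec_sum,
      evalPoly_add, evalPoly_smul, evalPoly_sum, map_add, map_smul, map_sum, smul_eq_mul,
      Finset.sum_add_distrib, Finset.sum_mul, add_mul]
    ring
  simp only [h1]
  rw [integral_add ((hcont _).const_mul _) (integrable_finsetSum _ fun j _ => hcont _),
    integral_const_mul, integral_flux_bubbleField κ r hψ, mul_zero, zero_add,
    integral_finsetSum _ fun j _ => hcont _]
  refine Finset.sum_congr rfl fun j _ => ?_
  rw [integral_flux_facetField κ (f j) _ hψ]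
  congr 1
  ext y
  congr 1
  unfold evalPoly
  rw [MvPolynomial.eval_rename]
  congr 2
  ext l; simp [facetMap]

end LocalField

/-- Choice of the weight of the bubble field: it has to absorb the interaction of the gradient with
the at most `N₀` facet fields. -/
lemma exists_localField_estimates (κ : CellKind) (n k N₀ : ℕ) :
    ∃ M C : ℝ, 0 < C ∧ ∀ {ι : Type} (r : MvPolynomial (Fin (n + 1)) ℝ) (N : Finset ι)
      (f : ι → Fin (n + 1) × Bool) (p : ι → MvPolynomial (Fin n) ℝ),
      r ∈ scalarPoly κ (n + 1) k → N.card ≤ N₀ →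
      (∫ x in refCell κ (n + 1), ‖evalVec (localField κ M r N f p) x‖ ^ 2 ≤
        C * ((∫ x in refCell κ (n + 1), ‖evalVec (gradP r) x‖ ^ 2) +
          ∑ j ∈ N, ∫ y in refCell κ n, evalPoly (p j) y ^ 2)) ∧
      1 / 4 * (∫ x in refCell κ (n + 1), ‖evalVec (gradP r) x‖ ^ 2) -
          1 / 4 * ∑ j ∈ N, ∫ y in refCell κ n, evalPoly (p j) y ^ 2 ≤
        -∫ x in refCell κ (n + 1),
          fderiv ℝ (evalPoly r) x (evalVec (localField κ M r N f p) x) := by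
  obtain ⟨c, hc, hbub⟩ := exists_bubbleField_coercive κ n k
  set M : ℝ := (N₀ * (n + 1) + 1 / 4) / c with hM
  have hM0 : 0 ≤ M := by positivity
  set C₁ : ℝ := 2 * M ^ 2 * ((n + 1) * (n + 2) ^ 2) with hC₁
  set C₂ : ℝ := 2 * N₀ * (n + 1) with hC₂
  refine ⟨M, C₁ + C₂ + 1, by positivity, fun {ι} r N f p hr hN => ?_⟩
  set K := refCell κ (n + 1) with hK
  set D := ∫ x in K, ‖evalVec (gradP r) x‖ ^ 2 with hD
  set J : ι → ℝ := fun j => ∫ y in refCell κ n, evalPoly (p j) y ^ 2 with hJ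
  set w : ι → Fin (n + 1) → MvPolynomial (Fin (n + 1)) ℝ := fun j l =>
    MvPolynomial.rename (f j).1.succAbove (p j) * facetField κ (f j) l with hw
  have hD0 : 0 ≤ D := integral_nonneg fun x => by positivity
  have hJ0 : ∀ j, 0 ≤ J j := fun j => integral_nonneg fun x => by positivity
  have hwJ : ∀ j, ∫ x in K, ‖evalVec (w j) x‖ ^ 2 ≤ (n + 1) * J j := by
    intro j
    calc _ ≤ ∫ x in K, (n + 1) * evalPoly (MvPolynomial.rename (f j).1.succAbove (p j)) x ^ 2 :=
          setIntegral_mono_on (integrableOn_refCell (by fun_prop))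
            (integrableOn_refCell (by fun_prop)) (measurableSet_refCell _ _)
            fun x hx => norm_mul_facetField_sq_le (f j) _ hx
      _ ≤ _ := by
          rw [integral_const_mul]
          exact mul_le_mul_of_nonneg_left (integral_rename_sq_le κ _ (p j)) (by positivity)
  have hbD : ∫ x in K, ‖evalVec (bubbleField κ r) x‖ ^ 2 ≤ (n + 1) * (n + 2) ^ 2 * D := by
    rw [hD, ← integral_const_mul]
    exact setIntegral_mono_on (integrableOn_refCell (by fun_prop))
      (integrableOn_refCell (by fun_prop)) (measurableSet_refCell _ _)
      fun x hx => norm_bubbleField_sq_le r hx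
  have hev : ∀ x, evalVec (localField κ M r N f p) x =
      (-M) • evalVec (bubbleField κ r) x + ∑ j ∈ N, evalVec (w j) x := fun x => by
    simp only [localField, evalVec_add, evalVec_smul, evalVec_sum, hw]
  constructor
  · have hpt : ∀ x, ‖evalVec (localField κ M r N f p) x‖ ^ 2 ≤
        2 * M ^ 2 * ‖evalVec (bubbleField κ r) x‖ ^ 2 +
          ∑ j ∈ N, 2 * N₀ * ‖evalVec (w j) x‖ ^ 2 := by
      intro x
      rw [hev]
      have h1 : ‖∑ j ∈ N, evalVec (w j) x‖ ^ 2 ≤ N₀ * ∑ j ∈ N, ‖evalVec (w j) x‖ ^ 2 := by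
        calc _ ≤ (∑ j ∈ N, ‖evalVec (w j) x‖) ^ 2 := by
              gcongr; exact norm_sum_le _ _
          _ ≤ N.card * ∑ j ∈ N, ‖evalVec (w j) x‖ ^ 2 := sq_sum_le_card_mul_sum_sq
          _ ≤ _ := by gcongr
      have h2 := norm_add_le ((-M) • evalVec (bubbleField κ r) x) (∑ j ∈ N, evalVec (w j) x)
      have h3 : ‖(-M) • evalVec (bubbleField κ r) x‖ = M * ‖evalVec (bubbleField κ r) x‖ := by
        rw [norm_smul, norm_neg, Real.norm_of_nonneg hM0]
      rw [h3] at h2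
      rw [← Finset.mul_sum]
      set A := M * ‖evalVec (bubbleField κ r) x‖
      set B := ‖∑ j ∈ N, evalVec (w j) x‖
      have h4 : ‖(-M) • evalVec (bubbleField κ r) x + ∑ j ∈ N, evalVec (w j) x‖ ^ 2 ≤
          (A + B) ^ 2 := by gcongr
      have h5 : 2 * M ^ 2 * ‖evalVec (bubbleField κ r) x‖ ^ 2 = 2 * A ^ 2 := by ring
      rw [h5]
      nlinarith [sq_nonneg (A - B)]
    calc _ ≤ ∫ x in K, (2 * M ^ 2 * ‖evalVec (bubbleField κ r) x‖ ^ 2 +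
          ∑ j ∈ N, 2 * N₀ * ‖evalVec (w j) x‖ ^ 2) :=
          integral_mono (integrableOn_refCell (by fun_prop)) (integrableOn_refCell (by fun_prop))
            hpt
      _ = 2 * M ^ 2 * (∫ x in K, ‖evalVec (bubbleField κ r) x‖ ^ 2) +
          ∑ j ∈ N, 2 * N₀ * ∫ x in K, ‖evalVec (w j) x‖ ^ 2 := by
          rw [integral_add (integrableOn_refCell (by fun_prop))
            (integrableOn_refCell (by fun_prop)), integral_const_mul,
            integral_finsetSum _ fun j _ => integrableOn_refCell (by fun_prop)]
          simp only [integral_const_mul, hK]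
      _ ≤ C₁ * D + ∑ j ∈ N, C₂ * J j := by
          refine add_le_add ?_ (Finset.sum_le_sum fun j _ => ?_)
          · rw [hC₁, mul_assoc _ _ D]; exact mul_le_mul_of_nonneg_left hbD (by positivity)
          · rw [hC₂, mul_assoc _ _ (J j)]; exact mul_le_mul_of_nonneg_left (hwJ j) (by positivity)
      _ ≤ _ := by
          rw [← Finset.mul_sum]
          have hS : 0 ≤ ∑ j ∈ N, J j := Finset.sum_nonneg fun j _ => hJ0 j
          have h1 : 0 ≤ C₁ := by positivity
          have h2 : 0 ≤ C₂ := by positivity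
          nlinarith [mul_nonneg h1 hS, mul_nonneg h2 hD0]
  · have hcf : ∀ w, Continuous fun x => fderiv ℝ (evalPoly r) x (evalVec w x) := fun w =>
      ((contDiff_evalPoly r).continuous_fderiv (n := 1) (by simp)).clm_apply
        (continuous_evalVec w)
    have hsplit : ∫ x in K, fderiv ℝ (evalPoly r) x (evalVec (localField κ M r N f p) x) =
        -M * (∫ x in K, fderiv ℝ (evalPoly r) x (evalVec (bubbleField κ r) x)) +
          ∑ j ∈ N, ∫ x in K, fderiv ℝ (evalPoly r) x (evalVec (w j) x) := by
      simp only [hev, map_add, map_smul, map_sum, smul_eq_mul]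
      rw [integral_add ((integrableOn_refCell (hcf _)).const_mul _)
        (integrable_finsetSum _ fun j _ => integrableOn_refCell (hcf _)), integral_const_mul,
        integral_finsetSum _ fun j _ => integrableOn_refCell (hcf _)]
    -- Young's inequality for the interaction of the gradient with a facet field
    have hcross : ∀ j, ∫ x in K, fderiv ℝ (evalPoly r) x (evalVec (w j) x) ≤
        (n + 1) * D + 1 / 4 * J j := by
      intro j
      have hn : (0 : ℝ) < n + 1 := by positivity
      calc _ ≤ ∫ x in K, ((n + 1) * ‖evalVec (gradP r) x‖ ^ 2 +
            1 / (4 * (n + 1)) * ‖evalVec (w j) x‖ ^ 2) := by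
            refine integral_mono (integrableOn_refCell (hcf _))
              (integrableOn_refCell (by fun_prop)) fun x => ?_
            simp only
            rw [fderiv_evalPoly_eq_inner]
            refine (real_inner_le_norm _ _).trans ?_
            set a := ‖evalVec (gradP r) x‖
            set b := ‖evalVec (w j) x‖
            have : (n + 1) * a ^ 2 + 1 / (4 * (n + 1)) * b ^ 2 - a * b =
                1 / (4 * (n + 1)) * (2 * (n + 1) * a - b) ^ 2 := by field_simp; ring
            have h2 : 0 ≤ 1 / (4 * ((n : ℝ) + 1)) * (2 * (n + 1) * a - b) ^ 2 := by positivity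
            linarith
        _ = (n + 1) * D + 1 / (4 * (n + 1)) * ∫ x in K, ‖evalVec (w j) x‖ ^ 2 := by
            rw [integral_add (integrableOn_refCell (by fun_prop))
              (integrableOn_refCell (by fun_prop)), integral_const_mul, integral_const_mul]
        _ ≤ (n + 1) * D + 1 / (4 * (n + 1)) * ((n + 1) * J j) := by
            gcongr; exact hwJ j
        _ = _ := by field_simp
    have hsum : ∑ j ∈ N, ∫ x in K, fderiv ℝ (evalPoly r) x (evalVec (w j) x) ≤
        N₀ * (n + 1) * D + 1 / 4 * ∑ j ∈ N, J j := by
      calc _ ≤ ∑ j ∈ N, ((n + 1) * D + 1 / 4 * J j) := Finset.sum_le_sum fun j _ => hcross j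
        _ = N.card * ((n + 1) * D) + 1 / 4 * ∑ j ∈ N, J j := by
            rw [Finset.sum_add_distrib, Finset.sum_const, nsmul_eq_mul, Finset.mul_sum]
        _ ≤ N₀ * ((n + 1) * D) + 1 / 4 * ∑ j ∈ N, J j := by gcongr
        _ = _ := by ring
    have hb : (N₀ * (n + 1) + 1 / 4) * D ≤
        M * ∫ x in K, fderiv ℝ (evalPoly r) x (evalVec (bubbleField κ r) x) := by
      calc (N₀ * (n + 1) + 1 / 4) * D = M * (c * D) := by rw [hM]; field_simp
        _ ≤ _ := mul_le_mul_of_nonneg_left (hbub r hr) hM0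
    rw [hsplit]
    linarith

end Energy

/-! ### Scaling of the element maps -/

section Linear

variable {d : ℕ}

lemma abs_det_le_pow (L : Pt d →L[ℝ] Pt d) {A : ℝ} (hA : 0 ≤ A) (h : ∀ u, ‖L u‖ ≤ A * ‖u‖) :
    |L.det| ≤ A ^ d := by
  have h1 : (L : Pt d → Pt d) '' Metric.closedBall 0 1 ⊆ Metric.closedBall 0 A := by
    rintro _ ⟨u, hu, rfl⟩
    rw [mem_closedBall_zero_iff] at hu ⊢
    exact (h u).trans (mul_le_of_le_one_right hA hu)
  have h2 := measure_mono (μ := volume) h1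
  have h3 : (L : Pt d → Pt d) '' Metric.closedBall 0 1 =
      L.toLinearMap '' Metric.closedBall 0 1 := rfl
  rw [h3, Measure.addHaar_image_linearMap, Measure.addHaar_closedBall _ _ hA,
    Measure.addHaar_closedBall _ _ zero_le_one, one_pow, ENNReal.ofReal_one, one_mul] at h2
  have h4 := (ENNReal.mul_le_mul_iff_left (Metric.measure_ball_pos volume (0 : Pt d) one_pos).ne'
    measure_ball_lt_top.ne).1 h2
  rw [finrank_euclideanSpace_fin] at h4
  exact (ENNReal.ofReal_le_ofReal_iff (by positivity)).1 h4

lemma pow_le_abs_det (L : Pt d →L[ℝ] Pt d) {a : ℝ} (ha : 0 < a) (h : ∀ u, a * ‖u‖ ≤ ‖L u‖) :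
    a ^ d ≤ |L.det| := by
  have hinj : Function.Injective L := by
    rw [← ContinuousLinearMap.coe_coe, ← LinearMap.ker_eq_bot, LinearMap.ker_eq_bot']
    intro u hu
    have := h u
    rw [ContinuousLinearMap.coe_coe] at hu
    rw [hu, norm_zero] at this
    exact norm_eq_zero.1 (le_antisymm (nonpos_of_mul_nonpos_right this ha) (norm_nonneg u))
  have hsurj : Function.Surjective L.toLinearMap := LinearMap.injective_iff_surjective.1 hinj
  have h1 : Metric.closedBall 0 a ⊆ L.toLinearMap '' Metric.closedBall 0 1 := by
    intro y hy
    obtain ⟨u, rfl⟩ := hsurj y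
    rw [mem_closedBall_zero_iff] at hy
    refine ⟨u, ?_, rfl⟩
    rw [mem_closedBall_zero_iff]
    have := (h u).trans hy
    exact le_of_mul_le_mul_left (by simpa using this) ha
  have h2 := measure_mono (μ := volume) h1
  rw [Measure.addHaar_image_linearMap, Measure.addHaar_closedBall _ _ ha.le,
    Measure.addHaar_closedBall _ _ zero_le_one, one_pow, ENNReal.ofReal_one, one_mul] at h2
  have h4 := (ENNReal.mul_le_mul_iff_left (Metric.measure_ball_pos volume (0 : Pt d) one_pos).ne'
    measure_ball_lt_top.ne).1 h2
  rw [finrank_euclideanSpace_fin] at h4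
  exact (ENNReal.ofReal_le_ofReal_iff (abs_nonneg _)).1 h4

lemma norm_le_of_norm_single_le {W : Type*} [NormedAddCommGroup W] [NormedSpace ℝ W]
    (L : Pt d →L[ℝ] W) {A : ℝ}
    (h : ∀ j, ‖L (EuclideanSpace.single j 1)‖ ≤ A) (u : Pt d) : ‖L u‖ ≤ d * A * ‖u‖ := by
  have h1 : u = ∑ m, u m • (EuclideanSpace.single m 1 : Pt d) := by
    ext j; simp [Finset.sum_apply, WithLp.ofLp_sum, Pi.single_apply]
  calc ‖L u‖ = ‖∑ m, u m • L (EuclideanSpace.single m 1)‖ := by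
        conv_lhs => rw [h1, map_sum]
        simp
    _ ≤ ∑ _m : Fin d, ‖u‖ * A := by
        refine (norm_sum_le _ _).trans (Finset.sum_le_sum fun m _ => ?_)
        rw [norm_smul]
        exact mul_le_mul (PiLp.norm_apply_le u m) (h m) (norm_nonneg _) (norm_nonneg _)
    _ = d * A * ‖u‖ := by simp; ring

/-- For a polynomial which is affine in the `j`-th variable, the partial derivative is a
difference quotient. -/
lemma evalPoly_pderiv_eq_sub {p : MvPolynomial (Fin d) ℝ} {j : Fin d} (hp : p.degreeOf j ≤ 1)
    (x : Pt d) (s t : ℝ) (hst : t - s = 1) :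
    evalPoly (MvPolynomial.pderiv j p) x =
      evalPoly p (x + t • EuclideanSpace.single j 1) -
        evalPoly p (x + s • EuclideanSpace.single j 1) := by
  have hline : ∀ r : ℝ, HasDerivAt (fun r : ℝ => x + r • (EuclideanSpace.single j 1 : Pt d))
      (EuclideanSpace.single j 1) r := fun r => by
    simpa using ((hasDerivAt_id r).smul_const (EuclideanSpace.single j 1 : Pt d)).const_add x
  have hder : ∀ (q : MvPolynomial (Fin d) ℝ) (r : ℝ),
      HasDerivAt (fun r : ℝ => evalPoly q (x + r • (EuclideanSpace.single j 1 : Pt d)))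
        (evalPoly (MvPolynomial.pderiv j q) (x + r • (EuclideanSpace.single j 1 : Pt d))) r := by
    intro q r
    have := (differentiable_evalPoly q _).hasFDerivAt.comp_hasDerivAt r (hline r)
    rwa [fderiv_evalPoly_apply, Finset.sum_eq_single j (by simp +contextual) (by simp),
      PiLp.single_apply, if_pos rfl, mul_one] at this
  have h0 : MvPolynomial.pderiv j (MvPolynomial.pderiv j p) = 0 := by
    refine pderiv_eq_zero_of_degreeOf_eq_zero ?_
    have := degreeOf_pderiv_le j j p
    simp at this; omega
  have hconst : ∀ r : ℝ, evalPoly (MvPolynomial.pderiv j p)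
      (x + r • (EuclideanSpace.single j 1 : Pt d)) = evalPoly (MvPolynomial.pderiv j p) x := by
    intro r
    have := is_const_of_deriv_eq_zero (𝕜 := ℝ)
      (fun r => (hder (MvPolynomial.pderiv j p) r).differentiableAt)
      (fun r => by rw [(hder (MvPolynomial.pderiv j p) r).deriv, h0, evalPoly_zero]) r 0
    simpa using this
  set c := evalPoly (MvPolynomial.pderiv j p) x with hc
  have hd : ∀ r : ℝ, HasDerivAt (fun r : ℝ =>
      evalPoly p (x + r • (EuclideanSpace.single j 1 : Pt d)) - r * c) 0 r := by
    intro r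
    have := (hder p r).fun_sub ((hasDerivAt_id r).mul_const c)
    rw [hconst] at this
    simpa using this
  have h2 :=
    is_const_of_deriv_eq_zero (fun r => (hd r).differentiableAt) (fun r => (hd r).deriv) t s
  linear_combination (-c) * hst - h2

end Linear

namespace Mesh

section Geometry

variable {κ : CellKind} {d : ℕ} (T : Mesh κ d)

lemma exists_F_eq (i : Fin T.card) : ∃ w : Fin d → MvPolynomial (Fin d) ℝ,
    (∀ a, w a ∈ scalarPoly κ d 1) ∧ T.F i = evalVec w := by
  obtain ⟨w, hw, h⟩ := T.F_poly i
  exact ⟨w, hw, funext h⟩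

lemma contDiff_F {m : WithTop ℕ∞} (i : Fin T.card) : ContDiff ℝ m (T.F i) := by
  obtain ⟨w, -, h⟩ := T.exists_F_eq i
  rw [h]; exact contDiff_evalVec w

lemma continuous_F (i : Fin T.card) : Continuous (T.F i) := (T.contDiff_F (m := 0) i).continuous

lemma differentiable_F (i : Fin T.card) : Differentiable ℝ (T.F i) :=
  (T.contDiff_F (m := 1) i).differentiable (by simp)

lemma continuous_fderiv_F (i : Fin T.card) : Continuous (fderiv ℝ (T.F i)) :=
  (T.contDiff_F (m := 1) i).continuous_fderiv (by simp)

lemma continuous_det_F (i : Fin T.card) : Continuous fun x => (fderiv ℝ (T.F i) x).det :=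
  ContinuousLinearMap.continuous_det.comp (T.continuous_fderiv_F i)

lemma isCompact_cell (i : Fin T.card) : IsCompact (T.cell i) :=
  (isCompact_refCell κ d).image (T.continuous_F i)

lemma measurableSet_cell (i : Fin T.card) : MeasurableSet (T.cell i) :=
  (T.isCompact_cell i).isClosed.measurableSet

lemma F_mem_cell (i : Fin T.card) {x : Pt d} (hx : x ∈ refCell κ d) : T.F i x ∈ T.cell i :=
  Set.mem_image_of_mem _ hx

lemma surjective_fderiv_F (i : Fin T.card) {x : Pt d} (hx : x ∈ refCell κ d) :
    Function.Surjective (fderiv ℝ (T.F i) x) :=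
  (LinearEquiv.ofIsUnitDet (f := (fderiv ℝ (T.F i) x).toLinearMap)
    (v := Module.finBasis ℝ (Pt d)) (v' := Module.finBasis ℝ (Pt d)) (by
      rw [LinearMap.det_toMatrix]; exact isUnit_iff_ne_zero.2 (T.F_det i x hx))).surjective

lemma F_mem_interior_cell (i : Fin T.card) {x : Pt d} (hx : x ∈ openRefCell κ d) :
    T.F i x ∈ interior (T.cell i) := by
  have hs : HasStrictFDerivAt (T.F i) (fderiv ℝ (T.F i) x) x :=
    (T.contDiff_F (m := 1) i).contDiffAt.hasStrictFDerivAt (by simp)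
  have h1 := hs.map_nhds_eq_of_surj
    (LinearMap.range_eq_top.2 (T.surjective_fderiv_F i (openRefCell_subset κ d hx)))
  rw [mem_interior_iff_mem_nhds, ← h1, Filter.mem_map]
  exact Filter.mem_of_superset ((isOpen_openRefCell κ d).mem_nhds hx)
    fun y hy => T.F_mem_cell i (openRefCell_subset κ d hy)

lemma volume_image_null (i : Fin T.card) {s : Set (Pt d)} (hs : volume s = 0) :
    volume (T.F i '' s) = 0 :=
  addHaar_image_eq_zero_of_differentiableOn_of_addHaar_eq_zero _
    (T.differentiable_F i).differentiableOn hs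

lemma volume_cell_diff_interior (i : Fin T.card) :
    volume (T.cell i \ interior (T.cell i)) = 0 := by
  refine measure_mono_null ?_ (T.volume_image_null i (volume_refCell_diff_open κ d))
  rintro _ ⟨⟨x, hx, rfl⟩, h⟩
  exact ⟨x, ⟨hx, fun hx' => h (T.F_mem_interior_cell i hx')⟩, rfl⟩

lemma interior_cell_ae_eq (i : Fin T.card) : interior (T.cell i) =ᵐ[volume] T.cell i :=
  Filter.EventuallyLE.antisymm interior_subset.eventuallyLE
    (ae_le_set.2 (T.volume_cell_diff_interior i))

lemma volume_cell_inter {i j : Fin T.card} (hij : i ≠ j) :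
    volume (T.cell i ∩ T.cell j) = 0 := by
  rcases T.admissible i j hij with h | ⟨s, hs, -, -, -, -, -, h⟩
  · rw [cell, cell, h, measure_empty]
  · rw [cell, cell, h]
    exact T.volume_image_null i (refFace_null hs).2

lemma disjoint_interior {i j : Fin T.card} (hij : i ≠ j) :
    Disjoint (interior (T.cell i)) (interior (T.cell j)) := by
  rw [Set.disjoint_iff_inter_eq_empty]
  refine (isOpen_interior.inter isOpen_interior).eq_empty_of_measure_zero (μ := volume) ?_
  exact measure_mono_null (Set.inter_subset_inter interior_subset interior_subset)
    (T.volume_cell_inter hij)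

lemma interior_cell_subset_domain (i : Fin T.card) : interior (T.cell i) ⊆ T.domain :=
  interior_mono (Set.subset_iUnion T.cell i)

lemma setIntegral_interior_cell {W : Type*} [NormedAddCommGroup W] [NormedSpace ℝ W]
    (i : Fin T.card) (g : Pt d → W) :
    ∫ x in interior (T.cell i), g x =
      ∫ x in refCell κ d, |(fderiv ℝ (T.F i) x).det| • g (T.F i x) := by
  rw [setIntegral_congr_set (T.interior_cell_ae_eq i)]
  exact integral_image_eq_integral_abs_det_fderiv_smul volume (measurableSet_refCell κ d)
    (fun x _ => (T.differentiable_F i x).hasFDerivAt.hasFDerivWithinAt) (T.F_injOn i) g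

/-- The inverse of the element map. -/
noncomputable def inv (i : Fin T.card) : Pt d → Pt d := Function.invFunOn (T.F i) (refCell κ d)

lemma inv_F (i : Fin T.card) {x : Pt d} (hx : x ∈ refCell κ d) : T.inv i (T.F i x) = x :=
  (T.F_injOn i).leftInvOn_invFunOn hx

lemma inv_mem (i : Fin T.card) {y : Pt d} (hy : y ∈ T.cell i) : T.inv i y ∈ refCell κ d := by
  obtain ⟨x, hx, rfl⟩ := hy
  rwa [T.inv_F i hx]

lemma continuousOn_inv (i : Fin T.card) : ContinuousOn (T.inv i) (T.cell i) := by
  rw [continuousOn_iff_isClosed]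
  intro t ht
  refine ⟨T.F i '' (refCell κ d ∩ t), ?_, ?_⟩
  · exact (((isCompact_refCell κ d).inter_right ht).image (T.continuous_F i)).isClosed
  · ext y
    constructor
    · rintro ⟨hy, x, hx, rfl⟩
      refine ⟨⟨x, ⟨hx, ?_⟩, rfl⟩, T.F_mem_cell i hx⟩
      rw [Set.mem_preimage, T.inv_F i hx] at hy
      exact hy
    · rintro ⟨⟨x, ⟨hx, hxt⟩, rfl⟩, hy⟩
      refine ⟨?_, hy⟩
      rw [Set.mem_preimage, T.inv_F i hx]
      exact hxt

/-! ### Gluing -/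

lemma glue_of_mem_interior {W : Type*} [AddCommMonoid W] (u : Fin T.card → Pt d → W)
    {i : Fin T.card} {x : Pt d} (hx : x ∈ interior (T.cell i)) : T.glue u x = u i x := by
  rw [glue, Finset.sum_eq_single i, Set.indicator_of_mem hx]
  · intro j _ hj
    exact Set.indicator_of_notMem (fun h => (T.disjoint_interior hj).le_bot ⟨h, hx⟩) _
  · simp

lemma memLp_indicator {W : Type*} [NormedAddCommGroup W]
    {u : Pt d → W} {i : Fin T.card} (hu : ContinuousOn u (T.cell i)) :
    MemLp ((interior (T.cell i)).indicator u) 2 := by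
  rw [memLp_indicator_iff_restrict isOpen_interior.measurableSet]
  obtain ⟨C, hC⟩ := (T.isCompact_cell i).exists_bound_of_continuousOn hu
  have hfin : IsFiniteMeasure (volume.restrict (interior (T.cell i))) :=
    isFiniteMeasure_restrict.2 ((measure_mono interior_subset).trans_lt
      (T.isCompact_cell i).measure_lt_top).ne
  refine MemLp.of_bound ((hu.mono interior_subset).aestronglyMeasurable_of_isSeparable
    isOpen_interior.measurableSet ?_) C ?_
  · exact TopologicalSpace.IsSeparable.of_separableSpace _
  · exact ae_restrict_of_forall_mem isOpen_interior.measurableSet fun x hx =>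
      hC x (interior_subset hx)

lemma memLp_glue {W : Type*} [NormedAddCommGroup W]
    {u : Fin T.card → Pt d → W} (hu : ∀ i, ContinuousOn (u i) (T.cell i)) :
    MemLp (T.glue u) 2 := by
  have : T.glue u = ∑ i, (interior (T.cell i)).indicator (u i) := by
    ext x; simp [glue, Finset.sum_apply]
  rw [this]
  exact memLp_finsetSum' _ fun i _ => T.memLp_indicator (hu i)

/-- An integral over `U` of a glued function which is determined elementwise. -/
lemma setIntegral_glue {W : Type*} [NormedAddCommGroup W] [NormedSpace ℝ W]
    {u : Fin T.card → Pt d → W} (hu : ∀ i, ContinuousOn (u i) (T.cell i)) {U : Set (Pt d)} :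
    ∫ x in U, T.glue u x = ∑ i, ∫ x in U ∩ interior (T.cell i), u i x := by
  have hint : ∀ i, Integrable ((interior (T.cell i)).indicator (u i)) := fun i => by
    rw [integrable_indicator_iff isOpen_interior.measurableSet]
    exact ((hu i).integrableOn_compact (T.isCompact_cell i)).mono_set interior_subset
  unfold glue
  rw [integral_finsetSum _ fun i _ => (hint i).integrableOn]
  refine Finset.sum_congr rfl fun i _ => ?_
  exact setIntegral_indicator isOpen_interior.measurableSet

lemma glue_map {W₁ W₂ : Type*} [AddCommMonoid W₁] [AddCommMonoid W₂]
    (Φ : Pt d → W₁ → W₂) (hΦ : ∀ x, Φ x 0 = 0) (u : Fin T.card → Pt d → W₁) (x : Pt d) :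
    Φ x (T.glue u x) = T.glue (fun i y => Φ y (u i y)) x := by
  by_cases h : ∃ i, x ∈ interior (T.cell i)
  · obtain ⟨i, hi⟩ := h
    simp only [T.glue_of_mem_interior _ hi]
  · push Not at h
    simp [glue, Set.indicator_of_notMem (h _), hΦ]

lemma glue_mul (u v : Fin T.card → Pt d → ℝ) (x : Pt d) :
    T.glue u x * T.glue v x = T.glue (fun i y => u i y * v i y) x := by
  by_cases h : ∃ i, x ∈ interior (T.cell i)
  · obtain ⟨i, hi⟩ := h
    simp only [T.glue_of_mem_interior _ hi]
  · push Not at h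
    simp [glue, Set.indicator_of_notMem (h _)]

end Geometry

/-! ### Shape regularity -/

section Shape

variable {κ : CellKind} {d : ℕ} (T : Mesh κ d)

lemma norm_F_sub_le_diam (i : Fin T.card) {x y : Pt d} (hx : x ∈ refCell κ d)
    (hy : y ∈ refCell κ d) :
    ‖T.F i x - T.F i y‖ ≤ Metric.diam (T.cell i) := by
  rw [← dist_eq_norm]
  exact Metric.dist_le_diam_of_mem (T.isCompact_cell i).isBounded (T.F_mem_cell i hx)
    (T.F_mem_cell i hy)

/-- The element maps of simplices are affine. -/
lemma F_sub_eq_fderiv_of_simplex (T : Mesh CellKind.simplex d) (i : Fin T.card) (x₀ x y : Pt d) :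
    T.F i x - T.F i y = fderiv ℝ (T.F i) x₀ (x - y) := by
  obtain ⟨w, hw, hF⟩ := T.exists_F_eq i
  ext l
  have hd : ∀ z, HasFDerivAt (evalPoly (w l)) (fderiv ℝ (evalPoly (w l)) x₀) z := by
    intro z
    refine (differentiable_evalPoly (w l) z).hasFDerivAt.congr_fderiv ?_
    ext v
    rw [fderiv_evalPoly_apply, fderiv_evalPoly_apply]
    refine Finset.sum_congr rfl fun m _ => ?_
    have h1 : (MvPolynomial.pderiv m (w l)).totalDegree = 0 := by
      have h2 := totalDegree_pderiv_le m (w l)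
      have h3 : (w l).totalDegree ≤ 1 := hw l
      omega
    rw [MvPolynomial.totalDegree_eq_zero_iff_eq_C.1 h1, evalPoly_C, evalPoly_C]
  have hg : ∀ z, HasFDerivAt (fun z => evalPoly (w l) z - fderiv ℝ (evalPoly (w l)) x₀ z)
      (0 : Pt d →L[ℝ] ℝ) z := fun z => by
    simpa using (hd z).fun_sub (fderiv ℝ (evalPoly (w l)) x₀).hasFDerivAt
  have h2 := is_const_of_fderiv_eq_zero (fun z => (hg z).differentiableAt)
    (fun z => (hg z).fderiv) x y
  have h3 : fderiv ℝ (T.F i) x₀ (x - y) l = fderiv ℝ (evalPoly (w l)) x₀ (x - y) := by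
    have h4 := ((EuclideanSpace.proj l : Pt d →L[ℝ] ℝ).hasFDerivAt.comp x₀
      (T.differentiable_F i x₀).hasFDerivAt)
    have h5 : ((EuclideanSpace.proj l : Pt d →L[ℝ] ℝ) ∘ T.F i) = evalPoly (w l) := by
      rw [hF]; ext z; simp
    rw [h5] at h4
    rw [h4.fderiv]; simp
  rw [h3, map_sub]
  simp only [PiLp.sub_apply, hF, evalVec_apply]
  linarith

/-- The partial derivatives of an element map are differences of two points of the element: the
map is affine in each variable, and a segment of unit length in the direction of the `j`-th axis
fits into the reference element. -/
lemma norm_fderiv_F_single_le (i : Fin T.card) {x : Pt d} (hx : x ∈ refCell κ d) (j : Fin d) :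
    ‖fderiv ℝ (T.F i) x (EuclideanSpace.single j 1)‖ ≤ Metric.diam (T.cell i) := by
  cases κ with
  | simplex =>
    have h := F_sub_eq_fderiv_of_simplex T i x (EuclideanSpace.single j 1) 0
    rw [sub_zero] at h
    rw [← h]
    exact T.norm_F_sub_le_diam i (single_mem_refCell _ j) (zero_mem_refCell _ d)
  | cube =>
    obtain ⟨w, hw, hF⟩ := T.exists_F_eq i
    have h1 : fderiv ℝ (T.F i) x (EuclideanSpace.single j 1) =
        T.F i (x + (1 - x j) • EuclideanSpace.single j 1) -
          T.F i (x + (-x j) • EuclideanSpace.single j 1) := by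
      ext l
      have h4 := ((EuclideanSpace.proj l : Pt d →L[ℝ] ℝ).hasFDerivAt.comp x
        (T.differentiable_F i x).hasFDerivAt)
      have h5 : ((EuclideanSpace.proj l : Pt d →L[ℝ] ℝ) ∘ T.F i) = evalPoly (w l) := by
        rw [hF]; ext z; simp
      rw [h5] at h4
      have h6 : fderiv ℝ (T.F i) x (EuclideanSpace.single j 1) l =
          fderiv ℝ (evalPoly (w l)) x (EuclideanSpace.single j 1) := by
        rw [h4.fderiv]; simp
      rw [h6, fderiv_evalPoly_apply, Finset.sum_eq_single j (by simp +contextual) (by simp),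
        PiLp.single_apply, if_pos rfl, mul_one,
        evalPoly_pderiv_eq_sub (hw l j) x (-x j) (1 - x j) (by ring)]
      simp only [PiLp.sub_apply, hF, evalVec_apply]
    rw [h1]
    refine T.norm_F_sub_le_diam i ?_ ?_ <;>
    · intro m
      have := hx m
      by_cases hm : m = j
      · subst hm; simp
      · simp [hm, this]

lemma norm_fderiv_F_le (i : Fin T.card) {x : Pt d} (hx : x ∈ refCell κ d) (u : Pt d) :
    ‖fderiv ℝ (T.F i) x u‖ ≤ d * Metric.diam (T.cell i) * ‖u‖ :=
  norm_le_of_norm_single_le _ (T.norm_fderiv_F_single_le i hx) u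

/-- The inscribed ball bounds the inverse of the element map of a simplex. -/
lemma rho_mul_norm_le (T : Mesh CellKind.simplex d) (i : Fin T.card) {x : Pt d}
    (hx : x ∈ refCell CellKind.simplex d) (u : Pt d) :
    T.rho i * ‖u‖ ≤ 2 * √d * ‖fderiv ℝ (T.F i) x u‖ := by
  by_cases hu : u = 0
  · simp [hu]
  set L := fderiv ℝ (T.F i) x with hL
  have hinj : Function.Injective L :=
    LinearMap.injective_iff_surjective.2 (T.surjective_fderiv_F i hx)
  have hu' : 0 < ‖u‖ := norm_pos_iff.2 hu
  have hLu : 0 < ‖L u‖ := norm_pos_iff.2 fun h => hu (hinj (h.trans (map_zero L).symm))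
  rw [← le_div_iff₀ hu']
  refine Real.sSup_le ?_ (by positivity)
  rintro δ ⟨c, hc⟩
  rw [le_div_iff₀ hu']
  by_contra hlt
  push Not at hlt
  have hδ : 0 < δ := by
    by_contra h
    push Not at h
    have : δ * ‖u‖ ≤ 0 := mul_nonpos_of_nonpos_of_nonneg h hu'.le
    have : 0 ≤ 2 * √d * ‖L u‖ := by positivity
    linarith
  -- two almost opposite points of the ball in the direction `L u`
  obtain ⟨s, hs1, hs2⟩ : ∃ s, 2 * √d * ‖L u‖ / ‖u‖ < 2 * s ∧ s < δ / 2 := by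
    rw [← div_lt_iff₀ hu'] at hlt
    obtain ⟨r, h1, h2⟩ := exists_between hlt
    exact ⟨r / 2, by linarith, by linarith⟩
  have hs0 : 0 ≤ s := by
    have : 0 ≤ 2 * √d * ‖L u‖ / ‖u‖ := by positivity
    linarith
  have hball : ∀ t : ℝ, |t| = s → c + (t / ‖L u‖) • L u ∈ T.cell i := by
    intro t ht
    refine hc ?_
    rw [Metric.mem_ball, dist_eq_norm, add_sub_cancel_left, norm_smul, Real.norm_eq_abs, abs_div,
      abs_of_pos hLu, div_mul_cancel₀ _ hLu.ne', ht]
    exact hs2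
  obtain ⟨y, hy, hy'⟩ := hball s (abs_of_nonneg hs0)
  obtain ⟨z, hz, hz'⟩ := hball (-s) (by rw [abs_neg, abs_of_nonneg hs0])
  have h1 : L (y - z) = L ((2 * s / ‖L u‖) • u) := by
    rw [hL, ← F_sub_eq_fderiv_of_simplex T i x y z, hy', hz', ← hL, map_smul]
    module
  have h2 := hinj h1
  have h3 : ‖y - z‖ ≤ 2 * √d := (norm_sub_le _ _).trans (by
    linarith [norm_le_of_mem_refCell hy, norm_le_of_mem_refCell hz])
  rw [h2, norm_smul, Real.norm_of_nonneg (by positivity), div_mul_eq_mul_div, div_le_iff₀ hLu] at h3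
  rw [div_lt_iff₀ hu'] at hs1
  linarith

lemma diam_mul_norm_le {σ : ℝ} (hσ : 0 < σ) (hT : T.ShapeRegular σ) (i : Fin T.card) {x : Pt d}
    (hx : x ∈ refCell κ d) (u : Pt d) :
    Metric.diam (T.cell i) * ‖u‖ ≤ σ * (1 + 2 * √d) * ‖fderiv ℝ (T.F i) x u‖ := by
  have h0 : 0 ≤ √(d : ℝ) := Real.sqrt_nonneg _
  have h1 := norm_nonneg (fderiv ℝ (T.F i) x u)
  cases κ with
  | simplex =>
    calc _ ≤ σ * T.rho i * ‖u‖ := by gcongr; exact hT.1 i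
      _ = σ * (T.rho i * ‖u‖) := by ring
      _ ≤ σ * (2 * √d * ‖fderiv ℝ (T.F i) x u‖) :=
          mul_le_mul_of_nonneg_left (rho_mul_norm_le T i hx u) hσ.le
      _ ≤ _ := by nlinarith [mul_nonneg hσ.le h1]
  | cube =>
    refine (hT.2 rfl i x hx u).trans ?_
    nlinarith [mul_nonneg (mul_nonneg hσ.le h0) h1]

lemma diam_le_h (i : Fin T.card) : Metric.diam (T.cell i) ≤ T.h :=
  le_ciSup (f := fun i => Metric.diam (T.cell i)) (Set.finite_range _).bddAbove i

end Shape

section Uniform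

variable {κ : CellKind} {n : ℕ} (T : Mesh κ (n + 1))

lemma h_pos (i : Fin T.card) : 0 < T.h := by
  refine lt_of_lt_of_le ?_ (T.diam_le_h i)
  refine lt_of_lt_of_le ?_
    (T.norm_F_sub_le_diam i (single_mem_refCell κ 0) (zero_mem_refCell κ (n + 1)))
  rw [norm_pos_iff, sub_ne_zero]
  intro h
  have := T.F_injOn i (single_mem_refCell κ 0) (zero_mem_refCell κ (n + 1)) h
  simpa using congrArg (fun x : Pt (n + 1) => x 0) this

/-- The element maps of a shape regular, quasi-uniform mesh are uniformly bi-Lipschitz at scale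
`h`. -/
structure IsScaled (a : ℝ) : Prop where
  pos : 0 < a
  le_norm : ∀ i, ∀ x ∈ refCell κ (n + 1), ∀ u, a * T.h * ‖u‖ ≤ ‖fderiv ℝ (T.F i) x u‖
  norm_le : ∀ i, ∀ x ∈ refCell κ (n + 1), ∀ u,
    ‖fderiv ℝ (T.F i) x u‖ ≤ (n + 1) * T.h * ‖u‖

lemma isScaled {σ τ : ℝ} (hσ : 0 < σ) (hτ : 0 < τ) (h₁ : T.ShapeRegular σ)
    (h₂ : T.QuasiUniform τ) : T.IsScaled (τ / (σ * (1 + 2 * √((n + 1 : ℕ) : ℝ)))) where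
  pos := by positivity
  le_norm i x hx u := by
    have hc : 0 < σ * (1 + 2 * √((n + 1 : ℕ) : ℝ)) := by positivity
    rw [div_mul_eq_mul_div, div_mul_eq_mul_div, div_le_iff₀ hc]
    calc τ * T.h * ‖u‖ ≤ Metric.diam (T.cell i) * ‖u‖ := by gcongr; exact h₂ i
      _ ≤ _ := T.diam_mul_norm_le hσ h₁ i hx u
      _ = _ := by ring
  norm_le i x hx u := by
    refine (T.norm_fderiv_F_le i hx u).trans ?_
    push_cast
    gcongr
    exact T.diam_le_h i

end Uniform

end Mesh

/-! ### Estimates on scaled meshes -/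

section Facet

variable {n : ℕ}

lemma norm_facetMap_sub_le (κ : CellKind) (f : Fin (n + 1) × Bool) (y z : Pt n) :
    ‖facetMap κ f y - facetMap κ f z‖ ≤ (n + 1) * ‖y - z‖ := by
  obtain ⟨i, b⟩ := f
  have htop : ‖top κ y - top κ z‖ ≤ n * ‖y - z‖ := by
    cases κ with
    | simplex =>
      have : top CellKind.simplex y - top CellKind.simplex z = -∑ j, (y - z) j := by
        simp [top, Finset.sum_sub_distrib]
      rw [this, norm_neg]
      refine (norm_sum_le _ _).trans ?_
      calc _ ≤ ∑ _j : Fin n, ‖y - z‖ := Finset.sum_le_sum fun j _ => PiLp.norm_apply_le _ j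
        _ = _ := by simp
    | cube => simp [top]; positivity
  have hc : ‖(if b then top κ y else 0) - (if b then top κ z else 0)‖ ≤ n * ‖y - z‖ := by
    cases b
    · simp; positivity
    · simpa using htop
  have hsq : ‖facetMap κ (i, b) y - facetMap κ (i, b) z‖ ^ 2 ≤ ((n + 1) * ‖y - z‖) ^ 2 := by
    rw [EuclideanSpace.norm_sq_eq, Fin.sum_univ_succAbove _ i]
    simp only [facetMap, PiLp.sub_apply, ins_apply_same, ins_apply_succAbove]
    have h1 : ∑ j, ‖y j - z j‖ ^ 2 = ‖y - z‖ ^ 2 := by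
      rw [EuclideanSpace.norm_sq_eq]; simp
    rw [h1]
    have h2 := pow_le_pow_left₀ (norm_nonneg _) hc 2
    have h3 : (0 : ℝ) ≤ n := by positivity
    nlinarith [mul_nonneg h3 (sq_nonneg ‖y - z‖)]
  exact le_of_sq_le_sq hsq (by positivity)

/-- Integrals over a Lipschitz image of the reference element are controlled by integrals over the
reference element. No measurability of `g` is required. -/
lemma setIntegral_image_sq_le {e : ℕ} {S : Set (Pt n)} (hS : MeasurableSet S) {Φ : Pt n → Pt e}
    (hΦ : Continuous Φ) {L : ℝ} (hL : 0 ≤ L) (hLip : LipschitzOnWith L.toNNReal Φ S)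
    {g : Pt e → ℝ} {P : Pt n → ℝ} (hP : IntegrableOn (fun y => P y ^ 2) S)
    (hgP : ∀ y ∈ S, g (Φ y) = P y) :
    ∫ x in Φ '' S, g x ^ 2 ∂μHE[n] ≤ L ^ n * ∫ y in S, P y ^ 2 := by
  have hle : (μHE[n] : Measure (Pt e)).restrict (Φ '' S) ≤
      ENNReal.ofReal L ^ n • (volume.restrict S).map Φ := by
    refine Measure.le_iff.2 fun B hB => ?_
    rw [Measure.restrict_apply hB, Measure.smul_apply, smul_eq_mul,
      Measure.map_apply hΦ.measurable hB, Measure.restrict_apply (hΦ.measurable hB)]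
    have h1 : B ∩ Φ '' S = Φ '' (Φ ⁻¹' B ∩ S) := by
      rw [Set.inter_comm, Set.inter_comm _ S, Set.image_inter_preimage]
    rw [h1, ← EuclideanSpace.euclideanHausdorffMeasure_eq_volume,
      Measure.euclideanHausdorffMeasure_def, Measure.euclideanHausdorffMeasure_def]
    simp only [Measure.smul_apply]
    have h2 := (hLip.mono (Set.inter_subset_right (s := Φ ⁻¹' B))).hausdorffMeasure_image_le
      (d := n) (by positivity)
    rw [ENNReal.rpow_natCast] at h2
    rw [ENNReal.smul_def, ENNReal.smul_def, smul_eq_mul, smul_eq_mul, mul_left_comm]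
    gcongr
    exact h2
  have h1 : ENNReal.ofReal (∫ x in Φ '' S, g x ^ 2 ∂μHE[n]) ≤
      ENNReal.ofReal (L ^ n * ∫ y in S, P y ^ 2) := by
    calc ENNReal.ofReal (∫ x in Φ '' S, g x ^ 2 ∂μHE[n])
        = ‖∫ x in Φ '' S, g x ^ 2 ∂μHE[n]‖ₑ := by
          rw [Real.enorm_eq_ofReal (integral_nonneg fun x => sq_nonneg _)]
      _ ≤ ∫⁻ x in Φ '' S, ‖g x ^ 2‖ₑ ∂μHE[n] := enorm_integral_le_lintegral_enorm _
      _ ≤ ∫⁻ x, ‖g x ^ 2‖ₑ ∂(ENNReal.ofReal L ^ n • (volume.restrict S).map Φ) :=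
          lintegral_mono' hle le_rfl
      _ = ENNReal.ofReal L ^ n * ∫⁻ x, ‖g x ^ 2‖ₑ ∂((volume.restrict S).map Φ) :=
          lintegral_smul_measure _ _
      _ ≤ ENNReal.ofReal L ^ n * ∫⁻ y in S, ‖g (Φ y) ^ 2‖ₑ := by
          gcongr; exact lintegral_map_le _ _
      _ = ENNReal.ofReal L ^ n * ∫⁻ y in S, ENNReal.ofReal (P y ^ 2) := by
          congr 1
          refine setLIntegral_congr_fun hS fun y hy => ?_
          simp only [hgP y hy]
          rw [Real.enorm_eq_ofReal (sq_nonneg _)]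
      _ = _ := by
          rw [← ofReal_integral_eq_lintegral_ofReal hP (Filter.Eventually.of_forall fun y =>
            sq_nonneg _), ENNReal.ofReal_mul (by positivity), ENNReal.ofReal_pow hL]
  exact (ENNReal.ofReal_le_ofReal_iff (mul_nonneg (by positivity)
    (integral_nonneg fun y => sq_nonneg _))).1 h1

end Facet

namespace Mesh

variable {κ : CellKind} {n : ℕ} {T : Mesh κ (n + 1)} {a : ℝ}

lemma IsScaled.det_le (hT : T.IsScaled a) (i : Fin T.card) {x : Pt (n + 1)}
    (hx : x ∈ refCell κ (n + 1)) :
    |(fderiv ℝ (T.F i) x).det| ≤ ((n + 1) * T.h) ^ (n + 1) :=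
  abs_det_le_pow _ (by have := T.h_pos i; positivity) (hT.norm_le i x hx)

lemma IsScaled.le_det (hT : T.IsScaled a) (i : Fin T.card) {x : Pt (n + 1)}
    (hx : x ∈ refCell κ (n + 1)) :
    (a * T.h) ^ (n + 1) ≤ |(fderiv ℝ (T.F i) x).det| :=
  pow_le_abs_det _ (mul_pos hT.pos (T.h_pos i)) (hT.le_norm i x hx)

/-- An element meets boundedly many others: they have comparable volumes, disjoint interiors and
lie in a common ball of radius `2 h`. -/
lemma exists_card_le_of_inter_nonempty (κ : CellKind) (n : ℕ) {a : ℝ} (ha : 0 < a) : ∃ N₀ : ℕ,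
    ∀ T : Mesh κ (n + 1), T.IsScaled a → ∀ (i : Fin T.card) (s : Finset (Fin T.card)),
      (∀ j ∈ s, (T.cell i ∩ T.cell j).Nonempty) → s.card ≤ N₀ := by
  set v := (volume (refCell κ (n + 1))).toReal with hv
  set b := (volume (Metric.ball (0 : Pt (n + 1)) 1)).toReal with hb
  have hv0 : 0 < v := ENNReal.toReal_pos (volume_refCell_pos κ _).ne' (volume_refCell_lt_top κ _).ne
  refine ⟨⌈2 ^ (n + 1) * b / (a ^ (n + 1) * v)⌉₊, fun T hT i s hs => ?_⟩
  have hh := T.h_pos i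
  have hx₀ := T.F_mem_cell i (zero_mem_refCell κ (n + 1))
  set x₀ := T.F i 0
  have hsub : (⋃ j ∈ s, interior (T.cell j)) ⊆ Metric.closedBall x₀ (2 * T.h) := by
    intro y hy
    obtain ⟨j, hj, hy⟩ := Set.mem_iUnion₂.1 hy
    obtain ⟨z, hzi, hzj⟩ := hs j hj
    rw [Metric.mem_closedBall]
    calc dist y x₀ ≤ dist y z + dist z x₀ := dist_triangle _ _ _
      _ ≤ T.h + T.h := add_le_add
          ((Metric.dist_le_diam_of_mem (T.isCompact_cell j).isBounded (interior_subset hy)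
            hzj).trans (T.diam_le_h j))
          ((Metric.dist_le_diam_of_mem (T.isCompact_cell i).isBounded hzi hx₀).trans
            (T.diam_le_h i))
      _ = 2 * T.h := by ring
  have hvol : ∀ j, ENNReal.ofReal ((a * T.h) ^ (n + 1) * v) ≤ volume (interior (T.cell j)) := by
    intro j
    rw [measure_congr (T.interior_cell_ae_eq j)]
    have h1 := lintegral_abs_det_fderiv_eq_addHaar_image volume (measurableSet_refCell κ (n + 1))
      (fun x _ => (T.differentiable_F j x).hasFDerivAt.hasFDerivWithinAt) (T.F_injOn j)
    rw [cell, ← h1, ENNReal.ofReal_mul (by have := hT.pos; positivity), hv,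
      ENNReal.ofReal_toReal (volume_refCell_lt_top κ _).ne, ← setLIntegral_const]
    exact setLIntegral_mono' (measurableSet_refCell κ _) fun x hx =>
      ENNReal.ofReal_le_ofReal (hT.le_det j hx)
  have h2 := measure_mono (μ := volume) hsub
  rw [measure_biUnion_finset (fun j _ l _ hjl => T.disjoint_interior hjl)
    (fun j _ => isOpen_interior.measurableSet), Measure.addHaar_closedBall _ _ (by positivity),
    finrank_euclideanSpace_fin] at h2
  have h3 := (Finset.sum_le_sum fun j (_ : j ∈ s) => hvol j).trans h2
  rw [Finset.sum_const, nsmul_eq_mul] at h3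
  have h4 : (s.card : ℝ) * ((a * T.h) ^ (n + 1) * v) ≤ (2 * T.h) ^ (n + 1) * b := by
    have h5 := ENNReal.toReal_mono (ENNReal.mul_ne_top ENNReal.ofReal_ne_top
      measure_ball_lt_top.ne) h3
    rw [ENNReal.toReal_mul, ENNReal.toReal_mul, ENNReal.toReal_natCast,
      ENNReal.toReal_ofReal (by positivity), ENNReal.toReal_ofReal (by positivity)] at h5
    exact h5
  have h6 : (s.card : ℝ) ≤ 2 ^ (n + 1) * b / (a ^ (n + 1) * v) := by
    rw [le_div_iff₀ (by positivity)]
    have hhp : 0 < T.h ^ (n + 1) := by positivity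
    refine le_of_mul_le_mul_right ?_ hhp
    calc _ = (s.card : ℝ) * ((a * T.h) ^ (n + 1) * v) := by rw [mul_pow]; ring
      _ ≤ _ := h4
      _ = _ := by rw [mul_pow]; ring
  exact_mod_cast h6.trans (Nat.le_ceil _)

/-- Where `u` is not differentiable its gradient is zero by convention, so the bound needs no
smoothness of the inverse of the element map. -/
lemma IsScaled.norm_gradient_le (hT : T.IsScaled a) (i : Fin T.card) {u : Pt (n + 1) → ℝ}
    {p : MvPolynomial (Fin (n + 1)) ℝ} (hu : ∀ x ∈ refCell κ (n + 1), u (T.F i x) = evalPoly p x)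
    {x : Pt (n + 1)} (hx : x ∈ openRefCell κ (n + 1)) :
    a * T.h * ‖gradient u (T.F i x)‖ ≤ ‖evalVec (gradP p) x‖ := by
  by_cases hd : DifferentiableAt ℝ u (T.F i x)
  · set g := gradient u (T.F i x) with hg
    by_cases hg0 : g = 0
    · simp [hg0]
    obtain ⟨z, hz⟩ := T.surjective_fderiv_F i (openRefCell_subset κ _ hx) g
    have hcomp : fderiv ℝ (evalPoly p) x = (fderiv ℝ u (T.F i x)).comp (fderiv ℝ (T.F i) x) := by
      have h1 := (hd.hasFDerivAt.comp x (T.differentiable_F i x).hasFDerivAt)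
      have h2 : u ∘ T.F i =ᶠ[𝓝 x] evalPoly p :=
        Filter.eventually_of_mem ((isOpen_openRefCell κ _).mem_nhds hx)
          fun y hy => hu y (openRefCell_subset κ _ hy)
      exact (h1.congr_of_eventuallyEq h2.symm).fderiv
    have h3 : ‖g‖ ^ 2 = inner ℝ (evalVec (gradP p) x) z := by
      rw [← real_inner_self_eq_norm_sq, ← fderiv_evalPoly_eq_inner, hcomp,
        ContinuousLinearMap.comp_apply, hz, ← inner_gradient_eq_fderiv]
    have h4 := hT.le_norm i x (openRefCell_subset κ _ hx) z
    rw [hz] at h4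
    have h5 : ‖g‖ ^ 2 ≤ ‖evalVec (gradP p) x‖ * ‖z‖ := h3 ▸ real_inner_le_norm _ _
    have hgpos : 0 < ‖g‖ := norm_pos_iff.2 hg0
    have hah : 0 < a * T.h := mul_pos hT.pos (T.h_pos i)
    refine le_of_mul_le_mul_right ?_ hgpos
    calc a * T.h * ‖g‖ * ‖g‖ = a * T.h * ‖g‖ ^ 2 := by ring
      _ ≤ a * T.h * (‖evalVec (gradP p) x‖ * ‖z‖) := by gcongr
      _ = ‖evalVec (gradP p) x‖ * (a * T.h * ‖z‖) := by ring
      _ ≤ _ := by gcongr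
  · have : gradient u (T.F i x) = 0 := by
      rw [gradient, fderiv_zero_of_not_differentiableAt hd, map_zero]
    simp [this]

lemma IsScaled.integral_gradient_sq_le (hT : T.IsScaled a) (i : Fin T.card) {u : Pt (n + 1) → ℝ}
    {p : MvPolynomial (Fin (n + 1)) ℝ}
    (hu : ∀ x ∈ refCell κ (n + 1), u (T.F i x) = evalPoly p x) :
    ∫ x in interior (T.cell i), ‖gradient u x‖ ^ 2 ≤
      (n + 1) ^ (n + 1) / a ^ 2 * (T.h ^ (n + 1) / T.h ^ 2) *
        ∫ x in refCell κ (n + 1), ‖evalVec (gradP p) x‖ ^ 2 := by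
  have hh := T.h_pos i
  have ha := hT.pos
  rw [T.setIntegral_interior_cell i, ← setIntegral_congr_set (openRefCell_ae_eq κ (n + 1)),
    ← setIntegral_congr_set (openRefCell_ae_eq κ (n + 1)), ← integral_const_mul]
  refine integral_mono_of_nonneg (Filter.Eventually.of_forall fun x => by positivity)
    ((integrableOn_refCell (by fun_prop)).mono_set (openRefCell_subset κ _))
    (ae_restrict_of_forall_mem (isOpen_openRefCell κ _).measurableSet fun x hx => ?_)
  have h1 := hT.norm_gradient_le i hu hx
  have h2 := hT.det_le i (openRefCell_subset κ _ hx)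
  have h3 : ‖gradient u (T.F i x)‖ ^ 2 ≤ ‖evalVec (gradP p) x‖ ^ 2 / (a * T.h) ^ 2 := by
    rw [le_div_iff₀ (by positivity), mul_comm, ← mul_pow]
    gcongr
  simp only [smul_eq_mul]
  calc _ ≤ ((n + 1) * T.h) ^ (n + 1) * (‖evalVec (gradP p) x‖ ^ 2 / (a * T.h) ^ 2) := by gcongr
    _ = _ := by rw [mul_pow, mul_pow]; field_simp

lemma IsScaled.integral_piola_sq_le (hT : T.IsScaled a) (i : Fin T.card)
    {v : Pt (n + 1) → Pt (n + 1)} {w : Fin (n + 1) → MvPolynomial (Fin (n + 1)) ℝ}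
    (hv : ∀ x ∈ refCell κ (n + 1), v (T.F i x) =
      |(fderiv ℝ (T.F i) x).det|⁻¹ • fderiv ℝ (T.F i) x (evalVec w x)) :
    ∫ x in interior (T.cell i), ‖v x‖ ^ 2 ≤
      (n + 1) ^ 2 / a ^ (n + 1) * (T.h ^ 2 / T.h ^ (n + 1)) *
        ∫ x in refCell κ (n + 1), ‖evalVec w x‖ ^ 2 := by
  have hh := T.h_pos i
  have ha := hT.pos
  rw [T.setIntegral_interior_cell i, ← integral_const_mul]
  refine integral_mono_of_nonneg (Filter.Eventually.of_forall fun x => by positivity)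
    (integrableOn_refCell (by fun_prop))
    (ae_restrict_of_forall_mem (measurableSet_refCell κ _) fun x hx => ?_)
  have h1 := hT.norm_le i x hx (evalVec w x)
  have h2 := hT.le_det i hx
  have h3 : 0 < |(fderiv ℝ (T.F i) x).det| := abs_pos.2 (T.F_det i x hx)
  simp only [smul_eq_mul, hv x hx, norm_smul, norm_inv, Real.norm_eq_abs, abs_abs]
  set D := |(fderiv ℝ (T.F i) x).det|
  calc D * (D⁻¹ * ‖fderiv ℝ (T.F i) x (evalVec w x)‖) ^ 2
      = D⁻¹ * ‖fderiv ℝ (T.F i) x (evalVec w x)‖ ^ 2 := by field_simp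
    _ ≤ ((a * T.h) ^ (n + 1))⁻¹ * ((n + 1) * T.h * ‖evalVec w x‖) ^ 2 := by gcongr
    _ = _ := by rw [mul_pow, mul_pow, mul_pow]; field_simp

lemma IsScaled.integral_facet_sq_le (hT : T.IsScaled a) (i : Fin T.card)
    (f : Fin (n + 1) × Bool) {g : Pt (n + 1) → ℝ} {p : MvPolynomial (Fin n) ℝ}
    (hg : ∀ y ∈ refCell κ n, g (T.F i (facetMap κ f y)) = evalPoly p y) :
    ∫ x in (fun y => T.F i (facetMap κ f y)) '' refCell κ n, g x ^ 2 ∂μHE[n] ≤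
      (n + 1) ^ (2 * n) * T.h ^ n * ∫ y in refCell κ n, evalPoly p y ^ 2 := by
  have hh := T.h_pos i
  have hL : (0 : ℝ) ≤ (n + 1) ^ 2 * T.h := by positivity
  have hlip : LipschitzOnWith (((n : ℝ) + 1) ^ 2 * T.h).toNNReal
      (fun y => T.F i (facetMap κ f y)) (refCell κ n) := by
    refine LipschitzOnWith.of_dist_le_mul fun y hy z hz => ?_
    rw [Real.coe_toNNReal _ hL, dist_eq_norm, dist_eq_norm]
    have h1 : ‖T.F i (facetMap κ f y) - T.F i (facetMap κ f z)‖ ≤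
        (n + 1) * T.h * ‖facetMap κ f y - facetMap κ f z‖ :=
      (convex_refCell κ (n + 1)).norm_image_sub_le_of_norm_fderiv_le
        (fun x _ => T.differentiable_F i x)
        (fun x hx => ContinuousLinearMap.opNorm_le_bound _ (by positivity) (hT.norm_le i x hx))
        (facetMap_mem f hz) (facetMap_mem f hy)
    refine h1.trans ?_
    calc _ ≤ (n + 1) * T.h * ((n + 1) * ‖y - z‖) := by
          gcongr; exact norm_facetMap_sub_le κ f y z
      _ = _ := by ring
  refine (setIntegral_image_sq_le (measurableSet_refCell κ n)
    ((T.continuous_F i).comp (continuous_facetMap κ f)) hL hlip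
    (integrableOn_refCell (by fun_prop)) hg).trans (le_of_eq ?_)
  rw [mul_pow, ← pow_mul]

end Mesh

/-! ### Uniqueness of the weak divergence -/

section WeakDiv

variable {d : ℕ} {U : Set (Pt d)} {v : Pt d → Pt d} {g g' : Pt d → ℝ}

lemma IsWeakDiv.ae_eq (hU : IsOpen U) (h : IsWeakDiv U v g) (h' : IsWeakDiv U v g') :
    g =ᵐ[volume.restrict U] g' := by
  have hsub : MemLp (g - g') 2 (volume.restrict U) := h.1.sub h'.1
  have hloc : LocallyIntegrableOn (g - g') U :=
    locallyIntegrableOn_of_locallyIntegrable_restrict (hsub.locallyIntegrable (by norm_num))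
  have h0 := hU.ae_eq_zero_of_integral_contDiff_smul_eq_zero hloc fun φ hφ hφc hφU => by
    have hφ2 : MemLp φ 2 (volume.restrict U) :=
      (hφ.continuous.memLp_of_hasCompactSupport hφc)
    have e1 := h.2 φ hφ hφc hφU
    have e2 := h'.2 φ hφ hφc hφU
    have e3 : ∫ x in U, φ x • (g - g') x = ∫ x, φ x • (g - g') x :=
      setIntegral_eq_integral_of_forall_compl_eq_zero fun x hx => by
        rw [image_eq_zero_of_notMem_tsupport fun hx' => hx (hφU hx'), zero_smul]
    rw [← e3]
    have e4 : ∀ x, φ x • (g - g') x = g x * φ x - g' x * φ x := fun x => by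
      simp; ring
    simp only [e4]
    have i1 : Integrable (fun x => g x * φ x) (volume.restrict U) := h.1.integrable_mul hφ2
    have i2 : Integrable (fun x => g' x * φ x) (volume.restrict U) := h'.1.integrable_mul hφ2
    rw [integral_sub i1 i2]
    linarith
  rw [Filter.EventuallyEq, ae_restrict_iff' hU.measurableSet]
  filter_upwards [h0] with x hx hxU
  exact sub_eq_zero.1 (hx hxU)

lemma IsWeakDiv.weakDiv_ae_eq (hU : IsOpen U) (h : IsWeakDiv U v g) :
    weakDiv U v =ᵐ[volume.restrict U] g := by
  have hex : ∃ g, IsWeakDiv U v g := ⟨g, h⟩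
  rw [weakDiv, dif_pos hex]
  exact hex.choose_spec.ae_eq hU h

lemma IsWeakDiv.zero_of_ae_eq_zero (hv : v =ᵐ[volume.restrict U] 0) : IsWeakDiv U v 0 := by
  refine ⟨MemLp.zero, fun φ _ _ _ => ?_⟩
  have : ∫ x in U, inner ℝ (v x) (gradient φ x) = ∫ x in U, (0 : ℝ) := by
    refine integral_congr_ae ?_
    filter_upwards [hv] with x hx
    rw [hx]; simp
  rw [this]; simp

end WeakDiv

lemma innerTrace_eq_of_eventually_zero {d : ℕ} {W : Type*} [NormedAddCommGroup W]
    [NormedSpace ℝ W] {Ω : Set (Pt d)} {u : Pt d → W} {x : Pt d} (h : ∀ᶠ y in 𝓝 x, u y = 0) :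
    innerTrace Ω u x = 0 := by
  have hlim : Filter.Tendsto (fun r : ℝ => ⨍ y in Metric.ball x r ∩ Ω, u y) (𝓝[>] 0) (𝓝 0) := by
    refine tendsto_const_nhds.congr' ?_
    obtain ⟨ε, hε, hball⟩ := Metric.eventually_nhds_iff_ball.1 h
    filter_upwards [Ioo_mem_nhdsGT hε] with r hr
    have : ∫ y in Metric.ball x r ∩ Ω, u y = 0 := by
      refine integral_eq_zero_of_ae ?_
      filter_upwards [ae_restrict_of_ae_restrict_of_subset Set.inter_subset_left
        (ae_restrict_mem (μ := volume) (Metric.isOpen_ball (x := x) (ε := r)).measurableSet)]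
        with y hy
      exact hball y (Metric.ball_subset_ball hr.2.le hy)
    rw [setAverage_eq, this, smul_zero]
  have hex : ∃ l, Filter.Tendsto (fun r : ℝ => ⨍ y in Metric.ball x r ∩ Ω, u y) (𝓝[>] 0) (𝓝 l) :=
    ⟨0, hlim⟩
  rw [innerTrace, dif_pos hex]
  exact tendsto_nhds_unique hex.choose_spec hlim

namespace Mesh

variable {κ : CellKind} {n : ℕ} (T : Mesh κ (n + 1))

/-! ### Piola transforms -/

/-- The contravariant Piola transform to the `i`-th element of a polynomial field on the reference
element. -/
noncomputable def piola (i : Fin T.card) (w : Fin (n + 1) → MvPolynomial (Fin (n + 1)) ℝ)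
    (y : Pt (n + 1)) : Pt (n + 1) :=
  |(fderiv ℝ (T.F i) (T.inv i y)).det|⁻¹ • fderiv ℝ (T.F i) (T.inv i y) (evalVec w (T.inv i y))

/-- The divergence of the Piola transform. -/
noncomputable def piolaDiv (i : Fin T.card) (w : Fin (n + 1) → MvPolynomial (Fin (n + 1)) ℝ)
    (y : Pt (n + 1)) : ℝ :=
  |(fderiv ℝ (T.F i) (T.inv i y)).det|⁻¹ * evalPoly (divP w) (T.inv i y)

lemma piola_F (i : Fin T.card) (w : Fin (n + 1) → MvPolynomial (Fin (n + 1)) ℝ) {x : Pt (n + 1)}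
    (hx : x ∈ refCell κ (n + 1)) : T.piola i w (T.F i x) =
      |(fderiv ℝ (T.F i) x).det|⁻¹ • fderiv ℝ (T.F i) x (evalVec w x) := by
  rw [piola, T.inv_F i hx]

lemma piolaDiv_F (i : Fin T.card) (w : Fin (n + 1) → MvPolynomial (Fin (n + 1)) ℝ)
    {x : Pt (n + 1)} (hx : x ∈ refCell κ (n + 1)) : T.piolaDiv i w (T.F i x) =
      |(fderiv ℝ (T.F i) x).det|⁻¹ * evalPoly (divP w) x := by
  rw [piolaDiv, T.inv_F i hx]

lemma piola_zero (i : Fin T.card) : T.piola i 0 = 0 := by ext1 y; simp [piola]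

lemma piola_smul (t : ℝ) (i : Fin T.card) (w : Fin (n + 1) → MvPolynomial (Fin (n + 1)) ℝ)
    (y : Pt (n + 1)) : T.piola i (t • w) y = t • T.piola i w y := by
  rw [piola, piola, evalVec_smul, map_smul, smul_comm]

lemma continuousOn_abs_det_inv (i : Fin T.card) :
    ContinuousOn (fun x => |(fderiv ℝ (T.F i) x).det|⁻¹) (refCell κ (n + 1)) :=
  (T.continuous_det_F i).abs.continuousOn.inv₀ fun x hx => abs_ne_zero.2 (T.F_det i x hx)

lemma continuousOn_piola (i : Fin T.card) (w : Fin (n + 1) → MvPolynomial (Fin (n + 1)) ℝ) :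
    ContinuousOn (T.piola i w) (T.cell i) := by
  have h : ContinuousOn (fun x => |(fderiv ℝ (T.F i) x).det|⁻¹ •
      fderiv ℝ (T.F i) x (evalVec w x)) (refCell κ (n + 1)) :=
    (T.continuousOn_abs_det_inv i).smul
      ((T.continuous_fderiv_F i).clm_apply (continuous_evalVec w)).continuousOn
  exact h.comp (T.continuousOn_inv i) fun y hy => T.inv_mem i hy

lemma continuousOn_piolaDiv (i : Fin T.card) (w : Fin (n + 1) → MvPolynomial (Fin (n + 1)) ℝ) :
    ContinuousOn (T.piolaDiv i w) (T.cell i) := by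
  have h : ContinuousOn (fun x => |(fderiv ℝ (T.F i) x).det|⁻¹ * evalPoly (divP w) x)
      (refCell κ (n + 1)) :=
    (T.continuousOn_abs_det_inv i).mul (continuous_evalPoly _).continuousOn
  exact h.comp (T.continuousOn_inv i) fun y hy => T.inv_mem i hy

/-- If the fluxes through the element boundaries cancel in total, the glued Piola transforms have
the glued elementwise divergences as weak divergence. -/
lemma isWeakDiv_glue_piola (w : Fin T.card → Fin (n + 1) → MvPolynomial (Fin (n + 1)) ℝ)
    (hflux : ∀ φ : Pt (n + 1) → ℝ, ContDiff ℝ 1 φ →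
      ∑ i, ∫ x in refCell κ (n + 1), (fderiv ℝ (φ ∘ T.F i) x (evalVec (w i) x) +
        evalPoly (divP (w i)) x * (φ ∘ T.F i) x) = 0) :
    IsWeakDiv T.domain (T.glue fun i => T.piola i (w i)) (T.glue fun i => T.piolaDiv i (w i)) := by
  refine ⟨(T.memLp_glue fun i => T.continuousOn_piolaDiv i (w i)).restrict _, fun φ hφ _ _ => ?_⟩
  have hφ1 : ContDiff ℝ 1 φ := hφ.of_le (by exact_mod_cast le_top)
  have hgrad : Continuous (gradient φ) :=
    (InnerProductSpace.toDual ℝ (Pt (n + 1))).symm.continuous.comp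
      (hφ1.continuous_fderiv (by simp))
  have e1 : ∀ x, inner ℝ (T.glue (fun i => T.piola i (w i)) x) (gradient φ x) =
      T.glue (fun i y => inner ℝ (T.piola i (w i) y) (gradient φ y)) x := fun x =>
    T.glue_map (fun y u => inner ℝ u (gradient φ y)) (fun y => inner_zero_left _) _ x
  have e2 : ∀ x, T.glue (fun i => T.piolaDiv i (w i)) x * φ x =
      T.glue (fun i y => T.piolaDiv i (w i) y * φ y) x := fun x =>
    T.glue_map (fun y u => u * φ y) (fun y => zero_mul _) _ x
  simp only [e1, e2]
  have c1 : ∀ i, ContinuousOn (fun y => inner ℝ (T.piola i (w i) y) (gradient φ y)) (T.cell i) :=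
    fun i => ContinuousOn.inner (T.continuousOn_piola i (w i)) hgrad.continuousOn
  have c2 : ∀ i, ContinuousOn (fun y => T.piolaDiv i (w i) y * φ y) (T.cell i) :=
    fun i => (T.continuousOn_piolaDiv i (w i)).mul hφ.continuous.continuousOn
  rw [T.setIntegral_glue c1, T.setIntegral_glue c2]
  have hdom : ∀ i, T.domain ∩ interior (T.cell i) = interior (T.cell i) := fun i =>
    Set.inter_eq_right.2 (T.interior_cell_subset_domain i)
  simp only [hdom]
  rw [eq_neg_iff_add_eq_zero, ← Finset.sum_add_distrib, ← hflux φ hφ1]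
  refine Finset.sum_congr rfl fun i _ => ?_
  have hcF : ContDiff ℝ 1 (φ ∘ T.F i) := hφ1.comp (T.contDiff_F i)
  have i1 : IntegrableOn (fun x => fderiv ℝ (φ ∘ T.F i) x (evalVec (w i) x))
      (refCell κ (n + 1)) :=
    integrableOn_refCell ((hcF.continuous_fderiv (by simp)).clm_apply (continuous_evalVec _))
  have i2 : IntegrableOn (fun x => evalPoly (divP (w i)) x * (φ ∘ T.F i) x)
      (refCell κ (n + 1)) :=
    integrableOn_refCell ((continuous_evalPoly _).mul hcF.continuous)
  rw [integral_add i1 i2,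
    T.setIntegral_interior_cell, T.setIntegral_interior_cell]
  congr 1
  · refine setIntegral_congr_fun (measurableSet_refCell κ _) fun x hx => ?_
    have h0 := abs_ne_zero.2 (T.F_det i x hx)
    simp only [T.piola_F i (w i) hx]
    rw [inner_gradient_eq_fderiv, map_smul, smul_smul, mul_inv_cancel₀ h0, one_smul,
      fderiv_comp x (hφ1.differentiable (by simp) _) (T.differentiable_F i x)]
    rfl
  · refine setIntegral_congr_fun (measurableSet_refCell κ _) fun x hx => ?_
    have h0 := abs_ne_zero.2 (T.F_det i x hx)
    simp only [T.piolaDiv_F i (w i) hx, smul_eq_mul, Function.comp_apply]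
    field_simp

/-! ### Facets shared by two elements -/

lemma ShareFacet.symm {T : Mesh κ (n + 1)} {i j : Fin T.card} (h : T.ShareFacet i j) :
    T.ShareFacet j i := by
  rw [ShareFacet, Set.inter_comm]
  exact ⟨h.2, h.1⟩

lemma ShareFacet.exists_facetMap {T : Mesh κ (n + 1)} {i j : Fin T.card} (h : T.ShareFacet i j) :
    ∃ f, T.cell i ∩ T.cell j = T.F i '' (facetMap κ f '' refCell κ n) := by
  obtain ⟨s, hs, h⟩ := h.1
  obtain ⟨f, rfl⟩ := exists_facetMap_image_eq hs
  exact ⟨f, h⟩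

/-- The two parametrizations of a shared facet differ by an affine bijection of the reference
element of one dimension less. -/
lemma exists_affine_facet_matching {i j : Fin T.card} (hij : i ≠ j) {f f' : Fin (n + 1) × Bool}
    (hf : T.cell i ∩ T.cell j = T.F i '' (facetMap κ f '' refCell κ n))
    (hf' : T.cell i ∩ T.cell j = T.F j '' (facetMap κ f' '' refCell κ n)) :
    ∃ B : Pt n →ᵃ[ℝ] Pt n, B '' refCell κ n = refCell κ n ∧
      ∀ y ∈ refCell κ n, T.F i (facetMap κ f y) = T.F j (facetMap κ f' (B y)) := by
  have hsub : ∀ f : Fin (n + 1) × Bool, facetMap κ f '' refCell κ n ⊆ refCell κ (n + 1) := by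
    rintro f _ ⟨y, hy, rfl⟩
    exact facetMap_mem f hy
  rcases T.admissible i j hij with h | ⟨s, hs, s', hs', A, hA, hFA, h⟩
  · exfalso
    have h1 : (T.cell i ∩ T.cell j).Nonempty := by
      rw [hf]; exact (Set.Nonempty.image _ ⟨0, zero_mem_refCell κ n⟩).image _
    exact h1.ne_empty h
  have e1 : s = facetMap κ f '' refCell κ n :=
    ((T.F_injOn i).image_eq_image_iff (refFace_null hs).1 (hsub f)).1 (h.symm.trans hf)
  have e2 : s' = facetMap κ f' '' refCell κ n := by
    refine ((T.F_injOn j).image_eq_image_iff (refFace_null hs').1 (hsub f')).1 ?_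
    rw [← hf', cell, cell, h, ← hA, Set.image_image]
    exact Set.image_congr fun x hx => (hFA x hx).symm
  let B : Pt n →ᵃ[ℝ] Pt n := (delLinear f'.1).toAffineMap.comp (A.comp (facetAffine κ f))
  have hB : ∀ y, B y = del f'.1 (A (facetMap κ f y)) := fun y => rfl
  have hAB : ∀ y ∈ refCell κ n, B y ∈ refCell κ n ∧ facetMap κ f' (B y) = A (facetMap κ f y) := by
    intro y hy
    have h1 : A (facetMap κ f y) ∈ s' := by
      rw [← hA, e1]
      exact Set.mem_image_of_mem _ (Set.mem_image_of_mem _ hy)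
    rw [e2] at h1
    obtain ⟨z, hz, hz'⟩ := h1
    rw [hB, ← hz', del_facetMap]
    exact ⟨hz, rfl⟩
  refine ⟨B, ?_, fun y hy => ?_⟩
  · refine Set.Subset.antisymm (by rintro _ ⟨y, hy, rfl⟩; exact (hAB y hy).1) fun z hz => ?_
    have h1 : facetMap κ f' z ∈ s' := by rw [e2]; exact Set.mem_image_of_mem _ hz
    rw [← hA, e1] at h1
    obtain ⟨_, ⟨y, hy, rfl⟩, hy'⟩ := h1
    exact ⟨y, hy, by rw [hB, hy', del_facetMap]⟩
  · rw [(hAB y hy).2]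
    exact hFA _ (e1 ▸ Set.mem_image_of_mem _ hy)

end Mesh

namespace Mesh

variable {κ : CellKind} {n : ℕ} (T : Mesh κ (n + 1)) {Ω ΓN : Set (Pt (n + 1))}

/-! ### Interior elements and the boundary terms -/

/-- The interior of a cut element is disjoint from the inner part of `Ω`, so that an element
contained in the closure of the inner part is not cut. -/
lemma IsInner.hausdorff_eq_zero {T : Mesh κ (n + 1)} {i : Fin T.card} (hi : T.IsInner Ω i) :
    μHE[n] (frontier Ω ∩ T.cell i) = 0 := by
  by_contra hcut
  have hcut' : T.IsCut (frontier Ω) i := hcut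
  have hne : (interior (T.cell i)).Nonempty := by
    obtain ⟨x, hx⟩ := openRefCell_nonempty κ (n + 1)
    exact ⟨_, T.F_mem_interior_cell i hx⟩
  obtain ⟨x, hx⟩ := hne
  have h1 : x ∈ closure (T.innerPart Ω) := hi (interior_subset hx)
  obtain ⟨y, hy, hy'⟩ := mem_closure_iff.1 h1 _ isOpen_interior hx
  exact hy'.2 (Set.mem_biUnion hcut' (interior_subset hy))

/-- An interior element lies in `Ω` up to a null set. It may still touch the boundary, but only in a
set of vanishing `n`-dimensional Hausdorff measure. -/
lemma IsInner.interior_inter_ae_eq {T : Mesh κ (n + 1)} {i : Fin T.card} (hΩ : IsOpen Ω)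
    (hi : T.IsInner Ω i) :
    (Ω ∩ interior (T.cell i) : Set (Pt (n + 1))) =ᵐ[volume] interior (T.cell i) := by
  have h0 : volume (frontier Ω ∩ T.cell i) = 0 := by
    rw [← EuclideanSpace.euclideanHausdorffMeasure_eq_volume]
    refine (Measure.euclideanHausdorffMeasure_zero_or_top (Nat.lt_succ_self n) _).resolve_right ?_
    rw [hi.hausdorff_eq_zero]; simp
  refine Filter.EventuallyLE.antisymm (Set.inter_subset_right).eventuallyLE (ae_le_set.2 ?_)
  refine measure_mono_null ?_ h0
  rintro x ⟨hx, hx'⟩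
  refine ⟨?_, interior_subset hx⟩
  rw [hΩ.frontier_eq]
  exact ⟨closure_mono Set.sdiff_subset (hi (interior_subset hx)), fun h => hx' ⟨h, hx⟩⟩

/-- A velocity supported on the interior elements has no trace on the boundary. -/
lemma ae_innerTrace_eq_zero {v : Fin T.card → Pt (n + 1) → Pt (n + 1)}
    (hv : ∀ i, ¬ T.IsInner Ω i → ∀ x ∈ T.cell i, v i x = 0) :
    ∀ᵐ x ∂(μHE[n] : Measure (Pt (n + 1))), x ∈ frontier Ω →
      innerTrace Ω (T.glue v) x = 0 := by
  have h0 : μHE[n] (⋃ i ∈ {i | T.IsInner Ω i}, frontier Ω ∩ T.cell i) = 0 :=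
    (measure_biUnion_null_iff (Set.to_countable _)).2 fun i hi => IsInner.hausdorff_eq_zero hi
  refine measure_mono_null ?_ h0
  intro x hx
  simp only [Set.mem_compl_iff, Set.mem_ofPred_eq, Classical.not_imp] at hx
  by_contra hx'
  refine hx.2 (innerTrace_eq_of_eventually_zero ?_)
  have hcl : IsClosed (⋃ i ∈ {i | T.IsInner Ω i}, T.cell i) :=
    Set.Finite.isClosed_biUnion (Set.toFinite _) fun i _ => (T.isCompact_cell i).isClosed
  have hxU : x ∈ (⋃ i ∈ {i | T.IsInner Ω i}, T.cell i)ᶜ := by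
    intro h
    obtain ⟨i, hi, hxi⟩ := Set.mem_iUnion₂.1 h
    exact hx' (Set.mem_iUnion₂.2 ⟨i, hi, hx.1, hxi⟩)
  filter_upwards [hcl.isOpen_compl.mem_nhds hxU] with y hy
  refine Finset.sum_eq_zero fun i _ => ?_
  by_cases hyi : y ∈ interior (T.cell i)
  · rw [Set.indicator_of_mem hyi]
    refine hv i (fun hi => hy ?_) y (interior_subset hyi)
    exact Set.mem_iUnion₂.2 ⟨i, hi, interior_subset hyi⟩
  · exact Set.indicator_of_notMem hyi _

lemma b₁_eq_of_interior (hΓ : ∃ U, IsOpen U ∧ ΓN = U ∩ frontier Ω)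
    {v : Fin T.card → Pt (n + 1) → Pt (n + 1)} (q : Fin T.card → Pt (n + 1) → ℝ)
    (hv : ∀ i, ¬ T.IsInner Ω i → ∀ x ∈ T.cell i, v i x = 0) :
    T.b₁ Ω ΓN v q = ∫ x in Ω, T.glue q x * weakDiv T.domain (T.glue v) x := by
  obtain ⟨U, hU, rfl⟩ := hΓ
  have : ∫ x in U ∩ frontier Ω, innerTrace Ω (T.glue q) x *
      inner ℝ (innerTrace Ω (T.glue v) x) (outerNormal Ω x) ∂μHE[n] = 0 := by
    refine integral_eq_zero_of_ae ?_
    rw [Filter.EventuallyEq,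
      ae_restrict_iff' (hU.measurableSet.inter isClosed_frontier.measurableSet)]
    filter_upwards [T.ae_innerTrace_eq_zero hv] with x hx hxU
    rw [hx hxU.2]; simp
  rw [b₁]
  exact (sub_eq_self).2 this

lemma velocityNorm_eq_of_interior (hΓ : ∃ U, IsOpen U ∧ ΓN = U ∩ frontier Ω)
    {v : Fin T.card → Pt (n + 1) → Pt (n + 1)}
    (hv : ∀ i, ¬ T.IsInner Ω i → ∀ x ∈ T.cell i, v i x = 0) :
    T.velocityNorm Ω ΓN v = √(∫ x in T.domain, ‖T.glue v x‖ ^ 2) := by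
  obtain ⟨U, hU, rfl⟩ := hΓ
  rw [velocityNorm]
  congr 1
  refine add_eq_left.2 (Finset.sum_eq_zero fun i _ => ?_)
  have : ∫ x in U ∩ frontier Ω ∩ T.cell i,
      (inner ℝ (innerTrace Ω (T.glue v) x) (outerNormal Ω x)) ^ 2 ∂μHE[n] = 0 := by
    refine integral_eq_zero_of_ae ?_
    rw [Filter.EventuallyEq, ae_restrict_iff' ((hU.measurableSet.inter
      isClosed_frontier.measurableSet).inter (T.measurableSet_cell i))]
    filter_upwards [T.ae_innerTrace_eq_zero hv] with x hx hxU
    rw [hx hxU.1.2]; simp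
  split_ifs
  · exact mul_eq_zero_of_right _ this
  · rfl

/-- A velocity of norm zero pairs to zero, so that the convention `x / 0 = 0` is harmless in the
supremum. -/
lemma b₁_eq_zero_of_velocityNorm_eq_zero (hΓ : ∃ U, IsOpen U ∧ ΓN = U ∩ frontier Ω)
    (hΩ : Ω ⊆ T.domain) {v : Fin T.card → Pt (n + 1) → Pt (n + 1)}
    (q : Fin T.card → Pt (n + 1) → ℝ)
    (hv : ∀ i, ¬ T.IsInner Ω i → ∀ x ∈ T.cell i, v i x = 0)
    (hL2 : MemLp (T.glue v) 2 (volume.restrict T.domain))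
    (h : T.velocityNorm Ω ΓN v = 0) : T.b₁ Ω ΓN v q = 0 := by
  rw [T.velocityNorm_eq_of_interior hΓ hv,
    Real.sqrt_eq_zero (integral_nonneg fun x => by positivity)] at h
  rw [integral_eq_zero_iff_of_nonneg (fun x => by positivity)
    ((memLp_two_iff_integrable_sq_norm hL2.1).1 hL2)] at h
  have hz : T.glue v =ᵐ[volume.restrict T.domain] 0 := by
    filter_upwards [h] with x hx
    simpa using hx
  have hwd : weakDiv T.domain (T.glue v) =ᵐ[volume.restrict T.domain] 0 :=
    (IsWeakDiv.zero_of_ae_eq_zero hz).weakDiv_ae_eq isOpen_interior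
  rw [T.b₁_eq_of_interior hΓ q hv]
  refine integral_eq_zero_of_ae ?_
  filter_upwards [ae_restrict_of_ae_restrict_of_subset hΩ hwd] with x hx
  rw [hx]; simp

/-! ### The form and the norms of a Piola transformed field -/

section Piola

variable {w : Fin T.card → Fin (n + 1) → MvPolynomial (Fin (n + 1)) ℝ}

lemma piola_eq_zero_of_not_inner (hw : ∀ i, ¬ T.IsInner Ω i → w i = 0) (i : Fin T.card)
    (hi : ¬ T.IsInner Ω i) (x : Pt (n + 1)) : T.piola i (w i) x = 0 := by
  rw [hw i hi, piola_zero]; rfl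

/-- The Piola transform preserves the pairing of a divergence with a pressure, so that the form is a
sum of integrals over the reference element. -/
lemma b₁_piola {k : ℕ} (hΓ : ∃ U, IsOpen U ∧ ΓN = U ∩ frontier Ω) (hΩo : IsOpen Ω)
    (hΩ : Ω ⊆ T.domain) {q : Fin T.card → Pt (n + 1) → ℝ} (hq : q ∈ T.pressureSpace k)
    (hw : ∀ i, ¬ T.IsInner Ω i → w i = 0)
    (hdiv : IsWeakDiv T.domain (T.glue fun i => T.piola i (w i))
      (T.glue fun i => T.piolaDiv i (w i))) :
    T.b₁ Ω ΓN (fun i => T.piola i (w i)) q =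
      ∑ i, ∫ x in refCell κ (n + 1), evalPoly (divP (w i)) x * q i (T.F i x) := by
  have hqc : ∀ i, ContinuousOn (q i) (T.cell i) := by
    intro i
    obtain ⟨p, -, hp⟩ := hq i
    refine (((continuous_evalPoly p).continuousOn (s := Set.univ)).comp (T.continuousOn_inv i)
      (fun _ _ => Set.mem_univ _)).congr ?_
    rintro _ ⟨x, hx, rfl⟩
    rw [hp x hx, Function.comp_apply, T.inv_F i hx]
  rw [T.b₁_eq_of_interior hΓ q fun i hi x _ => T.piola_eq_zero_of_not_inner hw i hi x]
  have h1 : ∫ x in Ω, T.glue q x * weakDiv T.domain (T.glue fun i => T.piola i (w i)) x =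
      ∫ x in Ω, T.glue (fun i y => q i y * T.piolaDiv i (w i) y) x := by
    refine integral_congr_ae ?_
    filter_upwards [ae_restrict_of_ae_restrict_of_subset hΩ (hdiv.weakDiv_ae_eq isOpen_interior)]
      with x hx
    rw [hx, T.glue_mul]
  have h2 : ∀ i, ContinuousOn (fun y => q i y * T.piolaDiv i (w i) y) (T.cell i) := fun i =>
    (hqc i).mul (T.continuousOn_piolaDiv i (w i))
  rw [h1, T.setIntegral_glue h2]
  refine Finset.sum_congr rfl fun i _ => ?_
  by_cases hi : T.IsInner Ω i
  · rw [setIntegral_congr_set (hi.interior_inter_ae_eq hΩo), T.setIntegral_interior_cell]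
    refine setIntegral_congr_fun (measurableSet_refCell κ _) fun x hx => ?_
    have h0 := abs_ne_zero.2 (T.F_det i x hx)
    simp only [T.piolaDiv_F i (w i) hx, smul_eq_mul]
    field_simp
  · have h3 : divP (0 : Fin (n + 1) → MvPolynomial (Fin (n + 1)) ℝ) = 0 := by simp [divP]
    simp [hw i hi, piolaDiv, h3]

lemma integral_norm_glue_sq :
    ∫ x in T.domain, ‖T.glue (fun i => T.piola i (w i)) x‖ ^ 2 =
      ∑ i, ∫ x in interior (T.cell i), ‖T.piola i (w i) x‖ ^ 2 := by
  have e1 : ∀ x, ‖T.glue (fun i => T.piola i (w i)) x‖ ^ 2 =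
      T.glue (fun i y => ‖T.piola i (w i) y‖ ^ 2) x := fun x =>
    T.glue_map (fun _ u => ‖u‖ ^ 2) (fun y => by simp) _ x
  have c1 : ∀ i, ContinuousOn (fun y => ‖T.piola i (w i) y‖ ^ 2) (T.cell i) := fun i =>
    (T.continuousOn_piola i (w i)).norm.pow 2
  simp only [e1]
  rw [T.setIntegral_glue c1]
  refine Finset.sum_congr rfl fun i _ => ?_
  rw [Set.inter_eq_right.2 (T.interior_cell_subset_domain i)]

lemma piola_mem_velocitySpace {k : ℕ} (hw : ∀ i, w i ∈ rtPoly κ (n + 1) k)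
    (hdiv : IsWeakDiv T.domain (T.glue fun i => T.piola i (w i))
      (T.glue fun i => T.piolaDiv i (w i))) :
    (fun i => T.piola i (w i)) ∈ T.velocitySpace k :=
  ⟨fun i => ⟨w i, hw i, fun _ hx => T.piola_F i (w i) hx⟩,
    (T.memLp_glue fun i => T.continuousOn_piola i (w i)).restrict _, _, hdiv⟩

end Piola

/-! ### Jumps across the interior facets -/

/-- The polynomial data of a discrete pressure `q` on the interior elements: `r i` represents `q` on
the `i`-th element (and is zero if that element is not interior), `N i` is the set of its interior
neighbours, and `p i j` represents the jump of `q` on the facet shared with the neighbour `j`, in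
the parametrization `f i j` from the side of the `i`-th element. -/
structure JumpData (Ω : Set (Pt (n + 1))) (k : ℕ) (q : Fin T.card → Pt (n + 1) → ℝ) where
  /-- the pressure on the reference element -/
  r : Fin T.card → MvPolynomial (Fin (n + 1)) ℝ
  /-- the interior neighbours -/
  N : Fin T.card → Finset (Fin T.card)
  /-- the shared facets -/
  f : Fin T.card → Fin T.card → Fin (n + 1) × Bool
  /-- the jumps -/
  p : Fin T.card → Fin T.card → MvPolynomial (Fin n) ℝ
  r_mem : ∀ i, r i ∈ scalarPoly κ (n + 1) k
  r_eval : ∀ i, T.IsInner Ω i → ∀ x ∈ refCell κ (n + 1), q i (T.F i x) = evalPoly (r i) x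
  r_zero : ∀ i, ¬ T.IsInner Ω i → r i = 0
  mem_N : ∀ i j, j ∈ N i ↔ i ≠ j ∧ T.IsInner Ω i ∧ T.IsInner Ω j ∧ T.ShareFacet i j
  image_eq : ∀ i, ∀ j ∈ N i, T.cell i ∩ T.cell j = T.F i '' (facetMap κ (f i j) '' refCell κ n)
  p_mem : ∀ i, ∀ j ∈ N i, p i j ∈ scalarPoly κ n k
  p_eval : ∀ i, ∀ j ∈ N i, ∀ y ∈ refCell κ n, evalPoly (p i j) y =
    q i (T.F i (facetMap κ (f i j) y)) - q j (T.F i (facetMap κ (f i j) y))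

open Classical in
lemma nonempty_jumpData {k : ℕ} {q : Fin T.card → Pt (n + 1) → ℝ} (hq : q ∈ T.pressureSpace k) :
    Nonempty (T.JumpData Ω k q) := by
  choose P hP hPq using hq
  let N : Fin T.card → Finset (Fin T.card) := fun i => Finset.univ.filter fun j =>
    i ≠ j ∧ T.IsInner Ω i ∧ T.IsInner Ω j ∧ T.ShareFacet i j
  have hN : ∀ i j, j ∈ N i ↔ i ≠ j ∧ T.IsInner Ω i ∧ T.IsInner Ω j ∧ T.ShareFacet i j :=
    fun i j => by simp [N]
  have hf : ∀ i j, ∃ f, j ∈ N i →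
      T.cell i ∩ T.cell j = T.F i '' (facetMap κ f '' refCell κ n) := by
    intro i j
    by_cases h : j ∈ N i
    · obtain ⟨f, hf⟩ := ((hN i j).1 h).2.2.2.exists_facetMap
      exact ⟨f, fun _ => hf⟩
    · exact ⟨(0, false), fun h' => absurd h' h⟩
  choose f hf using hf
  have hNs : ∀ i j, j ∈ N i → i ∈ N j := by
    intro i j h
    obtain ⟨h1, h2, h3, h4⟩ := (hN i j).1 h
    exact (hN j i).2 ⟨h1.symm, h3, h2, h4.symm⟩
  have hp : ∀ i j, ∃ p : MvPolynomial (Fin n) ℝ, j ∈ N i → p ∈ scalarPoly κ n k ∧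
      ∀ y ∈ refCell κ n, evalPoly p y =
        q i (T.F i (facetMap κ (f i j) y)) - q j (T.F i (facetMap κ (f i j) y)) := by
    intro i j
    by_cases h : j ∈ N i
    · obtain ⟨B, hB, hFB⟩ := T.exists_affine_facet_matching ((hN i j).1 h).1 (hf i j h)
        (by rw [Set.inter_comm]; exact hf j i (hNs i j h))
      obtain ⟨r₁, hr₁, e₁⟩ := exists_scalarPoly_comp_facetMap (f i j) (hP i)
      obtain ⟨r₂, hr₂, e₂⟩ := exists_scalarPoly_comp_facetMap (f j i) (hP j)
      obtain ⟨r₃, hr₃, e₃⟩ := exists_scalarPoly_comp_affine B hB hr₂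
      refine ⟨r₁ - r₃, fun _ => ⟨sub_mem_scalarPoly hr₁ hr₃, fun y hy => ?_⟩⟩
      have hBy : B y ∈ refCell κ n := by rw [← hB]; exact Set.mem_image_of_mem _ hy
      rw [evalPoly_sub, e₁, e₃, e₂, ← hPq i _ (facetMap_mem _ hy),
        ← hPq j _ (facetMap_mem _ hBy), hFB y hy]
    · exact ⟨0, fun h' => absurd h' h⟩
  choose p hp using hp
  refine ⟨⟨fun i => if T.IsInner Ω i then P i else 0, N, f, p, fun i => ?_, fun i hi x hx => ?_,
    fun i hi => if_neg hi, hN, fun i j h => hf i j h, fun i j h => (hp i j h).1,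
    fun i j h => (hp i j h).2⟩⟩
  · split_ifs
    · exact hP i
    · simpa using sub_mem_scalarPoly (hP i) (hP i)
  · rw [if_pos hi]; exact hPq i x hx

namespace JumpData

variable {T} {k : ℕ} {q : Fin T.card → Pt (n + 1) → ℝ} (J : T.JumpData Ω k q)

lemma mem_N_symm {i j : Fin T.card} (h : j ∈ J.N i) : i ∈ J.N j := by
  obtain ⟨h1, h2, h3, h4⟩ := (J.mem_N i j).1 h
  exact (J.mem_N j i).2 ⟨h1.symm, h3, h2, h4.symm⟩

/-- The normal flux through a shared facet leaves one element and enters the other. -/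
lemma flux_antisymm {i j : Fin T.card} (h : j ∈ J.N i) (g : Pt (n + 1) → ℝ) :
    ∫ y in refCell κ n, evalPoly (J.p j i) y * g (T.F j (facetMap κ (J.f j i) y)) =
      -∫ y in refCell κ n, evalPoly (J.p i j) y * g (T.F i (facetMap κ (J.f i j) y)) := by
  have h' := J.mem_N_symm h
  obtain ⟨B, hB, hFB⟩ := T.exists_affine_facet_matching ((J.mem_N i j).1 h).1 (J.image_eq i j h)
    (by rw [Set.inter_comm]; exact J.image_eq j i h')
  rw [← setIntegral_comp_affine B hB, ← integral_neg]
  refine setIntegral_congr_fun (measurableSet_refCell κ n) fun y hy => ?_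
  have hBy : B y ∈ refCell κ n := by rw [← hB]; exact Set.mem_image_of_mem _ hy
  beta_reduce
  rw [J.p_eval j i h' _ hBy, J.p_eval i j h y hy, ← hFB y hy]
  ring

/-- A symmetrization of sums over ordered pairs of neighbours. -/
lemma sum_add_swap (c : Fin T.card → Fin T.card → ℝ) :
    ∑ i, ∑ j ∈ J.N i, (c i j + c j i) = 2 * ∑ i, ∑ j ∈ J.N i, c i j := by
  have h : ∑ i, ∑ j ∈ J.N i, c j i = ∑ i, ∑ j ∈ J.N i, c i j :=
    Finset.sum_comm' fun i j => by
      simp only [Finset.mem_univ, true_and, and_true]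
      exact ⟨J.mem_N_symm, J.mem_N_symm⟩
  simp only [Finset.sum_add_distrib, h]
  ring

lemma sum_flux_eq_zero (g : Pt (n + 1) → ℝ) :
    ∑ i, ∑ j ∈ J.N i, ∫ y in refCell κ n,
      evalPoly (J.p i j) y * g (T.F i (facetMap κ (J.f i j) y)) = 0 := by
  have h := J.sum_add_swap fun i j => ∫ y in refCell κ n,
    evalPoly (J.p i j) y * g (T.F i (facetMap κ (J.f i j) y))
  have h0 : ∑ i, ∑ j ∈ J.N i, ((∫ y in refCell κ n,
      evalPoly (J.p i j) y * g (T.F i (facetMap κ (J.f i j) y))) + ∫ y in refCell κ n,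
      evalPoly (J.p j i) y * g (T.F j (facetMap κ (J.f j i) y))) = 0 :=
    Finset.sum_eq_zero fun i _ => Finset.sum_eq_zero fun j hj => by
      rw [J.flux_antisymm hj]; ring
  linarith

/-- Both sides of a facet together contribute the square of the jump, and every facet is counted
twice. -/
lemma sum_flux_pressure :
    ∑ i, ∑ j ∈ J.N i, ∫ y in refCell κ n,
      evalPoly (J.p i j) y * evalPoly (J.r i) (facetMap κ (J.f i j) y) =
    1 / 2 * ∑ i, ∑ j ∈ J.N i, ∫ y in refCell κ n, evalPoly (J.p i j) y ^ 2 := by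
  have h := J.sum_add_swap fun i j => ∫ y in refCell κ n,
    evalPoly (J.p i j) y * evalPoly (J.r i) (facetMap κ (J.f i j) y)
  have h1 : ∀ i, ∀ j ∈ J.N i, (∫ y in refCell κ n,
      evalPoly (J.p i j) y * evalPoly (J.r i) (facetMap κ (J.f i j) y)) + (∫ y in refCell κ n,
      evalPoly (J.p j i) y * evalPoly (J.r j) (facetMap κ (J.f j i) y)) =
      ∫ y in refCell κ n, evalPoly (J.p i j) y ^ 2 := by
    intro i j hj
    obtain ⟨-, hi, hj', -⟩ := (J.mem_N i j).1 hj
    have e1 : ∫ y in refCell κ n, evalPoly (J.p j i) y * evalPoly (J.r j) (facetMap κ (J.f j i) y) =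
        ∫ y in refCell κ n, evalPoly (J.p j i) y * q j (T.F j (facetMap κ (J.f j i) y)) :=
      setIntegral_congr_fun (measurableSet_refCell κ n) fun y hy => by
        rw [J.r_eval j hj' _ (facetMap_mem _ hy)]
    have e2 : ∫ y in refCell κ n, evalPoly (J.p i j) y * q j (T.F i (facetMap κ (J.f i j) y)) =
        ∫ y in refCell κ n, (evalPoly (J.p i j) y * evalPoly (J.r i) (facetMap κ (J.f i j) y) -
          evalPoly (J.p i j) y ^ 2) :=
      setIntegral_congr_fun (measurableSet_refCell κ n) fun y hy => by
        have h2 := J.p_eval i j hj y hy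
        rw [J.r_eval i hi _ (facetMap_mem _ hy)] at h2
        rw [show q j (T.F i (facetMap κ (J.f i j) y)) =
          evalPoly (J.r i) (facetMap κ (J.f i j) y) - evalPoly (J.p i j) y by linarith]
        ring
    have i1 : IntegrableOn (fun y => evalPoly (J.p i j) y *
        evalPoly (J.r i) (facetMap κ (J.f i j) y)) (refCell κ n) :=
      integrableOn_refCell ((continuous_evalPoly _).mul
        ((continuous_evalPoly _).comp (continuous_facetMap _ _)))
    have i2 : IntegrableOn (fun y => evalPoly (J.p i j) y ^ 2) (refCell κ n) :=
      integrableOn_refCell ((continuous_evalPoly _).pow 2)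
    rw [e1, J.flux_antisymm hj, e2, integral_sub i1 i2]
    ring
  rw [Finset.sum_congr rfl fun i _ => Finset.sum_congr rfl fun j hj => h1 i j hj] at h
  linarith

/-- The local velocities built from the gradients and the jumps of the pressure. -/
noncomputable def field (M : ℝ) (i : Fin T.card) : Fin (n + 1) → MvPolynomial (Fin (n + 1)) ℝ :=
  localField κ M (J.r i) (J.N i) (J.f i) (J.p i)

lemma field_mem (M : ℝ) (i : Fin T.card) : J.field M i ∈ rtPoly κ (n + 1) k :=
  localField_mem_rtPoly M (J.r_mem i) (J.p_mem i)

lemma field_eq_zero (M : ℝ) (i : Fin T.card) (hi : ¬ T.IsInner Ω i) : J.field M i = 0 := by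
  have h1 : J.N i = ∅ := by
    refine Finset.eq_empty_of_forall_notMem fun j hj => hi ((J.mem_N i j).1 hj).2.1
  have h2 : bubbleField κ (0 : MvPolynomial (Fin (n + 1)) ℝ) = 0 := by
    ext1 j; cases κ <;> simp [bubbleField]
  simp [field, localField, J.r_zero i hi, h1, h2]

/-- The normal components of neighbouring local velocities match, up to an arbitrary common
factor. -/
lemma field_flux (M t : ℝ) (φ : Pt (n + 1) → ℝ) (hφ : ContDiff ℝ 1 φ) :
    ∑ i, ∫ x in refCell κ (n + 1), (fderiv ℝ (φ ∘ T.F i) x (evalVec (t • J.field M i) x) +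
        evalPoly (divP (t • J.field M i)) x * (φ ∘ T.F i) x) = 0 := by
  have h1 : ∀ i, ∫ x in refCell κ (n + 1), (fderiv ℝ (φ ∘ T.F i) x (evalVec (t • J.field M i) x) +
        evalPoly (divP (t • J.field M i)) x * (φ ∘ T.F i) x) =
      t * ∑ j ∈ J.N i, ∫ y in refCell κ n,
        evalPoly (J.p i j) y * φ (T.F i (facetMap κ (J.f i j) y)) := by
    intro i
    have h2 := integral_flux_localField (κ := κ) M (J.r i) (J.N i) (J.f i) (J.p i)
      (hφ.comp (T.contDiff_F i))
    simp only [Function.comp_apply] at h2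
    rw [← h2, ← integral_const_mul]
    congr 1; ext x
    simp only [evalVec_smul, map_smul, divP_smul, evalPoly_smul, smul_eq_mul, field,
      Function.comp_apply]
    simp only [Function.comp_def]
    ring
  rw [Finset.sum_congr rfl fun i _ => h1 i, ← Finset.mul_sum, J.sum_flux_eq_zero, mul_zero]

/-- The energy of the pressure on the reference elements. -/
noncomputable def energy : ℝ :=
  ∑ i, ((∫ x in refCell κ (n + 1), ‖evalVec (gradP (J.r i)) x‖ ^ 2) +
    ∑ j ∈ J.N i, ∫ y in refCell κ n, evalPoly (J.p i j) y ^ 2)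

lemma energy_nonneg : 0 ≤ J.energy :=
  Finset.sum_nonneg fun _ _ => add_nonneg (integral_nonneg fun _ => by positivity)
    (Finset.sum_nonneg fun _ _ => integral_nonneg fun _ => by positivity)

open Classical in
/-- Both parts of the norm of the pressure scale like `h ^ (n + 1 - 2)`. -/
lemma pressureNorm_sq_le {a : ℝ} (hT : T.IsScaled a) :
    T.pressureNorm Ω q ^ 2 ≤ ((n + 1) ^ (n + 1) / a ^ 2 + (n + 1) ^ (2 * n)) *
      (T.h ^ (n + 1) / T.h ^ 2) * J.energy := by
  set C₁ : ℝ := (n + 1) ^ (n + 1) / a ^ 2 with hC₁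
  set C₂ : ℝ := (n + 1) ^ (2 * n) with hC₂
  have h1 : 0 ≤ C₁ := by positivity
  have h2 : 0 ≤ C₂ := by positivity
  rw [pressureNorm, Real.sq_sqrt, energy, ← Finset.sum_add_distrib, Finset.mul_sum]
  · refine Finset.sum_le_sum fun i _ => ?_
    have hh := T.h_pos i
    set g := T.h ^ (n + 1) / T.h ^ 2 with hg
    have hg0 : 0 ≤ g := by positivity
    have hD0 : 0 ≤ ∫ x in refCell κ (n + 1), ‖evalVec (gradP (J.r i)) x‖ ^ 2 :=
      integral_nonneg fun _ => by positivity
    have hJ0 : ∀ j, 0 ≤ ∫ y in refCell κ n, evalPoly (J.p i j) y ^ 2 := fun j =>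
      integral_nonneg fun _ => by positivity
    have e1 : (if T.IsInner Ω i then ∫ x in interior (T.cell i), ‖gradient (q i) x‖ ^ 2 else 0) ≤
        C₁ * g * ∫ x in refCell κ (n + 1), ‖evalVec (gradP (J.r i)) x‖ ^ 2 := by
      split_ifs with hi
      · exact hT.integral_gradient_sq_le i (J.r_eval i hi)
      · positivity
    have e2 : (∑ j, if i < j ∧ T.IsInner Ω i ∧ T.IsInner Ω j ∧ T.ShareFacet i j then
        T.h⁻¹ * ∫ x in T.cell i ∩ T.cell j, (q i x - q j x) ^ 2 ∂μHE[n + 1 - 1] else 0) ≤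
        C₂ * g * ∑ j ∈ J.N i, ∫ y in refCell κ n, evalPoly (J.p i j) y ^ 2 := by
      rw [Finset.mul_sum, ← Finset.sum_filter]
      refine (Finset.sum_le_sum (g := fun j => C₂ * g *
        ∫ y in refCell κ n, evalPoly (J.p i j) y ^ 2) fun j hj => ?_).trans
        (Finset.sum_le_sum_of_subset_of_nonneg (fun j hj => ?_)
          fun j _ _ => mul_nonneg (mul_nonneg h2 hg0) (hJ0 j))
      · have hj' := (Finset.mem_filter.1 hj).2
        have hjN : j ∈ J.N i := (J.mem_N i j).2 ⟨hj'.1.ne, hj'.2⟩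
        have h3 := hT.integral_facet_sq_le i (J.f i j) (g := fun x => q i x - q j x)
          fun y hy => (J.p_eval i j hjN y hy).symm
        rw [← Set.image_image (T.F i) (facetMap κ (J.f i j)), ← J.image_eq i j hjN] at h3
        calc _ ≤ T.h⁻¹ * ((n + 1) ^ (2 * n) * T.h ^ n *
              ∫ y in refCell κ n, evalPoly (J.p i j) y ^ 2) :=
              mul_le_mul_of_nonneg_left h3 (by positivity)
          _ = _ := by rw [hg, hC₂, pow_succ T.h n]; field_simp
      · have hj' := (Finset.mem_filter.1 hj).2
        exact (J.mem_N i j).2 ⟨hj'.1.ne, hj'.2⟩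
    have hS0 : 0 ≤ ∑ j ∈ J.N i, ∫ y in refCell κ n, evalPoly (J.p i j) y ^ 2 :=
      Finset.sum_nonneg fun j _ => hJ0 j
    refine (add_le_add e1 e2).trans ?_
    nlinarith [mul_nonneg (mul_nonneg h2 hg0) hD0, mul_nonneg (mul_nonneg h1 hg0) hS0]
  · refine add_nonneg (Finset.sum_nonneg fun i _ => ?_)
      (Finset.sum_nonneg fun i _ => Finset.sum_nonneg fun j _ => ?_)
    · split_ifs
      · exact integral_nonneg fun _ => by positivity
      · exact le_rfl
    · split_ifs
      · have := T.h_pos i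
        exact mul_nonneg (by positivity) (integral_nonneg fun _ => by positivity)
      · exact le_rfl

end JumpData

/-! ### The inf-sup condition -/

/-- Before normalization: a velocity supported on the interior elements whose pairing with the
pressure and whose norm are comparable to the energy of the pressure. -/
lemma exists_velocity_of_isScaled (κ : CellKind) (n k : ℕ) {a : ℝ} (ha : 0 < a) :
    ∃ C : ℝ, 0 < C ∧ ∀ (Ω ΓN : Set (Pt (n + 1))) (T : Mesh κ (n + 1)),
      IsOpen Ω → (∃ U, IsOpen U ∧ ΓN = U ∩ frontier Ω) → Ω ⊆ T.domain → T.IsScaled a →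
      ∀ q ∈ T.pressureSpace k,
        ∃ w : Fin T.card → Fin (n + 1) → MvPolynomial (Fin (n + 1)) ℝ,
          (∀ i, w i ∈ rtPoly κ (n + 1) k) ∧ (∀ i, ¬ T.IsInner Ω i → w i = 0) ∧
          (∀ t : ℝ, IsWeakDiv T.domain (T.glue fun i => T.piola i (t • w i))
            (T.glue fun i => T.piolaDiv i (t • w i))) ∧
          0 ≤ ∑ i, ∫ x in refCell κ (n + 1), evalPoly (divP (w i)) x * q i (T.F i x) ∧
          T.pressureNorm Ω q *
              √(∫ x in T.domain, ‖T.glue (fun i => T.piola i (w i)) x‖ ^ 2) ≤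
            C * ∑ i, ∫ x in refCell κ (n + 1), evalPoly (divP (w i)) x * q i (T.F i x) ∧
          T.pressureNorm Ω q ^ 2 ≤ C * (T.h ^ (n + 1) / T.h ^ 2) *
            ∑ i, ∫ x in refCell κ (n + 1), evalPoly (divP (w i)) x * q i (T.F i x) := by
  obtain ⟨N₀, hN₀⟩ := exists_card_le_of_inter_nonempty κ n ha
  obtain ⟨M, C₀, hC₀, hest⟩ := exists_localField_estimates κ n k N₀
  set C₁ : ℝ := (n + 1) ^ (n + 1) / a ^ 2 + (n + 1) ^ (2 * n) with hC₁
  set C₂ : ℝ := (n + 1) ^ 2 / a ^ (n + 1) * C₀ with hC₂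
  have h1 : 0 < C₁ := by positivity
  have h2 : 0 < C₂ := by positivity
  refine ⟨4 * √(C₁ * C₂) + 4 * C₁, by positivity, fun Ω ΓN T hΩo hΓ hΩ hT q hq => ?_⟩
  obtain ⟨J⟩ := T.nonempty_jumpData (Ω := Ω) hq
  have hcard : ∀ i, (J.N i).card ≤ N₀ := fun i => hN₀ T hT i _ fun j hj => by
    rw [J.image_eq i j hj]
    exact (Set.Nonempty.image _ ⟨0, zero_mem_refCell κ n⟩).image _
  set b := ∑ i, ∫ x in refCell κ (n + 1), evalPoly (divP (J.field M i)) x * q i (T.F i x) with hb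
  have hE0 := J.energy_nonneg
  -- the facet terms contribute one half of the squared jumps, of which the interaction of the
  -- gradients with the facet fields consumes one quarter
  have hbE : 1 / 4 * J.energy ≤ b := by
    have e1 : ∀ i, ∫ x in refCell κ (n + 1), evalPoly (divP (J.field M i)) x * q i (T.F i x) =
        (∑ j ∈ J.N i, ∫ y in refCell κ n,
          evalPoly (J.p i j) y * evalPoly (J.r i) (facetMap κ (J.f i j) y)) -
        ∫ x in refCell κ (n + 1), fderiv ℝ (evalPoly (J.r i)) x (evalVec (J.field M i) x) := by
      intro i
      have e2 : ∫ x in refCell κ (n + 1), evalPoly (divP (J.field M i)) x * q i (T.F i x) =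
          ∫ x in refCell κ (n + 1), evalPoly (divP (J.field M i)) x * evalPoly (J.r i) x := by
        by_cases hi : T.IsInner Ω i
        · refine setIntegral_congr_fun (measurableSet_refCell κ _) fun x hx => ?_
          simp only [J.r_eval i hi x hx]
        · have h3 : divP (0 : Fin (n + 1) → MvPolynomial (Fin (n + 1)) ℝ) = 0 := by simp [divP]
          simp [J.field_eq_zero M i hi, h3]
      have e3 := integral_flux_localField (κ := κ) M (J.r i) (J.N i) (J.f i) (J.p i)
        (contDiff_evalPoly (m := 1) (J.r i))
      rw [integral_add (integrableOn_refCell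
        (((contDiff_evalPoly (J.r i)).continuous_fderiv (n := 1) (by simp)).clm_apply
          (continuous_evalVec _))) (integrableOn_refCell (by fun_prop))] at e3
      rw [e2, ← e3, JumpData.field]
      ring
    have e4 := J.sum_flux_pressure
    have e5 : ∑ i, (1 / 4 * (∫ x in refCell κ (n + 1), ‖evalVec (gradP (J.r i)) x‖ ^ 2) -
        1 / 4 * ∑ j ∈ J.N i, ∫ y in refCell κ n, evalPoly (J.p i j) y ^ 2) ≤
        ∑ i, -∫ x in refCell κ (n + 1),
          fderiv ℝ (evalPoly (J.r i)) x (evalVec (J.field M i) x) :=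
      Finset.sum_le_sum fun i _ => (hest (J.r i) (J.N i) (J.f i) (J.p i) (J.r_mem i) (hcard i)).2
    rw [Finset.sum_sub_distrib, ← Finset.mul_sum, ← Finset.mul_sum, Finset.sum_neg_distrib] at e5
    rw [hb, Finset.sum_congr rfl fun i _ => e1 i, Finset.sum_sub_distrib, e4, JumpData.energy,
      Finset.sum_add_distrib]
    linarith
  have hV : ∫ x in T.domain, ‖T.glue (fun i => T.piola i (J.field M i)) x‖ ^ 2 ≤
      C₂ * (T.h ^ 2 / T.h ^ (n + 1)) * J.energy := by
    rw [T.integral_norm_glue_sq, JumpData.energy, Finset.mul_sum]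
    refine Finset.sum_le_sum fun i _ => ?_
    have hh := T.h_pos i
    refine (hT.integral_piola_sq_le i fun x hx => T.piola_F i _ hx).trans ?_
    calc _ ≤ (n + 1) ^ 2 / a ^ (n + 1) * (T.h ^ 2 / T.h ^ (n + 1)) * (C₀ * _) :=
          mul_le_mul_of_nonneg_left
            (hest (J.r i) (J.N i) (J.f i) (J.p i) (J.r_mem i) (hcard i)).1 (by positivity)
      _ = _ := by rw [hC₂]; ring
  have hP := J.pressureNorm_sq_le hT
  have hh0 : 0 ≤ T.h := Real.iSup_nonneg fun i => Metric.diam_nonneg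
  have hb0 : 0 ≤ b := by linarith
  refine ⟨J.field M, J.field_mem M, J.field_eq_zero M,
    fun t => T.isWeakDiv_glue_piola _ (J.field_flux M t), hb0, ?_, ?_⟩
  · -- the powers of `h` in the bounds of the two factors cancel
    have hsq : (T.pressureNorm Ω q *
        √(∫ x in T.domain, ‖T.glue (fun i => T.piola i (J.field M i)) x‖ ^ 2)) ^ 2 ≤
        (4 * √(C₁ * C₂) * b) ^ 2 := by
      rw [mul_pow, Real.sq_sqrt (integral_nonneg fun x => by positivity)]
      have hgg : T.h ^ (n + 1) / T.h ^ 2 * (T.h ^ 2 / T.h ^ (n + 1)) ≤ 1 := by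
        rcases hh0.eq_or_lt with h | h
        · simp [← h]
        · exact le_of_eq (by field_simp)
      calc _ ≤ (C₁ * (T.h ^ (n + 1) / T.h ^ 2) * J.energy) *
            (C₂ * (T.h ^ 2 / T.h ^ (n + 1)) * J.energy) := by
            refine mul_le_mul hP hV (integral_nonneg fun x => by positivity) ?_
            positivity
        _ = C₁ * C₂ * J.energy ^ 2 *
            (T.h ^ (n + 1) / T.h ^ 2 * (T.h ^ 2 / T.h ^ (n + 1))) := by ring
        _ ≤ C₁ * C₂ * J.energy ^ 2 * 1 := by gcongr
        _ ≤ C₁ * C₂ * (4 * b) ^ 2 * 1 := by gcongr; linarith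
        _ = _ := by rw [mul_pow, mul_pow, mul_pow, Real.sq_sqrt (by positivity)]; ring
    have h3 := le_of_sq_le_sq hsq (by positivity)
    nlinarith [mul_nonneg h1.le hb0]
  · refine hP.trans ?_
    have hg0 : 0 ≤ T.h ^ (n + 1) / T.h ^ 2 := by positivity
    have hEb : J.energy ≤ 4 * b := by linarith
    calc _ ≤ C₁ * (T.h ^ (n + 1) / T.h ^ 2) * (4 * b) := by gcongr
      _ = 4 * C₁ * ((T.h ^ (n + 1) / T.h ^ 2) * b) := by ring
      _ ≤ (4 * √(C₁ * C₂) + 4 * C₁) * ((T.h ^ (n + 1) / T.h ^ 2) * b) := by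
          gcongr; linarith [Real.sqrt_nonneg (C₁ * C₂)]
      _ = _ := by ring

/-- The inf-sup condition in every dimension, with a constant depending only on the bi-Lipschitz
constant of the element maps at scale `h`. -/
lemma infSup_of_isScaled (κ : CellKind) (n k : ℕ) {a : ℝ} (ha : 0 < a) :
    ∃ β : ℝ, 0 < β ∧ ∀ (Ω ΓN : Set (Pt (n + 1))) (T : Mesh κ (n + 1)),
      IsOpen Ω → (∃ U, IsOpen U ∧ ΓN = U ∩ frontier Ω) → Ω ⊆ T.domain → T.IsScaled a →
      ∀ q ∈ T.pressureSpace k,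
        ((β * T.pressureNorm Ω q : ℝ) : EReal) ≤
            ⨆ v ∈ T.velocitySpace k, ((T.b₁ Ω ΓN v q / T.velocityNorm Ω ΓN v : ℝ) : EReal) ∧
        ∃ v ∈ T.velocitySpace k,
          (∀ i, ¬ T.IsInner Ω i → ∀ x ∈ T.cell i, v i x = 0) ∧
          T.b₁ Ω ΓN v q = T.pressureNorm Ω q ^ 2 ∧
          β * T.velocityNorm Ω ΓN v ≤ T.pressureNorm Ω q := by
  obtain ⟨C, hC, hvel⟩ := exists_velocity_of_isScaled κ n k ha
  refine ⟨1 / C, by positivity, fun Ω ΓN T hΩo hΓ hΩ hT q hq => ?_⟩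
  obtain ⟨w, hw, hw0, hdiv, hb0, hPV, hPb⟩ := hvel Ω ΓN T hΩo hΓ hΩ hT q hq
  set b := ∑ i, ∫ x in refCell κ (n + 1), evalPoly (divP (w i)) x * q i (T.F i x) with hb
  set P := T.pressureNorm Ω q with hPdef
  have hP0 : 0 ≤ P := Real.sqrt_nonneg _
  -- normalization; if `b = 0` then `P = 0` as well and `t = 0`
  set t := P ^ 2 / b with ht
  have ht0 : 0 ≤ t := by positivity
  have htb : t * b = P ^ 2 := by
    by_cases h : b = 0
    · rw [h, mul_zero] at hPb ⊢
      exact (le_antisymm hPb (sq_nonneg _)).symm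
    · rw [ht, div_mul_cancel₀ _ h]
  have hmem : (fun i => T.piola i (t • w i)) ∈ T.velocitySpace k :=
    T.piola_mem_velocitySpace (fun i => smul_mem_rtPoly t (hw i)) (hdiv t)
  have hzero : ∀ i, ¬ T.IsInner Ω i → t • w i = 0 := fun i hi => by rw [hw0 i hi, smul_zero]
  have hint : ∀ i, ¬ T.IsInner Ω i → ∀ x ∈ T.cell i, T.piola i (t • w i) x = 0 :=
    fun i hi x _ => T.piola_eq_zero_of_not_inner (w := fun i => t • w i) hzero i hi x
  have hb₁ : T.b₁ Ω ΓN (fun i => T.piola i (t • w i)) q = P ^ 2 := by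
    rw [T.b₁_piola hΓ hΩo hΩ hq hzero (hdiv t), ← htb, hb, Finset.mul_sum]
    refine Finset.sum_congr rfl fun i _ => ?_
    rw [← integral_const_mul]
    simp only [divP_smul, evalPoly_smul, mul_assoc]
  set V₀ := √(∫ x in T.domain, ‖T.glue (fun i => T.piola i (w i)) x‖ ^ 2) with hV₀
  have hV : T.velocityNorm Ω ΓN (fun i => T.piola i (t • w i)) = t * V₀ := by
    rw [T.velocityNorm_eq_of_interior hΓ hint, T.integral_norm_glue_sq, hV₀,
      T.integral_norm_glue_sq]
    simp only [piola_smul, norm_smul, mul_pow, integral_const_mul, ← Finset.mul_sum]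
    rw [Real.sqrt_mul (by positivity), Real.sqrt_sq (norm_nonneg _), Real.norm_of_nonneg ht0]
  have hbound : 1 / C * T.velocityNorm Ω ΓN (fun i => T.piola i (t • w i)) ≤ P := by
    rw [hV]
    by_cases hP : P = 0
    · simp [ht, hP]
    have hPpos : 0 < P := lt_of_le_of_ne hP0 (Ne.symm hP)
    refine le_of_mul_le_mul_right ?_ hPpos
    calc 1 / C * (t * V₀) * P = 1 / C * t * (P * V₀) := by ring
      _ ≤ 1 / C * t * (C * b) := by gcongr
      _ = t * b := by field_simp
      _ = P * P := by rw [htb, sq]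
  refine ⟨?_, _, hmem, hint, hb₁, hbound⟩
  refine le_iSup₂_of_le _ hmem (EReal.coe_le_coe_iff.2 ?_)
  rw [hb₁]
  by_cases hVz : T.velocityNorm Ω ΓN (fun i => T.piola i (t • w i)) = 0
  · have h1 := T.b₁_eq_zero_of_velocityNorm_eq_zero hΓ hΩ q hint hmem.2.1 hVz
    rw [hb₁] at h1
    have h2 : P = 0 := pow_eq_zero_iff (two_ne_zero) |>.1 h1
    simp [h2]
  · have hVpos : 0 < T.velocityNorm Ω ΓN (fun i => T.piola i (t • w i)) :=
      lt_of_le_of_ne (Real.sqrt_nonneg _) (Ne.symm hVz)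
    rw [le_div_iff₀ hVpos]
    nlinarith

end Mesh

end CutFEM

theorem mainTheorem6 (κ : CutFEM.CellKind) (d : ℕ) (hd : d = 2 ∨ d = 3) (k : ℕ)
    (σ τ : ℝ) (hσ : 0 < σ) (hτ : 0 < τ) :
    ∃ β₁ : ℝ, 0 < β₁ ∧
      ∀ (Ω ΓN : Set (CutFEM.Pt d)) (T : CutFEM.Mesh κ d),
        CutFEM.IsLipschitzDomain Ω →
        (∃ U : Set (CutFEM.Pt d), IsOpen U ∧ ΓN = U ∩ frontier Ω) →
        closure Ω ⊂ T.domain →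
        T.ShapeRegular σ →
        T.QuasiUniform τ →
        ∀ q ∈ T.pressureSpace k,
          ((β₁ * T.pressureNorm Ω q : ℝ) : EReal) ≤
              ⨆ v ∈ T.velocitySpace k,
                ((T.b₁ Ω ΓN v q / T.velocityNorm Ω ΓN v : ℝ) : EReal) ∧
          ∃ v ∈ T.velocitySpace k,
            (∀ i, ¬ T.IsInner Ω i → ∀ x ∈ T.cell i, v i x = 0) ∧
            T.b₁ Ω ΓN v q = T.pressureNorm Ω q ^ 2 ∧
            β₁ * T.velocityNorm Ω ΓN v ≤ T.pressureNorm Ω q := by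
  obtain ⟨n, rfl⟩ : ∃ n, d = n + 1 := by rcases hd with rfl | rfl <;> exact ⟨_, rfl⟩
  have ha : 0 < τ / (σ * (1 + 2 * √((n + 1 : ℕ) : ℝ))) := by positivity
  obtain ⟨β, hβ, h⟩ := CutFEM.Mesh.infSup_of_isScaled κ n k ha
  exact ⟨β, hβ, fun Ω ΓN T hΩ hΓ hsub hσT hτT q hq =>
    h Ω ΓN T hΩ.isOpen hΓ (subset_closure.trans hsub.subset) (T.isScaled hσ hτ hσT hτT) q hq⟩
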